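/- Let $n\ge 2$. For $\underline p=(a_1,\dots,a_n,b_1,\dots,b_n,c_2,\dots,c_n)\in\mathbb Z^{3n-1}$ put $$L(\underline p)=\int_{[0,1]^n}\frac{\prod_{k=1}^n x_k^{a_k}(1-x_k)^{b_k}}{\prod_{k=2}^n\delta_k(\underline x)^{c_k}}\,\frac{dx_1\cdots dx_n}{\delta_n(\underline x)}\in(0,\infty],\qquad \delta_0=1,\quad \delta_k=1-x_k\delta_{k-1}.$$ Let $\mathcal E\subset\mathbb Z^{3n-1}$ be the subgroup defined by $c_2=\dots=c_{n-1}=0$, together with $a_1+b_2=a_3+b_3$ if $n=3$, and with $a_2=b_1$, $b_n=c_n$ and $a_k+b_{k+1}=a_{k+2}+b_{k+2}$ for $1\le k\le n-2$ if $n\ge4$. The following maps induce automorphisms of $\mathcal E$: * $\sigma$ exchanges $a_1$ and $b_2$, as well as $a_2$ and $b_1$, and fixes the other coordinates; * $\psi$ sends $\underline p$ to $\underline p'$, where $a'_k=a_{n+1-k}$ for $1\le k\le n$; $b'_1=a_{n-1}+b_n-c_n$ and $b'_k=b_{n+2-k}$ for $2\le k\le n$; $c'_k=a_{n+2-k}+b_{n+2-k}+c_{n+1-k}-b_{n+1-k}-a_{n-k}$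 for $2\le k\le n-1$; and $c'_n=a_2+b_2-b_1$; * $\varphi$ exchanges $a_{n-1}$ and $c_n$, replaces $b_{n-1}$ by $a_{n-1}+b_{n-1}-c_n$ and $b_n$ by $a_{n-1}+b_n-c_n$, and fixes the other coordinates. Let $G$ be the group of automorphisms of $\mathcal E$ generated by $\sigma,\psi,\varphi$. **Theorem.** The family $(L(\underline p))_{\underline p\in\mathcal E}$ admits $G$ as a Rhin–Viola group: one has $L(\underline p)>0$ for all $\underline p\in\mathcal E$, and $L(g\underline p)/L(\underline p)$ is a non-zero rational number (with $\infty/\infty=1$) for all $g\in G$ and all $\underline p\in\mathcal E$ such that $L(\underline p)$ and $L(g\underline p)$ are both finite or both infinite. For all $\underline p\in\mathcal E$ one has $L(\sigma\underline p)=L(\psi\underline p)=L(\underline p)$ in $(0,\infty]$, and $$L(\underline p)=\frac{a_{n-1}!\,b_{n-1}!}{c_n!\,(a_{n-1}+b_{n-1}-c_n)!}\,L(\varphi\underline p)$$ in $(0,\infty]$ whenever $a_{n-1},\,b_{n-1},\,c_n,\,a_{n-1}+b_{n-1}-c_n\ge0$. More precisely, say that $G$ leaves $L(\underline p)/\prod_i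 m_i(\underline p)!$ invariant if all the integers $m_i(\underline p)$ are nonnegative whenever $L(\underline p)$ is finite, and the quotient takes the same value at $\underline p$ and at $g\underline p$ whenever $g\in G$ and $L(\underline p)$, $L(g\underline p)$ are both finite. Then: * If $n\ge4$, $G$ is isomorphic to $(\mathfrak S_3\times\mathfrak S_3)\rtimes\mathbb Z/2\mathbb Z$, where $\mathbb Z/2\mathbb Z$ exchanges the two factors, hence has order $72$. It leaves invariant $\dfrac{L(\underline p)}{a_{n-1}!\,b_{n-1}!\,a_2!\,b_3!}$ if $n\ge5$, and $\dfrac{L(\underline p)}{a_3!\,b_3!\,a_2!}$ if $n=4$. * If $n=3$, $G$ is isomorphic to $H\rtimes\mathfrak S_5$, where $H$ is the hyperplane $\varepsilon_1+\dots+\varepsilon_5=0$ of $(\mathbb Z/2\mathbb Z)^5$, on which $\mathfrak S_5$ acts by permuting the coordinates. It leaves invariant $\dfrac{L(\underline p)}{a_1!\,a_2!\,a_3!\,b_1!\,b_2!\,b_3!\,(a_2+b_3-c_3)!\,(b_1+b_3-c_3)!}$. * If $n=2$, $G$ is isomorphic to $\mathfrak S_5$. It leaves invariant $\dfrac{L(\underline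 p)}{a_1!\,a_2!\,b_1!\,b_2!\,(a_1+b_2-c_2)!}$. -/

import Mathlib

open MeasureTheory
open scoped ENNReal

namespace RhinViola

/-! ### Parameters `(a_1,…,a_n,b_1,…,b_n,c_2,…,c_n) ∈ ℤ^(3n-1)` -/

/-- The lattice `ℤ^(3n-1)` of parameters `(a_1,…,a_n,b_1,…,b_n,c_2,…,c_n)`. -/
abbrev Param (n : ℕ) : Type := (Fin n → ℤ) × (Fin n → ℤ) × (Fin (n - 1) → ℤ)

/-- `p.a k` is the coordinate `a_k`, for `1 ≤ k ≤ n` (and `0` for other `k`). -/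
def Param.a {n : ℕ} (p : Param n) (k : ℕ) : ℤ :=
  if h : 1 ≤ k ∧ k ≤ n then p.1 ⟨k - 1, by omega⟩ else 0

/-- `p.b k` is the coordinate `b_k`, for `1 ≤ k ≤ n` (and `0` for other `k`). -/
def Param.b {n : ℕ} (p : Param n) (k : ℕ) : ℤ :=
  if h : 1 ≤ k ∧ k ≤ n then p.2.1 ⟨k - 1, by omega⟩ else 0

/-- `p.c k` is the coordinate `c_k`, for `2 ≤ k ≤ n` (and `0` for other `k`). -/
def Param.c {n : ℕ} (p : Param n) (k : ℕ) : ℤ :=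
  if h : 2 ≤ k ∧ k ≤ n then p.2.2 ⟨k - 2, by omega⟩ else 0

/-- The parameter with coordinates `a_k = A k`, `b_k = B k` (`1 ≤ k ≤ n`) and
`c_k = C k` (`2 ≤ k ≤ n`). -/
def Param.of (n : ℕ) (A B C : ℕ → ℤ) : Param n :=
  (fun i => A (i + 1), fun i => B (i + 1), fun i => C (i + 2))

section Coordinates

variable {n : ℕ}

theorem Param.a_of (A B C : ℕ → ℤ) (k : ℕ) :
    (Param.of n A B C).a k = if 1 ≤ k ∧ k ≤ n then A k else 0 := by
  unfold Param.a Param.of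
  split_ifs with h
  · simp only
    congr 1
    omega
  · rfl

theorem Param.b_of (A B C : ℕ → ℤ) (k : ℕ) :
    (Param.of n A B C).b k = if 1 ≤ k ∧ k ≤ n then B k else 0 := by
  unfold Param.b Param.of
  split_ifs with h
  · simp only
    congr 1
    omega
  · rfl

theorem Param.c_of (A B C : ℕ → ℤ) (k : ℕ) :
    (Param.of n A B C).c k = if 2 ≤ k ∧ k ≤ n then C k else 0 := by
  unfold Param.c Param.of
  split_ifs with h
  · simp only
    congr 1
    omega
  · rfl

theorem Param.of_self (p : Param n) : Param.of n p.a p.b p.c = p := by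
  refine Prod.ext ?_ (Prod.ext ?_ ?_)
  · funext i
    simp [Param.of, Param.a]
  · funext i
    simp [Param.of, Param.b]
  · funext i
    have := i.2
    simp [Param.of, Param.c]
    omega

theorem Param.of_congr {A B C A' B' C' : ℕ → ℤ}
    (ha : ∀ k, 1 ≤ k → k ≤ n → A k = A' k) (hb : ∀ k, 1 ≤ k → k ≤ n → B k = B' k)
    (hc : ∀ k, 2 ≤ k → k ≤ n → C k = C' k) : Param.of n A B C = Param.of n A' B' C' := by
  refine Prod.ext ?_ (Prod.ext ?_ ?_)
  · funext i
    exact ha _ (by omega) (by omega)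
  · funext i
    exact hb _ (by omega) (by omega)
  · funext i
    have := i.2
    exact hc _ (by omega) (by omega)

theorem Param.a_add (p q : Param n) (k : ℕ) : (p + q).a k = p.a k + q.a k := by
  unfold Param.a; split_ifs <;> simp

theorem Param.b_add (p q : Param n) (k : ℕ) : (p + q).b k = p.b k + q.b k := by
  unfold Param.b; split_ifs <;> simp

theorem Param.c_add (p q : Param n) (k : ℕ) : (p + q).c k = p.c k + q.c k := by
  unfold Param.c; split_ifs <;> simp

theorem Param.a_smul (m : ℤ) (p : Param n) (k : ℕ) : (m • p).a k = m * p.a k := by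
  unfold Param.a; split_ifs <;> simp

theorem Param.b_smul (m : ℤ) (p : Param n) (k : ℕ) : (m • p).b k = m * p.b k := by
  unfold Param.b; split_ifs <;> simp

theorem Param.c_smul (m : ℤ) (p : Param n) (k : ℕ) : (m • p).c k = m * p.c k := by
  unfold Param.c; split_ifs <;> simp

theorem Param.of_add (A B C A' B' C' : ℕ → ℤ) :
    Param.of n A B C + Param.of n A' B' C'
      = Param.of n (fun k => A k + A' k) (fun k => B k + B' k) (fun k => C k + C' k) := rfl

theorem Param.of_smul (m : ℤ) (A B C : ℕ → ℤ) :
    m • Param.of n A B C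
      = Param.of n (fun k => m * A k) (fun k => m * B k) (fun k => m * C k) := rfl

end Coordinates

/-! ### The integrals -/

/-- `coord x k` is the coordinate `x_k` of `x = (x_1,…,x_n)`, for `1 ≤ k ≤ n`. -/
noncomputable def coord {n : ℕ} (x : Fin n → ℝ) (k : ℕ) : ℝ :=
  if h : 1 ≤ k ∧ k ≤ n then x ⟨k - 1, by omega⟩ else 0

/-- `δ_0 = 1` and `δ_k = 1 - x_k δ_{k-1}`. -/
noncomputable def delta {n : ℕ} (x : Fin n → ℝ) : ℕ → ℝ
  | 0 => 1
  | k + 1 => 1 - coord x (k + 1) * delta x k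

/-- The (possibly infinite) integral `L(p)` over `[0,1]^n` of the nonnegative function
`∏_{k=1}^n x_k^{a_k} (1-x_k)^{b_k} / ∏_{k=2}^n δ_k^{c_k} · 1/δ_n`. -/
noncomputable def L {n : ℕ} (p : Param n) : ℝ≥0∞ :=
  ∫⁻ x in Set.Icc (0 : Fin n → ℝ) 1,
    ENNReal.ofReal
      ((∏ k ∈ Finset.Icc 1 n, coord x k ^ p.a k * (1 - coord x k) ^ p.b k)
        / (∏ k ∈ Finset.Icc 2 n, delta x k ^ p.c k) * (1 / delta x n))

/-! ### The transformations and the sublattice `𝓔` -/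

/-- `σ` exchanges `a_1` and `b_2`, as well as `a_2` and `b_1`, and fixes the rest. -/
def sigmaMap (n : ℕ) : Param n →ₗ[ℤ] Param n where
  toFun p := Param.of n
    (fun k => if k = 1 then p.b 2 else if k = 2 then p.b 1 else p.a k)
    (fun k => if k = 1 then p.a 2 else if k = 2 then p.a 1 else p.b k)
    p.c
  map_add' p q := by
    rw [Param.of_add]
    apply Param.of_congr <;> intro k _ _ <;>
      simp only [Param.a_add, Param.b_add, Param.c_add] <;> split_ifs <;> rfl
  map_smul' m p := by
    rw [RingHom.id_apply, Param.of_smul]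
    apply Param.of_congr <;> intro k _ _ <;>
      simp only [Param.a_smul, Param.b_smul, Param.c_smul] <;> split_ifs <;> rfl

/-- `ψ` : `a'_k = a_{n+1-k}` for `1 ≤ k ≤ n`, `b'_k = b_{n+2-k}` for `2 ≤ k ≤ n`,
`b'_1 = a_{n-1} + b_n - c_n`,
`c'_k = a_{n+2-k} + b_{n+2-k} + c_{n+1-k} - b_{n+1-k} - a_{n-k}` for `2 ≤ k ≤ n-1` and
`c'_n = a_2 + b_2 - b_1`. -/
def psiMap (n : ℕ) : Param n →ₗ[ℤ] Param n where
  toFun p := Param.of n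
    (fun k => p.a (n + 1 - k))
    (fun k => if k = 1 then p.a (n - 1) + p.b n - p.c n else p.b (n + 2 - k))
    (fun k => if k = n then p.a 2 + p.b 2 - p.b 1
      else p.a (n + 2 - k) + p.b (n + 2 - k) + p.c (n + 1 - k)
        - p.b (n + 1 - k) - p.a (n - k))
  map_add' p q := by
    rw [Param.of_add]
    apply Param.of_congr <;> intro k _ _ <;>
      simp only [Param.a_add, Param.b_add, Param.c_add] <;> split_ifs <;> ring
  map_smul' m p := by
    rw [RingHom.id_apply, Param.of_smul]
    apply Param.of_congr <;> intro k _ _ <;>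
      simp only [Param.a_smul, Param.b_smul, Param.c_smul] <;> split_ifs <;> ring

/-- `φ` fixes every coordinate, except `a_{n-1}` and `c_n`, which it exchanges, `b_{n-1}`,
which it replaces by `a_{n-1} + b_{n-1} - c_n`, and `b_n`, which it replaces by
`a_{n-1} + b_n - c_n`. -/
def phiMap (n : ℕ) : Param n →ₗ[ℤ] Param n where
  toFun p := Param.of n
    (fun k => if k = n - 1 then p.c n else p.a k)
    (fun k => if k = n - 1 then p.a (n - 1) + p.b (n - 1) - p.c n
      else if k = n then p.a (n - 1) + p.b n - p.c n else p.b k)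
    (fun k => if k = n then p.a (n - 1) else p.c k)
  map_add' p q := by
    rw [Param.of_add]
    apply Param.of_congr <;> intro k _ _ <;>
      simp only [Param.a_add, Param.b_add, Param.c_add] <;> split_ifs <;> ring
  map_smul' m p := by
    rw [RingHom.id_apply, Param.of_smul]
    apply Param.of_congr <;> intro k _ _ <;>
      simp only [Param.a_smul, Param.b_smul, Param.c_smul] <;> split_ifs <;> ring

/-- The set `𝓔` : `c_2 = … = c_{n-1} = 0`, and moreover `a_1 + b_2 = a_3 + b_3` if `n = 3`, and
`a_2 = b_1`, `b_n = c_n`, `a_k + b_{k+1} = a_{k+2} + b_{k+2}` for `1 ≤ k ≤ n-2` if `n ≥ 4`. -/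
def E (n : ℕ) : Submodule ℤ (Param n) where
  carrier := {p | (∀ k, 2 ≤ k → k ≤ n - 1 → p.c k = 0) ∧
    (n = 3 → p.a 1 + p.b 2 = p.a 3 + p.b 3) ∧
    (4 ≤ n → p.a 2 = p.b 1 ∧ p.b n = p.c n ∧
      ∀ k, 1 ≤ k → k ≤ n - 2 → p.a k + p.b (k + 1) = p.a (k + 2) + p.b (k + 2))}
  add_mem' := by
    rintro p q ⟨hp1, hp2, hp3⟩ ⟨hq1, hq2, hq3⟩
    simp only [Set.mem_ofPred_eq, Param.a_add, Param.b_add, Param.c_add]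
    refine ⟨fun k h1 h2 => by rw [hp1 k h1 h2, hq1 k h1 h2, add_zero],
      fun h => by linarith [hp2 h, hq2 h], fun h => ⟨by linarith [(hp3 h).1, (hq3 h).1],
        by linarith [(hp3 h).2.1, (hq3 h).2.1],
        fun k h1 h2 => by linarith [(hp3 h).2.2 k h1 h2, (hq3 h).2.2 k h1 h2]⟩⟩
  zero_mem' := by
    simp [Param.a, Param.b, Param.c]
  smul_mem' := by
    rintro m p ⟨hp1, hp2, hp3⟩
    simp only [Set.mem_ofPred_eq, Param.a_smul, Param.b_smul, Param.c_smul]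
    refine ⟨fun k h1 h2 => by rw [hp1 k h1 h2, mul_zero],
      fun h => by rw [← mul_add, ← mul_add, hp2 h], fun h => ⟨by rw [(hp3 h).1],
        by rw [(hp3 h).2.1],
        fun k h1 h2 => by rw [← mul_add, ← mul_add, (hp3 h).2.2 k h1 h2]⟩⟩

theorem mem_E {n : ℕ} (p : Param n) : p ∈ E n ↔
    (∀ k, 2 ≤ k → k ≤ n - 1 → p.c k = 0) ∧
    (n = 3 → p.a 1 + p.b 2 = p.a 3 + p.b 3) ∧
    (4 ≤ n → p.a 2 = p.b 1 ∧ p.b n = p.c n ∧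
      ∀ k, 1 ≤ k → k ≤ n - 2 → p.a k + p.b (k + 1) = p.a (k + 2) + p.b (k + 2)) := Iff.rfl

section Maps

variable {n : ℕ}

theorem sigmaMap_apply (p : Param n) : sigmaMap n p = Param.of n
    (fun k => if k = 1 then p.b 2 else if k = 2 then p.b 1 else p.a k)
    (fun k => if k = 1 then p.a 2 else if k = 2 then p.a 1 else p.b k) p.c := rfl

theorem psiMap_apply (p : Param n) : psiMap n p = Param.of n
    (fun k => p.a (n + 1 - k))
    (fun k => if k = 1 then p.a (n - 1) + p.b n - p.c n else p.b (n + 2 - k))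
    (fun k => if k = n then p.a 2 + p.b 2 - p.b 1
      else p.a (n + 2 - k) + p.b (n + 2 - k) + p.c (n + 1 - k)
        - p.b (n + 1 - k) - p.a (n - k)) := rfl

theorem phiMap_apply (p : Param n) : phiMap n p = Param.of n
    (fun k => if k = n - 1 then p.c n else p.a k)
    (fun k => if k = n - 1 then p.a (n - 1) + p.b (n - 1) - p.c n
      else if k = n then p.a (n - 1) + p.b n - p.c n else p.b k)
    (fun k => if k = n then p.a (n - 1) else p.c k) := rfl

theorem sigmaMap_invol (hn : 2 ≤ n) (p : Param n) : sigmaMap n (sigmaMap n p) = p := by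
  rw [sigmaMap_apply]
  conv_rhs => rw [← Param.of_self p]
  apply Param.of_congr <;> intro k h1 h2 <;>
    simp only [sigmaMap_apply, Param.a_of, Param.b_of, Param.c_of] <;> grind

theorem psiMap_invol (hn : 2 ≤ n) (p : Param n) : psiMap n (psiMap n p) = p := by
  rw [psiMap_apply]
  conv_rhs => rw [← Param.of_self p]
  apply Param.of_congr <;> intro k h1 h2 <;>
    simp only [psiMap_apply, Param.a_of, Param.b_of, Param.c_of]
  · rw [if_pos (by omega), show n + 1 - (n + 1 - k) = k by omega]
  · split_ifs <;> first | omega | skip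
    · rw [show n + 1 - (n - 1) = 2 by omega, show n + 2 - n = 2 by omega]
      grind
    · rw [show n + 2 - (n + 2 - k) = k by omega]
  · split_ifs <;> first | omega | skip
    · rw [show n + 1 - 2 = n - 1 by omega, show n + 2 - 2 = n by omega]
      grind
    · rw [show n + 1 - (n + 2 - k) = k - 1 by omega, show n + 2 - (n + 2 - k) = k by omega,
        show n + 2 - (n + 1 - k) = k + 1 by omega, show n + 1 - (n + 1 - k) = k by omega,
        show n - (n + 1 - k) = k - 1 by omega, show n + 1 - (n - k) = k + 1 by omega]
      ring

theorem phiMap_invol (hn : 2 ≤ n) (p : Param n) : phiMap n (phiMap n p) = p := by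
  rw [phiMap_apply]
  conv_rhs => rw [← Param.of_self p]
  apply Param.of_congr <;> intro k h1 h2 <;>
    simp only [phiMap_apply, Param.a_of, Param.b_of, Param.c_of] <;> grind

theorem sigmaMap_mem (hn : 2 ≤ n) (p : Param n) (hp : p ∈ E n) : sigmaMap n p ∈ E n := by
  rw [mem_E] at hp ⊢
  obtain ⟨h1, h2, h3⟩ := hp
  simp only [sigmaMap_apply, Param.a_of, Param.b_of, Param.c_of]
  refine ⟨?_, ?_, fun h => ⟨?_, ?_, ?_⟩⟩
  · grind
  · grind
  · grind
  · grind
  · grind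

theorem phiMap_mem (hn : 2 ≤ n) (p : Param n) (hp : p ∈ E n) : phiMap n p ∈ E n := by
  rw [mem_E] at hp ⊢
  obtain ⟨h1, h2, h3⟩ := hp
  simp only [phiMap_apply, Param.a_of, Param.b_of, Param.c_of]
  refine ⟨?_, ?_, fun h => ⟨?_, ?_, ?_⟩⟩
  · grind
  · grind
  · grind
  · grind
  · grind

theorem psiMap_mem (hn : 2 ≤ n) (p : Param n) (hp : p ∈ E n) : psiMap n p ∈ E n := by
  rw [mem_E] at hp ⊢
  obtain ⟨h1, h2, h3⟩ := hp
  simp only [psiMap_apply, Param.a_of, Param.b_of, Param.c_of]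
  refine ⟨fun k hk1 hk2 => ?_, fun h => ?_, fun h => ⟨?_, ?_, fun k hk1 hk2 => ?_⟩⟩
  · have hc := h1 (n + 1 - k) (by omega) (by omega)
    rw [if_pos (by omega), if_neg (by omega), hc]
    have key : p.a (n - k) + p.b (n - k + 1) = p.a (n - k + 2) + p.b (n - k + 2) := by
      rcases Nat.lt_or_ge n 4 with h4 | h4
      · obtain rfl : n = 3 := by omega
        obtain rfl : k = 2 := by omega
        exact h2 rfl
      · exact (h3 h4).2.2 (n - k) (by omega) (by omega)
    rw [show n + 2 - k = n - k + 2 by omega, show n + 1 - k = n - k + 1 by omega]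
    linarith
  · subst h
    have := h2 rfl
    norm_num
    linarith
  · obtain ⟨e1, e2, -⟩ := h3 h
    rw [show n + 1 - 2 = n - 1 by omega]
    split_ifs <;> omega
  · obtain ⟨e1, e2, -⟩ := h3 h
    rw [show n + 2 - n = 2 by omega]
    split_ifs <;> omega
  · have e := (h3 h).2.2 (n - 1 - k) (by omega) (by omega)
    rw [show n + 1 - k = n - 1 - k + 2 by omega,
      show n + 2 - (k + 1) = n - 1 - k + 2 by omega, show n + 1 - (k + 2) = n - 1 - k by omega,
      show n + 2 - (k + 2) = n - 1 - k + 1 by omega]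
    split_ifs <;> omega

end Maps

/-- The automorphism of `𝓔` induced by `σ`. -/
def sigma {n : ℕ} (hn : 2 ≤ n) : E n ≃ₗ[ℤ] E n :=
  LinearEquiv.ofInvolutive ((sigmaMap n).restrict (sigmaMap_mem hn))
    fun p => Subtype.ext (sigmaMap_invol hn p)

/-- The automorphism of `𝓔` induced by `ψ`. -/
def psi {n : ℕ} (hn : 2 ≤ n) : E n ≃ₗ[ℤ] E n :=
  LinearEquiv.ofInvolutive ((psiMap n).restrict (psiMap_mem hn))
    fun p => Subtype.ext (psiMap_invol hn p)

/-- The automorphism `φ` of `𝓔`. -/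
def phi {n : ℕ} (hn : 2 ≤ n) : E n ≃ₗ[ℤ] E n :=
  LinearEquiv.ofInvolutive ((phiMap n).restrict (phiMap_mem hn))
    fun p => Subtype.ext (phiMap_invol hn p)

theorem coe_sigma {n : ℕ} (hn : 2 ≤ n) (p : E n) :
    (sigma hn p : Param n) = sigmaMap n p := rfl

theorem coe_psi {n : ℕ} (hn : 2 ≤ n) (p : E n) :
    (psi hn p : Param n) = psiMap n p := rfl

theorem coe_phi {n : ℕ} (hn : 2 ≤ n) (p : E n) :
    (phi hn p : Param n) = phiMap n p := rfl

/-- The group `G` of automorphisms of `𝓔` generated by `σ`, `ψ` and `φ`. -/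
def G {n : ℕ} (hn : 2 ≤ n) : Subgroup (E n ≃ₗ[ℤ] E n) :=
  Subgroup.closure {sigma hn, psi hn, phi hn}

/-! ### Rhin–Viola groups and invariant quotients -/

/-- The quotient `x / y` in `[0,∞]`, with `∞ / ∞ = 1`. -/
noncomputable def quot (x y : ℝ≥0∞) : ℝ≥0∞ :=
  open Classical in if x = ⊤ ∧ y = ⊤ then 1 else x / y

/-- The family `(I p)` of elements of `ℝ_{>0} ∪ {∞}`, indexed by a `ℤ`-module `M`, admits `G` as a
Rhin–Viola group: `I (g p) / I p` (with `∞ / ∞ = 1`) is a non-zero rational number for all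
`g ∈ G` and all `p` such that `I p` and `I (g p)` are both finite or both infinite. -/
structure IsRhinViolaGroup {M : Type*} [AddCommGroup M] [Module ℤ M] (I : M → ℝ≥0∞)
    (G : Subgroup (M ≃ₗ[ℤ] M)) : Prop where
  pos : ∀ p, 0 < I p
  ratio : ∀ g ∈ G, ∀ p, (I (g p) = ⊤ ↔ I p = ⊤) →
    ∃ q : ℚ, 0 < q ∧ quot (I (g p)) (I p) = ENNReal.ofReal (q : ℝ)

/-- The factorial `m!` of an integer `m ≥ 0`. -/
noncomputable def fact (m : ℤ) : ℝ≥0∞ := (m.toNat.factorial : ℝ≥0∞)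

/-- `G` leaves `I p / (m_1! ⋯ m_r!)` invariant, where `m_1, …, m_r` is the list of integers
`args p`: if `I p` is finite, then `m_1, …, m_r` are nonnegative, and the quotient takes the same
value at `p` and at `g p` for `g ∈ G` whenever `I p` and `I (g p)` are finite. -/
structure LeavesStable {M : Type*} [AddCommGroup M] [Module ℤ M] (I : M → ℝ≥0∞)
    (G : Subgroup (M ≃ₗ[ℤ] M)) (args : M → List ℤ) : Prop where
  nonneg : ∀ p, I p ≠ ⊤ → ∀ m ∈ args p, 0 ≤ m
  stable : ∀ g ∈ G, ∀ p, I p ≠ ⊤ → I (g p) ≠ ⊤ →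
    I (g p) / ((args (g p)).map fact).prod = I p / ((args p).map fact).prod

/-! ### The abstract groups -/

/-- `ℤ/2ℤ` acts on `N × N` by exchanging the two factors. -/
def swapAction (N : Type*) [Group N] : Multiplicative (ZMod 2) →* MulAut (N × N) where
  toFun e := if e = 1 then 1 else MulEquiv.prodComm
  map_one' := if_pos rfl
  map_mul' := by
    have h : (MulEquiv.prodComm : MulAut (N × N)) * MulEquiv.prodComm = 1 := by
      ext x <;> rfl
    have hc : ∀ e : Multiplicative (ZMod 2), e = 1 ∨ e = Multiplicative.ofAdd 1 := by decide
    have h1 : ¬ (Multiplicative.ofAdd (1 : ZMod 2) = 1) := by decide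
    have h2 : Multiplicative.ofAdd (1 : ZMod 2) * Multiplicative.ofAdd 1 = 1 := by decide
    intro e f
    rcases hc e with rfl | rfl <;> rcases hc f with rfl | rfl <;> simp [h1, h2, h]

/-- The hyperplane `H : ε_1 + ⋯ + ε_5 = 0` of `(ℤ/2ℤ)^5`. -/
def H : AddSubgroup (Fin 5 → ZMod 2) where
  carrier := {e | ∑ i, e i = 0}
  add_mem' := by
    intro e f he hf
    simp only [Set.mem_ofPred_eq] at he hf ⊢
    simp only [Pi.add_apply, Finset.sum_add_distrib, he, hf, add_zero]
  zero_mem' := by simp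
  neg_mem' := by
    intro e he
    simp only [Set.mem_ofPred_eq] at he ⊢
    simp only [Pi.neg_apply, Finset.sum_neg_distrib, he, neg_zero]

/-- The automorphism of `H` which permutes the coordinates by `s`. -/
def permH (s : Equiv.Perm (Fin 5)) : H ≃+ H where
  toFun e := ⟨fun i => e.1 (s⁻¹ i), (Equiv.sum_comp s⁻¹ e.1).trans e.2⟩
  invFun e := ⟨fun i => e.1 (s i), (Equiv.sum_comp s e.1).trans e.2⟩
  left_inv e := by ext i; simp
  right_inv e := by ext i; simp
  map_add' e f := rfl

/-- The symmetric group `S_5` acts on `H` by permuting the coordinates. -/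
def permAction : Equiv.Perm (Fin 5) →* MulAut (Multiplicative H) where
  toFun s := AddEquiv.toMultiplicative (permH s)
  map_one' := rfl
  map_mul' _ _ := rfl

end RhinViola

open RhinViola

/-! ### Beta integrals and the symmetry of Euler's integral -/

namespace RhinViola

open Set ProbabilityTheory

/-! Each generator comes from an identity between integrals over the open cube. For `σ` it is the
substitution `(x_1,x_2) ↦ (1-x_2,1-x_1)`, which leaves `δ_2`, hence every later `δ_k`, unchanged.
For `ψ` one takes `δ_1,…,δ_n` as new variables: the domain becomes `δ_{k-1} + δ_k > 1`, the
integrand a monomial in `δ_k`, `1-δ_k` and `δ_{k-1}+δ_k-1`, and `ψ` records what reversing the order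
of the `δ_k` does to the exponents (`realL_psi`). For `φ` one integrates over `x_{n-1}` alone. Since
`c_{n-1} = 0`, this variable enters only through `x_{n-1}^a (1-x_{n-1})^b` and `δ_n`, which is
affine in it; the inner integral is Euler's integral for `₂F₁`, and its symmetry in the two upper
parameters gives `φ` with a quotient of Beta values (`lintegral_euler_swap`, `realL_phi`).

For a general `g ∈ G` these identities cannot simply be composed: along a word in the generators
some intermediate integral may diverge, or some exponent may be negative, even if `L p` and `L (g
p)` are finite. All parameters are therefore translated by a real `t` in the direction `a = b = 1`,
`c_n = 1`, which the three generators fix. For large `t` every step of the word is legitimate, and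
the steps compose to a proportionality with products of Gamma values (`eventually_paramShiftL_mul`).
If `L p` and `L (g p)` are finite, the translated integrals are moment generating functions of the
nonpositive variable `log (∏ x_k (1-x_k) / δ_n)`, hence analytic for `t > 0`. The identity theorem
and dominated convergence as `t → 0+` bring the proportionality back to `t = 0`
(`realL_mul_gammaProd_eq`), where Gamma values are factorials. Their arguments are nonnegative
because convergence forces every `a_k` and `b_k` to exceed `-1`.

The list of factorials then only has to be compatible with the three generators. This is expressed
as an equality of products of `f` over the lists for arbitrary `f`, so that `f` may be taken to be a
translated Gamma function.

The structure of `G` is found by exhibiting linear forms on `𝓔` which separate points and which `G`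
permutes (up to sign if `n = 3`). A test vector with distinct values shows that the model group acts
faithfully, and the images of the three generators are checked to generate it
(`nonempty_closure_mulEquiv`). -/

theorem lintegral_Ioo_beta {p q : ℝ} (hp : 0 < p) (hq : 0 < q) :
    ∫⁻ x in Ioo (0 : ℝ) 1, ENNReal.ofReal (x ^ (p - 1) * (1 - x) ^ (q - 1))
      = ENNReal.ofReal (beta p q) := by
  have h := lintegral_betaPDF_eq_one hp hq
  rw [lintegral_betaPDF] at h
  have hb := beta_pos hp hq
  calc _ = ∫⁻ x in Ioo (0 : ℝ) 1, ENNReal.ofReal (beta p q) *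
        ENNReal.ofReal (1 / beta p q * x ^ (p - 1) * (1 - x) ^ (q - 1)) := by
        congr 1; ext x
        rw [← ENNReal.ofReal_mul hb.le]
        congr 1
        field_simp
    _ = _ := by rw [lintegral_const_mul' _ _ ENNReal.ofReal_ne_top, h, mul_one]

theorem image_mobius_Ioo {A C : ℝ} (hA : 0 < A) (hC : 0 ≤ C) :
    (fun y : ℝ => y * (A + C) / (A + C * y)) '' Ioo 0 1 = Ioo 0 1 := by
  ext u
  simp only [mem_image, mem_Ioo]
  constructor
  · rintro ⟨y, ⟨h0, h1⟩, rfl⟩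
    have : 0 < A + C * y := by positivity
    refine ⟨by positivity, (div_lt_one this).2 ?_⟩
    nlinarith
  · rintro ⟨h0, h1⟩
    have hd : 0 < A + C * (1 - u) := by
      have : 0 ≤ C * (1 - u) := mul_nonneg hC (by linarith)
      linarith
    refine ⟨A * u / (A + C * (1 - u)), ⟨by positivity, (div_lt_one hd).2 ?_⟩, ?_⟩
    · nlinarith
    · have : A + C * (A * u / (A + C * (1 - u))) = A * (A + C) / (A + C * (1 - u)) := by
        field_simp; ring
      rw [this]
      field_simp

theorem hasDerivAt_mobius {A C y : ℝ} (h : A + C * y ≠ 0) :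
    HasDerivAt (fun y : ℝ => y * (A + C) / (A + C * y)) (A * (A + C) / (A + C * y) ^ 2) y := by
  have h1 : HasDerivAt (fun y : ℝ => y * (A + C)) (1 * (A + C)) y :=
    (hasDerivAt_id y).mul_const _
  have h2 : HasDerivAt (fun y : ℝ => A + C * y) (C * 1) y :=
    ((hasDerivAt_id y).const_mul C).const_add A
  refine (h1.div h2 h).congr_deriv ?_
  congr 1
  ring

theorem injOn_mobius {A C : ℝ} (hA : 0 < A) (hC : 0 ≤ C) :
    InjOn (fun y : ℝ => y * (A + C) / (A + C * y)) (Ioo 0 1) := by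
  intro x hx y hy h
  have h1 : 0 < A + C * x := by have := mul_nonneg hC hx.1.le; linarith
  have h2 : 0 < A + C * y := by have := mul_nonneg hC hy.1.le; linarith
  simp only at h
  rw [div_eq_div_iff h1.ne' h2.ne'] at h
  have h3 : (A * (A + C)) * (x - y) = 0 := by linarith
  have h4 : A * (A + C) ≠ 0 := by positivity
  have := (mul_eq_zero.1 h3).resolve_left h4
  linarith

/-- The homography `u = y (A+C) / (A + C y)` maps `(0,1)` onto itself, with `1 - u = A (1-y) / (A +
C y)` and derivative `A (A+C) / (A + C y)^2`. It turns the plain Beta integral into this one,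
because the exponent of `A + C y` is exactly `-(p+q)`. -/
theorem lintegral_beta_kernel {p q A C : ℝ} (hp : 0 < p) (hq : 0 < q) (hA : 0 < A) (hC : 0 ≤ C) :
    ∫⁻ y in Ioo (0 : ℝ) 1,
        ENNReal.ofReal (y ^ (p - 1) * (1 - y) ^ (q - 1) * (A + C * y) ^ (-(p + q)))
      = ENNReal.ofReal (beta p q * (A ^ (-q) * (A + C) ^ (-p))) := by
  have hAC : 0 < A + C := by linarith
  have hK : 0 < A ^ (-q) * (A + C) ^ (-p) := by positivity
  have key := lintegral_image_eq_lintegral_abs_deriv_mul (measurableSet_Ioo (a := (0 : ℝ)) (b := 1))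
    (f := fun y : ℝ => y * (A + C) / (A + C * y))
    (f' := fun y => A * (A + C) / (A + C * y) ^ 2)
    (fun y hy => (hasDerivAt_mobius (by have := mul_nonneg hC hy.1.le; linarith)).hasDerivWithinAt)
    (injOn_mobius hA hC)
    (fun u => ENNReal.ofReal (u ^ (p - 1) * (1 - u) ^ (q - 1)))
  rw [image_mobius_Ioo hA hC, lintegral_Ioo_beta hp hq] at key
  rw [mul_comm, ENNReal.ofReal_mul hK.le, key, ← lintegral_const_mul' _ _ ENNReal.ofReal_ne_top]
  refine setLIntegral_congr_fun measurableSet_Ioo fun y hy => ?_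
  have hy0 : 0 < y := hy.1
  have hy1 : 0 < 1 - y := by linarith [hy.2]
  have hD : 0 < A + C * y := by have := mul_nonneg hC hy.1.le; linarith
  rw [← ENNReal.ofReal_mul (abs_nonneg _), ← ENNReal.ofReal_mul hK.le]
  congr 1
  have e1 : 1 - y * (A + C) / (A + C * y) = A * (1 - y) / (A + C * y) := by
    field_simp; ring
  rw [e1, abs_of_pos (by positivity), Real.div_rpow (by positivity) hD.le,
    Real.div_rpow (by positivity) hD.le, Real.mul_rpow hy0.le hAC.le, Real.mul_rpow hA.le hy1.le]
  have e2 : (A + C * y) ^ (-(p + q))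
      = ((A + C * y) ^ (p - 1))⁻¹ * ((A + C * y) ^ (q - 1))⁻¹ * ((A + C * y) ^ 2)⁻¹ := by
    rw [← Real.rpow_neg hD.le, ← Real.rpow_neg hD.le, ← Real.rpow_natCast, ← Real.rpow_neg hD.le,
      ← Real.rpow_add hD, ← Real.rpow_add hD]
    congr 1; push_cast; ring
  have e3 : A ^ (-q) * A ^ (q - 1) * A = 1 := by
    rw [← Real.rpow_add hA, ← Real.rpow_add_one hA.ne']
    ring_nf; simp
  have e4 : (A + C) ^ (-p) * (A + C) ^ (p - 1) * (A + C) = 1 := by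
    rw [← Real.rpow_add hAC, ← Real.rpow_add_one hAC.ne']
    ring_nf; simp
  rw [e2]
  calc _ = (A ^ (-q) * A ^ (q - 1) * A) * ((A + C) ^ (-p) * (A + C) ^ (p - 1) * (A + C)) *
        (y ^ (p - 1) * (1 - y) ^ (q - 1) * (((A + C * y) ^ (p - 1))⁻¹ * ((A + C * y) ^ (q - 1))⁻¹
          * ((A + C * y) ^ 2)⁻¹)) := by rw [e3, e4]; ring
    _ = _ := by
      field_simp

/-- Euler's kernel: integrating out `y` in a symmetric double integral. -/
theorem lintegral_beta_prod {a b c d A B : ℝ} (hc : -1 < c) (hd : -1 < d) (h : a + b = c + d)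
    (hA : 0 < A) (hB : 0 ≤ B) :
    ∫⁻ x in Ioo (0 : ℝ) 1, ∫⁻ y in Ioo (0 : ℝ) 1,
        ENNReal.ofReal (x ^ a * (1 - x) ^ b * (y ^ c * (1 - y) ^ d)
          * (A + B * x * y) ^ (-(a + b + 2)))
      = ENNReal.ofReal (beta (c + 1) (d + 1) * A ^ (-(d + 1))) *
        ∫⁻ x in Ioo (0 : ℝ) 1, ENNReal.ofReal (x ^ a * (1 - x) ^ b * (A + B * x) ^ (-(c + 1))) := by
  have hb : 0 < beta (c + 1) (d + 1) := beta_pos (by linarith) (by linarith)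
  rw [← lintegral_const_mul' _ _ ENNReal.ofReal_ne_top]
  refine setLIntegral_congr_fun measurableSet_Ioo fun x hx => ?_
  have hx0 : 0 < x := hx.1
  have hx1 : 0 < 1 - x := by linarith [hx.2]
  have hk := lintegral_beta_kernel (p := c + 1) (q := d + 1) (A := A) (C := B * x)
    (by linarith) (by linarith) hA (by positivity)
  -- The hypothesis `a + b = c + d` is what makes the exponent of the kernel match the Beta integral
  -- in `y`.
  have e : -(c + 1 + (d + 1)) = -(a + b + 2) := by linarith
  simp only [add_sub_cancel_right, e] at hk
  have hP : 0 < x ^ a * (1 - x) ^ b := by positivity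
  calc _ = ∫⁻ y in Ioo (0 : ℝ) 1, ENNReal.ofReal (x ^ a * (1 - x) ^ b) * ENNReal.ofReal
        (y ^ c * (1 - y) ^ d * (A + B * x * y) ^ (-(a + b + 2))) := by
        congr 1; ext y; rw [← ENNReal.ofReal_mul hP.le, mul_assoc]
    _ = _ := by
      rw [lintegral_const_mul' _ _ ENNReal.ofReal_ne_top, hk, ← ENNReal.ofReal_mul hP.le,
        ← ENNReal.ofReal_mul (by positivity)]
      congr 1; ring

/-- The symmetry of Euler's integral representation of `₂F₁`. -/
theorem lintegral_euler_swap {a b c d A B : ℝ} (ha : -1 < a) (hb : -1 < b) (hc : -1 < c)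
    (hd : -1 < d) (h : a + b = c + d) (hA : 0 < A) (hB : 0 ≤ B) :
    ENNReal.ofReal (beta (c + 1) (d + 1)) *
      ∫⁻ x in Ioo (0 : ℝ) 1, ENNReal.ofReal (x ^ a * (1 - x) ^ b * (A + B * x) ^ (-(c + 1)))
    = ENNReal.ofReal (beta (a + 1) (b + 1) * A ^ (a - c)) *
      ∫⁻ x in Ioo (0 : ℝ) 1, ENNReal.ofReal (x ^ c * (1 - x) ^ d * (A + B * x) ^ (-(a + 1))) := by
  have h1 := lintegral_beta_prod (a := a) (b := b) hc hd h hA hB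
  have h2 := lintegral_beta_prod (a := c) (b := d) ha hb h.symm hA hB
  have hb1 : 0 < beta (c + 1) (d + 1) := beta_pos (by linarith) (by linarith)
  have hb2 : 0 < beta (a + 1) (b + 1) := beta_pos (by linarith) (by linarith)
  -- The double integral is symmetric under exchange of `(x,a,b)` and `(y,c,d)`; Tonelli allows
  -- either variable to be integrated out first.
  have hsymm : ∫⁻ x in Ioo (0 : ℝ) 1, ∫⁻ y in Ioo (0 : ℝ) 1,
        ENNReal.ofReal (x ^ a * (1 - x) ^ b * (y ^ c * (1 - y) ^ d)
          * (A + B * x * y) ^ (-(a + b + 2)))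
      = ∫⁻ x in Ioo (0 : ℝ) 1, ∫⁻ y in Ioo (0 : ℝ) 1,
        ENNReal.ofReal (x ^ c * (1 - x) ^ d * (y ^ a * (1 - y) ^ b)
          * (A + B * x * y) ^ (-(c + d + 2))) := by
    rw [lintegral_lintegral_swap]
    · congr 1; ext x; congr 1; ext y
      rw [h, mul_comm (y ^ a * _), mul_right_comm B]
    · apply Measurable.aemeasurable
      unfold Function.uncurry
      fun_prop
  rw [h1, h2] at hsymm
  have hAd : 0 < A ^ (d + 1) := by positivity
  have e1 : beta (c + 1) (d + 1) = A ^ (d + 1) * (beta (c + 1) (d + 1) * A ^ (-(d + 1))) := by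
    rw [Real.rpow_neg hA.le]; field_simp
  have e2 : beta (a + 1) (b + 1) * A ^ (a - c)
      = A ^ (d + 1) * (beta (a + 1) (b + 1) * A ^ (-(b + 1))) := by
    rw [mul_left_comm, ← Real.rpow_add hA]; congr 2; linarith
  rw [e1, e2, ENNReal.ofReal_mul hAd.le, ENNReal.ofReal_mul hAd.le, mul_assoc, mul_assoc, hsymm]

end RhinViola

/-! ### Lebesgue measure on the open cube and partial integrals -/

namespace RhinViola

open Set ProbabilityTheory

/-- Lebesgue measure on the open cube `(0,1)^n`. -/
noncomputable def cubeMeasure (n : ℕ) : Measure (Fin n → ℝ) :=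
  Measure.pi fun _ => volume.restrict (Ioo (0 : ℝ) 1)

theorem cubeMeasure_eq_restrict (n : ℕ) :
    cubeMeasure n = volume.restrict (Set.pi univ fun _ => Ioo (0 : ℝ) 1) := by
  rw [cubeMeasure, volume_pi, Measure.restrict_pi_pi]

theorem restrict_Icc_eq_cubeMeasure (n : ℕ) :
    (volume : Measure (Fin n → ℝ)).restrict (Icc 0 1) = cubeMeasure n := by
  rw [cubeMeasure_eq_restrict]
  exact Measure.restrict_congr_set Measure.univ_pi_Ioo_ae_eq_Icc.symm

theorem measurableSet_cube (n : ℕ) :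
    MeasurableSet (Set.pi univ fun _ : Fin n => Ioo (0 : ℝ) 1) :=
  MeasurableSet.univ_pi fun _ => measurableSet_Ioo

theorem ae_mem_cube (n : ℕ) : ∀ᵐ x ∂cubeMeasure n, ∀ i, x i ∈ Ioo (0 : ℝ) 1 := by
  rw [cubeMeasure_eq_restrict]
  filter_upwards [ae_restrict_mem (measurableSet_cube n)] with x hx i
  exact hx i (mem_univ i)

theorem lintegral_cube_congr {n : ℕ} {f g : (Fin n → ℝ) → ℝ≥0∞}
    (h : ∀ x, (∀ i, x i ∈ Ioo (0 : ℝ) 1) → f x = g x) :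
    ∫⁻ x, f x ∂cubeMeasure n = ∫⁻ x, g x ∂cubeMeasure n :=
  lintegral_congr_ae ((ae_mem_cube n).mono h)

theorem cubeMeasure_ne_zero (n : ℕ) : cubeMeasure n ≠ 0 := by
  intro h
  have := congrArg (fun m => m univ) h
  simp [cubeMeasure, Measure.pi_univ] at this

/-- Two functions on the cube have the same integral if they have the same partial integrals in
one variable. -/
theorem lintegral_cube_eq_of_coord {n : ℕ} (i : Fin n) {f g : (Fin n → ℝ) → ℝ≥0∞}
    (hf : Measurable f) (hg : Measurable g)
    (h : ∀ x, (∀ j, x j ∈ Ioo (0 : ℝ) 1) →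
      ∫⁻ y in Ioo (0 : ℝ) 1, f (Function.update x i y)
        = ∫⁻ y in Ioo (0 : ℝ) 1, g (Function.update x i y)) :
    ∫⁻ x, f x ∂cubeMeasure n = ∫⁻ x, g x ∂cubeMeasure n := by
  set S : Set (Fin n → ℝ) := Set.pi univ fun _ => Ioo (0 : ℝ) 1 with hS
  have hSm : MeasurableSet S := measurableSet_cube n
  -- Marginals must agree at every point of `ℝ^n`, whereas the hypothesis concerns the cube only;
  -- multiplying by its indicator makes both sides vanish elsewhere.
  have hind : ∀ u : (Fin n → ℝ) → ℝ≥0∞,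
      ∫⁻ x, u x ∂cubeMeasure n = ∫⁻ x, S.indicator u x ∂cubeMeasure n := fun u =>
    lintegral_cube_congr fun x hx => by
      rw [indicator_of_mem]; exact fun j _ => hx j
  rw [hind f, hind g]
  refine lintegral_eq_of_lmarginal_eq {i} (hf.indicator hSm) (hg.indicator hSm) ?_
  rw [lmarginal_singleton, lmarginal_singleton]
  funext x
  by_cases hx : ∀ j, j ≠ i → x j ∈ Ioo (0 : ℝ) 1
  · have hx' : ∀ j, Function.update x i (1 / 2 : ℝ) j ∈ Ioo (0 : ℝ) 1 := by
      intro j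
      by_cases hj : j = i
      · subst hj; simp; norm_num
      · rw [Function.update_of_ne hj]; exact hx j hj
    have hmem : ∀ y ∈ Ioo (0 : ℝ) 1, Function.update x i y ∈ S := by
      intro y hy j _
      by_cases hj : j = i
      · subst hj; simpa using hy
      · rw [Function.update_of_ne hj]; exact hx j hj
    have := h _ hx'
    simp only [Function.update_idem] at this
    rw [setLIntegral_congr_fun measurableSet_Ioo fun y hy => indicator_of_mem (hmem y hy) f,
      setLIntegral_congr_fun measurableSet_Ioo fun y hy => indicator_of_mem (hmem y hy) g]
    exact this
  · push Not at hx
    obtain ⟨j, hj, hxj⟩ := hx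
    have hmem : ∀ y : ℝ, Function.update x i y ∉ S := by
      intro y hy
      have := hy j (mem_univ j)
      rw [Function.update_of_ne hj] at this
      exact hxj this
    congr 1
    funext y
    rw [indicator_of_notMem (hmem y), indicator_of_notMem (hmem y)]

/-- A partial integral of a function of finite integral is finite somewhere. -/
theorem exists_lintegral_update_ne_top {n : ℕ} (i : Fin n) {f : (Fin n → ℝ) → ℝ≥0∞}
    (hf : Measurable f) (h : ∫⁻ x, f x ∂cubeMeasure n ≠ ⊤) :
    ∃ x : Fin n → ℝ, (∀ j, x j ∈ Ioo (0 : ℝ) 1) ∧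
      ∫⁻ y in Ioo (0 : ℝ) 1, f (Function.update x i y) ≠ ⊤ := by
  by_contra hcon
  push Not at hcon
  apply h
  rw [lintegral_cube_eq_of_coord i hf (measurable_const (a := ⊤)) fun x hx => by
    rw [hcon x hx]; simp]
  rw [lintegral_const, ENNReal.top_mul]
  rw [Ne, Measure.measure_univ_eq_zero]
  exact cubeMeasure_ne_zero n

/-! ### The chain `δ_k`, and the integrand with real exponents -/

section CoordDelta

variable {n : ℕ}

theorem coord_mem {x : Fin n → ℝ} (hx : ∀ i, x i ∈ Ioo (0 : ℝ) 1) {k : ℕ} (h1 : 1 ≤ k)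
    (h2 : k ≤ n) : coord x k ∈ Ioo (0 : ℝ) 1 := by
  rw [coord, dif_pos ⟨h1, h2⟩]; exact hx _

theorem delta_succ (x : Fin n → ℝ) (k : ℕ) :
    delta x (k + 1) = 1 - coord x (k + 1) * delta x k := rfl

theorem coord_update (x : Fin n → ℝ) (i : Fin n) (y : ℝ) (k : ℕ) :
    coord (Function.update x i y) k = if k = i + 1 then y else coord x k := by
  have hi := i.2
  unfold coord
  split_ifs with h1 h2 h3
  · have : (⟨k - 1, by omega⟩ : Fin n) = i := Fin.ext (by simp; omega)
    rw [this, Function.update_self]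
  · rw [Function.update_of_ne]
    intro h
    have := congrArg Fin.val h
    simp at this
    omega
  · omega
  · rfl

theorem delta_update_of_le (x : Fin n → ℝ) (i : Fin n) (y : ℝ) {k : ℕ} (hk : k ≤ i) :
    delta (Function.update x i y) k = delta x k := by
  induction k with
  | zero => rfl
  | succ k ih => rw [delta_succ, delta_succ, ih (by omega), coord_update, if_neg (by omega)]

/-- The induction may start at any `m`, and the later coordinates may be `0`. Both freedoms serve at
boundary points of the cube, where an earlier `δ_k` may vanish. -/
theorem delta_pos_le_one {x : Fin n → ℝ} {m : ℕ} (hm : delta x m ∈ Ioc (0 : ℝ) 1)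
    (hx : ∀ k, m < k → k ≤ n → coord x k ∈ Ico (0 : ℝ) 1) {k : ℕ} (hmk : m ≤ k) (hk : k ≤ n) :
    delta x k ∈ Ioc (0 : ℝ) 1 := by
  induction k, hmk using Nat.le_induction with
  | base => exact hm
  | succ k hmk ih =>
    have h1 := ih (by omega)
    have h2 := hx (k + 1) (by omega) hk
    rw [delta_succ]
    constructor
    · nlinarith [h1.1, h1.2, h2.1, h2.2]
    · nlinarith [mul_nonneg h2.1 h1.1.le]

theorem delta_pos {x : Fin n → ℝ} (hx : ∀ i, x i ∈ Ioo (0 : ℝ) 1) {k : ℕ} (hk : k ≤ n) :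
    0 < delta x k :=
  (delta_pos_le_one (m := 0) (by simp [delta]) (fun _ h1 h2 =>
    Ioo_subset_Ico_self (coord_mem hx h1 h2)) (Nat.zero_le _) hk).1

theorem delta_le_one {x : Fin n → ℝ} (hx : ∀ i, x i ∈ Ioo (0 : ℝ) 1) {k : ℕ} (hk : k ≤ n) :
    delta x k ≤ 1 :=
  (delta_pos_le_one (m := 0) (by simp [delta]) (fun _ h1 h2 =>
    Ioo_subset_Ico_self (coord_mem hx h1 h2)) (Nat.zero_le _) hk).2

theorem delta_lt_one {x : Fin n → ℝ} (hx : ∀ i, x i ∈ Ioo (0 : ℝ) 1) {k : ℕ} (h1 : 1 ≤ k)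
    (hk : k ≤ n) : delta x k < 1 := by
  obtain ⟨k, rfl⟩ := Nat.exists_eq_add_of_le' h1
  have := mul_pos (coord_mem hx h1 hk).1 (delta_pos hx (k := k) (by omega))
  rw [delta_succ]; linarith

@[fun_prop]
theorem continuous_coord (k : ℕ) : Continuous fun x : Fin n → ℝ => coord x k := by
  unfold coord
  split_ifs <;> fun_prop

@[fun_prop]
theorem continuous_delta (k : ℕ) : Continuous fun x : Fin n → ℝ => delta x k := by
  induction k with
  | zero => exact continuous_const
  | succ k ih => simp only [delta_succ]; fun_prop

end CoordDelta

/-- The integrand of `L`, with real exponents. -/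
noncomputable def integrand {n : ℕ} (A B C : ℕ → ℝ) (x : Fin n → ℝ) : ℝ :=
  (∏ k ∈ Finset.Icc 1 n, coord x k ^ A k * (1 - coord x k) ^ B k)
    / (∏ k ∈ Finset.Icc 2 n, delta x k ^ C k) * (1 / delta x n)

/-- The integral `L`, with real exponents. -/
noncomputable def realL (n : ℕ) (A B C : ℕ → ℝ) : ℝ≥0∞ :=
  ∫⁻ x, ENNReal.ofReal (integrand A B C x) ∂cubeMeasure n

theorem L_eq_realL {n : ℕ} (p : Param n) :
    L p = realL n (fun k => p.a k) (fun k => p.b k) (fun k => p.c k) := by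
  unfold L realL integrand
  simp only [Real.rpow_intCast]
  rw [restrict_Icc_eq_cubeMeasure]

section Integrand

variable {n : ℕ} {A B C : ℕ → ℝ}

@[fun_prop]
theorem measurable_coord (k : ℕ) : Measurable fun x : Fin n → ℝ => coord x k :=
  (continuous_coord k).measurable

@[fun_prop]
theorem measurable_delta (k : ℕ) : Measurable fun x : Fin n → ℝ => delta x k :=
  (continuous_delta k).measurable

@[fun_prop]
theorem measurable_integrand : Measurable fun x : Fin n → ℝ => integrand A B C x := by
  unfold integrand
  fun_prop

theorem integrand_pos {x : Fin n → ℝ} (hx : ∀ i, x i ∈ Ioo (0 : ℝ) 1) :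
    0 < integrand A B C x := by
  have h1 : 0 < ∏ k ∈ Finset.Icc 1 n, coord x k ^ A k * (1 - coord x k) ^ B k := by
    refine Finset.prod_pos fun k hk => ?_
    rw [Finset.mem_Icc] at hk
    have := coord_mem hx hk.1 hk.2
    have h0 := this.1
    have h1 : 0 < 1 - coord x k := by linarith [this.2]
    positivity
  have h2 : 0 < ∏ k ∈ Finset.Icc 2 n, delta x k ^ C k := by
    refine Finset.prod_pos fun k hk => ?_
    rw [Finset.mem_Icc] at hk
    exact Real.rpow_pos_of_pos (delta_pos hx hk.2) _
  have h3 := delta_pos hx (le_refl n)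
  unfold integrand
  positivity

/-- The integrand is positive throughout the open cube, which has positive measure. -/
theorem realL_pos : 0 < realL n A B C := by
  rw [realL, lintegral_pos_iff_support (by fun_prop), pos_iff_ne_zero]
  intro h
  refine cubeMeasure_ne_zero n ((Measure.measure_univ_eq_zero).1 ?_)
  rw [← nonpos_iff_eq_zero, ← h]
  refine measure_mono_ae ?_
  filter_upwards [ae_mem_cube n] with x hx _
  exact (ENNReal.ofReal_pos.2 (integrand_pos hx)).ne'

/-- The logarithm of the integrand on the open cube. -/
theorem integrand_eq_exp {x : Fin n → ℝ} (hx : ∀ i, x i ∈ Ioo (0 : ℝ) 1) :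
    integrand A B C x = Real.exp (∑ k ∈ Finset.Icc 1 n, (Real.log (coord x k) * A k
      + Real.log (1 - coord x k) * B k) - ∑ k ∈ Finset.Icc 2 n, Real.log (delta x k) * C k
      - Real.log (delta x n)) := by
  rw [Real.exp_sub, Real.exp_sub, Real.exp_sum, Real.exp_sum, Real.exp_log (delta_pos hx le_rfl),
    integrand, mul_one_div]
  congr 2
  · refine Finset.prod_congr rfl fun k hk => ?_
    rw [Finset.mem_Icc] at hk
    have := coord_mem hx hk.1 hk.2
    rw [Real.exp_add, ← Real.rpow_def_of_pos this.1,
      ← Real.rpow_def_of_pos (by linarith [this.2])]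
  · refine Finset.prod_congr rfl fun k hk => ?_
    rw [Finset.mem_Icc] at hk
    rw [← Real.rpow_def_of_pos (delta_pos hx hk.2)]

end Integrand

end RhinViola

namespace RhinViola

open Set ProbabilityTheory

/-! ### The transformation `φ` -/

section Phi

variable {m : ℕ} {A B C : ℕ → ℝ}

/-- The factor of the integrand which depends on `x_1,…,x_m` only. -/
noncomputable def integrandHead (m : ℕ) {n : ℕ} (A B C : ℕ → ℝ) (x : Fin n → ℝ) : ℝ :=
  (∏ k ∈ Finset.Icc 1 m, coord x k ^ A k * (1 - coord x k) ^ B k)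
    / (∏ k ∈ Finset.Icc 2 m, delta x k ^ C k)

/-- With `n = m + 2`, `δ_n = 1 - x_n + x_n δ_m x_{m+1}` is affine in `x_{m+1}`. The only other `δ_k`
involving this variable is `δ_{m+1}`, which has exponent `0`; for `m = 0` it is absent, since the
product over `k` starts at `2`. -/
theorem integrand_update_penultimate (hC : 1 ≤ m → C (m + 1) = 0) {x : Fin (m + 2) → ℝ}
    (hx : ∀ i, x i ∈ Ioo (0 : ℝ) 1) {y : ℝ} (hy : y ∈ Ioo (0 : ℝ) 1) :
    integrand A B C (Function.update x ⟨m, by omega⟩ y)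
      = integrandHead m A B C x
        * (coord x (m + 2) ^ A (m + 2) * (1 - coord x (m + 2)) ^ B (m + 2))
        * (y ^ A (m + 1) * (1 - y) ^ B (m + 1)
          * (1 - coord x (m + 2) + coord x (m + 2) * delta x m * y) ^ (-(C (m + 2) + 1))) := by
  set x' := Function.update x ⟨m, by omega⟩ y with hx'
  have hmem : ∀ i, x' i ∈ Ioo (0 : ℝ) 1 := by
    intro i
    by_cases hi : i = ⟨m, by omega⟩
    · rw [hx', hi, Function.update_self]; exact hy
    · rw [hx', Function.update_of_ne hi]; exact hx i
  have hc : ∀ k, k ≠ m + 1 → coord x' k = coord x k := fun k hk => by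
    rw [hx', coord_update, if_neg (by simpa using hk)]
  have hcm : coord x' (m + 1) = y := by rw [hx', coord_update, if_pos rfl]
  have hd : ∀ k ≤ m, delta x' k = delta x k := fun k hk => by
    rw [hx', delta_update_of_le]; exact hk
  have hdm : delta x' (m + 2) = 1 - coord x (m + 2) + coord x (m + 2) * delta x m * y := by
    rw [delta_succ, delta_succ, hd m le_rfl, hcm, hc _ (by omega)]; ring
  have hpos : 0 < delta x' (m + 2) := delta_pos hmem le_rfl
  have hP : ∏ k ∈ Finset.Icc 2 (m + 2), delta x' k ^ C k
      = (∏ k ∈ Finset.Icc 2 m, delta x k ^ C k) * delta x' (m + 2) ^ C (m + 2) := by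
    rw [Finset.prod_Icc_succ_top (by omega)]
    congr 1
    rcases Nat.eq_zero_or_pos m with rfl | h
    · simp
    · rw [Finset.prod_Icc_succ_top (by omega), hC h, Real.rpow_zero, mul_one]
      refine Finset.prod_congr rfl fun k hk => ?_
      rw [hd k (Finset.mem_Icc.1 hk).2]
  have hN : ∏ k ∈ Finset.Icc 1 (m + 2), coord x' k ^ A k * (1 - coord x' k) ^ B k
      = (∏ k ∈ Finset.Icc 1 m, coord x k ^ A k * (1 - coord x k) ^ B k)
        * (y ^ A (m + 1) * (1 - y) ^ B (m + 1))
        * (coord x (m + 2) ^ A (m + 2) * (1 - coord x (m + 2)) ^ B (m + 2)) := by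
    rw [Finset.prod_Icc_succ_top (by omega), Finset.prod_Icc_succ_top (by omega), hcm,
      hc (m + 2) (by omega)]
    congr 2
    refine Finset.prod_congr rfl fun k hk => ?_
    rw [hc k (by have := (Finset.mem_Icc.1 hk).2; omega)]
  rw [integrand, integrandHead, hP, hN, ← hdm, neg_add, Real.rpow_add hpos,
    Real.rpow_neg hpos.le, Real.rpow_neg_one]
  field_simp

theorem integrandHead_nonneg {x : Fin (m + 2) → ℝ} (hx : ∀ i, x i ∈ Ioo (0 : ℝ) 1) :
    0 ≤ integrandHead m A B C x := by
  refine div_nonneg (Finset.prod_nonneg fun k hk => ?_) (Finset.prod_nonneg fun k hk => ?_)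
  · rw [Finset.mem_Icc] at hk
    have := coord_mem hx hk.1 (by omega)
    have h0 := this.1.le
    have h1 : 0 ≤ 1 - coord x k := by linarith [this.2]
    positivity
  · rw [Finset.mem_Icc] at hk
    exact Real.rpow_nonneg (delta_pos hx (by omega)).le _

/-- On each line parallel to the axis of `x_{m+1}`, this is `lintegral_euler_swap` with constant
term `1 - x_n` and slope `x_n δ_m`. The power `(1 - x_n)^(a-c)` appearing there accounts for the
change of `b_n` into `a + b_n - c`. -/
theorem realL_phi {A' B' C' : ℕ → ℝ} (hC : 1 ≤ m → C (m + 1) = 0)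
    (ha : -1 < A (m + 1)) (hb : -1 < B (m + 1)) (hc : -1 < C (m + 2))
    (hd : -1 < A (m + 1) + B (m + 1) - C (m + 2))
    (hA' : ∀ k, A' k = if k = m + 1 then C (m + 2) else A k)
    (hB' : ∀ k, B' k = if k = m + 1 then A (m + 1) + B (m + 1) - C (m + 2)
      else if k = m + 2 then A (m + 1) + B (m + 2) - C (m + 2) else B k)
    (hC' : ∀ k, C' k = if k = m + 2 then A (m + 1) else C k) :
    ENNReal.ofReal (beta (C (m + 2) + 1) (A (m + 1) + B (m + 1) - C (m + 2) + 1))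
        * realL (m + 2) A B C
      = ENNReal.ofReal (beta (A (m + 1) + 1) (B (m + 1) + 1)) * realL (m + 2) A' B' C' := by
  unfold realL
  rw [← lintegral_const_mul' _ _ ENNReal.ofReal_ne_top,
    ← lintegral_const_mul' _ _ ENNReal.ofReal_ne_top]
  refine lintegral_cube_eq_of_coord ⟨m, by omega⟩ (by fun_prop) (by fun_prop) fun x hx => ?_
  set a := A (m + 1)
  set b := B (m + 1)
  set c := C (m + 2)
  have hxn := coord_mem hx (k := m + 2) (by omega) le_rfl
  have hP : 0 < 1 - coord x (m + 2) := by linarith [hxn.2]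
  have hQ : 0 ≤ coord x (m + 2) * delta x m :=
    mul_nonneg hxn.1.le (delta_pos hx (by omega)).le
  have hhead : integrandHead m A' B' C' x = integrandHead m A B C x := by
    unfold integrandHead
    congr 1
    · refine Finset.prod_congr rfl fun k hk => ?_
      rw [Finset.mem_Icc] at hk
      rw [hA', hB', if_neg (by omega), if_neg (by omega), if_neg (by omega)]
    · refine Finset.prod_congr rfl fun k hk => ?_
      rw [Finset.mem_Icc] at hk
      rw [hC', if_neg (by omega)]
  have hK0 : 0 ≤ integrandHead m A B C x * (coord x (m + 2) ^ A (m + 2)) :=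
    mul_nonneg (integrandHead_nonneg hx) (Real.rpow_nonneg hxn.1.le _)
  set K := integrandHead m A B C x * (coord x (m + 2) ^ A (m + 2)) with hK
  set P := 1 - coord x (m + 2)
  set Q := coord x (m + 2) * delta x m
  have hKP : 0 ≤ K * P ^ B (m + 2) := mul_nonneg hK0 (Real.rpow_nonneg hP.le _)
  have hKP' : 0 ≤ K * P ^ (a + B (m + 2) - c) := mul_nonneg hK0 (Real.rpow_nonneg hP.le _)
  have hβ := beta_pos (α := a + 1) (β := b + 1) (by linarith) (by linarith)
  have hβ' := beta_pos (α := c + 1) (β := a + b - c + 1) (by linarith) (by linarith)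
  have key := lintegral_euler_swap (a := a) (b := b) (c := c) (d := a + b - c) ha hb hc hd
    (by ring) hP hQ
  have e1 : ∫⁻ y in Ioo (0 : ℝ) 1, ENNReal.ofReal (beta (c + 1) (a + b - c + 1)) *
        ENNReal.ofReal (integrand A B C (Function.update x ⟨m, by omega⟩ y))
      = ENNReal.ofReal (K * P ^ B (m + 2)) * (ENNReal.ofReal (beta (c + 1) (a + b - c + 1)) *
        ∫⁻ y in Ioo (0 : ℝ) 1, ENNReal.ofReal (y ^ a * (1 - y) ^ b * (P + Q * y) ^ (-(c + 1)))) := by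
    rw [← lintegral_const_mul' _ _ ENNReal.ofReal_ne_top,
      ← lintegral_const_mul' _ _ ENNReal.ofReal_ne_top]
    refine setLIntegral_congr_fun measurableSet_Ioo fun y hy => ?_
    rw [mul_left_comm, ← ENNReal.ofReal_mul hKP, integrand_update_penultimate hC hx hy]
    congr 2
    rw [hK]; ring
  have e2 : ∫⁻ y in Ioo (0 : ℝ) 1, ENNReal.ofReal (beta (a + 1) (b + 1)) *
        ENNReal.ofReal (integrand A' B' C' (Function.update x ⟨m, by omega⟩ y))
      = ENNReal.ofReal (K * P ^ (a + B (m + 2) - c)) * (ENNReal.ofReal (beta (a + 1) (b + 1)) *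
        ∫⁻ y in Ioo (0 : ℝ) 1,
          ENNReal.ofReal (y ^ c * (1 - y) ^ (a + b - c) * (P + Q * y) ^ (-(a + 1)))) := by
    rw [← lintegral_const_mul' _ _ ENNReal.ofReal_ne_top,
      ← lintegral_const_mul' _ _ ENNReal.ofReal_ne_top]
    refine setLIntegral_congr_fun measurableSet_Ioo fun y hy => ?_
    rw [mul_left_comm, ← ENNReal.ofReal_mul hKP', integrand_update_penultimate
      (fun h => by rw [hC', if_neg (by omega), hC h]) hx hy, hhead]
    congr 2
    rw [hA' (m + 2), hB' (m + 2), hA' (m + 1), hB' (m + 1), hC' (m + 2), if_neg (by omega),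
      if_neg (by omega), if_pos rfl, if_pos rfl, if_pos rfl, if_pos rfl, hK]
    ring
  rw [e1, e2, key, ENNReal.ofReal_mul hβ.le, ← mul_assoc, ← mul_assoc, ← mul_assoc]
  congr 1
  rw [mul_assoc, mul_comm (ENNReal.ofReal (beta _ _)), ← mul_assoc, ← ENNReal.ofReal_mul hKP]
  congr 2
  -- Both powers of `1 - x_n` are now collected: `b_n + (a - c) = a + b_n - c`.
  rw [mul_assoc, ← Real.rpow_add hP]
  congr 2
  ring

end Phi

/-! ### The transformation `σ` -/

section Sigma

variable {n : ℕ}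

/-- `(x_1,x_2,x_3,…) ↦ (1-x_2,1-x_1,x_3,…)`. -/
noncomputable def reflectSwap (hn : 2 ≤ n) (x : Fin n → ℝ) : Fin n → ℝ := fun i =>
  if (i : ℕ) < 2 then 1 - x (Equiv.swap ⟨0, by omega⟩ ⟨1, by omega⟩ i)
  else x (Equiv.swap ⟨0, by omega⟩ ⟨1, by omega⟩ i)

theorem measurePreserving_one_sub_Ioo :
    MeasurePreserving (fun x : ℝ => 1 - x) (volume.restrict (Ioo 0 1))
      (volume.restrict (Ioo 0 1)) := by
  have h := (Measure.measurePreserving_sub_left (volume : Measure ℝ) 1).restrict_preimage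
    (measurableSet_Ioo (a := (0 : ℝ)) (b := 1))
  have e : (fun x : ℝ => 1 - x) ⁻¹' Ioo 0 1 = Ioo 0 1 := by
    ext x; simp only [mem_preimage, mem_Ioo]; constructor <;> rintro ⟨h1, h2⟩ <;>
      constructor <;> linarith
  rwa [e] at h

theorem measurePreserving_comp_perm (e : Equiv.Perm (Fin n)) :
    MeasurePreserving (fun x i => x (e i)) (cubeMeasure n) (cubeMeasure n) := by
  unfold cubeMeasure
  -- The inverse is needed because `piCongrLeft` transports a family along a permutation, so it
  -- composes with the inverse permutation.
  have h1 := measurePreserving_piCongrLeft (fun _ : Fin n => volume.restrict (Ioo (0 : ℝ) 1)) e.symm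
  convert h1 using 1
  funext x i
  simp [MeasurableEquiv.coe_piCongrLeft, Equiv.piCongrLeft_apply]

theorem measurePreserving_reflectSwap (hn : 2 ≤ n) :
    MeasurePreserving (reflectSwap hn) (cubeMeasure n) (cubeMeasure n) := by
  have h1 := measurePreserving_comp_perm (Equiv.swap (⟨0, by omega⟩ : Fin n) ⟨1, by omega⟩)
  have h2 := measurePreserving_pi (fun _ : Fin n => volume.restrict (Ioo (0 : ℝ) 1))
    (fun _ : Fin n => volume.restrict (Ioo (0 : ℝ) 1))
    (f := fun i : Fin n => if (i : ℕ) < 2 then fun x : ℝ => 1 - x else id) (by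
      intro i
      split_ifs
      · exact measurePreserving_one_sub_Ioo
      · exact MeasurePreserving.id _)
  unfold cubeMeasure at h1 ⊢
  have h3 := h2.comp h1
  convert h3 using 1
  funext x i
  simp only [reflectSwap, Function.comp]
  split_ifs <;> rfl

theorem coord_reflectSwap (hn : 2 ≤ n) (x : Fin n → ℝ) (k : ℕ) :
    coord (reflectSwap hn x) k
      = if k = 1 then 1 - coord x 2 else if k = 2 then 1 - coord x 1 else coord x k := by
  by_cases h1 : k = 1
  · subst h1
    rw [if_pos rfl, coord, dif_pos ⟨le_rfl, by omega⟩, reflectSwap, coord, dif_pos ⟨by omega, hn⟩]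
    simp
  by_cases h2 : k = 2
  · subst h2
    rw [if_neg h1, if_pos rfl, coord, dif_pos ⟨by omega, by omega⟩, reflectSwap, coord,
      dif_pos ⟨by omega, by omega⟩]
    simp
  rw [if_neg h1, if_neg h2]
  unfold coord
  split_ifs with h
  · rw [reflectSwap, if_neg (by simp; omega), Equiv.swap_apply_of_ne_of_ne]
    · simp [Fin.ext_iff]; omega
    · simp [Fin.ext_iff]; omega
  · rfl

/-- One has `δ_2 = 1 - (1-x_1) x_2`, and the map exchanges `1-x_1` and `x_2`. The later `δ_k` depend
on `x_1, x_2` through `δ_2` only; `δ_1` itself is not preserved. -/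
theorem delta_reflectSwap (hn : 2 ≤ n) (x : Fin n → ℝ) {k : ℕ} (hk : 2 ≤ k) :
    delta (reflectSwap hn x) k = delta x k := by
  induction k, hk using Nat.le_induction with
  | base => simp [delta, coord_reflectSwap]; ring
  | succ k hk ih =>
    rw [delta_succ, delta_succ, ih, coord_reflectSwap, if_neg (by omega), if_neg (by omega)]

theorem prod_Icc_one_split {M : Type*} [CommMonoid M] (hn : 2 ≤ n) (f : ℕ → M) :
    ∏ k ∈ Finset.Icc 1 n, f k = f 1 * f 2 * ∏ k ∈ Finset.Icc 3 n, f k := by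
  rw [← Finset.mul_prod_Ioc_eq_prod_Icc (by omega : 1 ≤ n), ← Finset.Icc_succ_left_eq_Ioc,
    show Order.succ 1 = 2 from rfl, ← Finset.mul_prod_Ioc_eq_prod_Icc hn,
    ← Finset.Icc_succ_left_eq_Ioc, mul_assoc]
  rfl

theorem integrand_reflectSwap (hn : 2 ≤ n) {A B C A' B' : ℕ → ℝ} (x : Fin n → ℝ)
    (hA' : ∀ k, A' k = if k = 1 then B 2 else if k = 2 then B 1 else A k)
    (hB' : ∀ k, B' k = if k = 1 then A 2 else if k = 2 then A 1 else B k) :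
    integrand A B C (reflectSwap hn x) = integrand A' B' C x := by
  unfold integrand
  rw [delta_reflectSwap hn x hn, prod_Icc_one_split hn, prod_Icc_one_split hn]
  congr 2
  · congr 1
    · simp only [coord_reflectSwap, hA', hB']
      norm_num
      ring
    · refine Finset.prod_congr rfl fun k hk => ?_
      have := (Finset.mem_Icc.1 hk).1
      rw [hA', hB', coord_reflectSwap, if_neg (by omega), if_neg (by omega), if_neg (by omega),
        if_neg (by omega), if_neg (by omega), if_neg (by omega)]
  · refine Finset.prod_congr rfl fun k hk => ?_
    rw [delta_reflectSwap hn x (Finset.mem_Icc.1 hk).1]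

theorem realL_sigma (hn : 2 ≤ n) {A B C A' B' : ℕ → ℝ}
    (hA' : ∀ k, A' k = if k = 1 then B 2 else if k = 2 then B 1 else A k)
    (hB' : ∀ k, B' k = if k = 1 then A 2 else if k = 2 then A 1 else B k) :
    realL n A' B' C = realL n A B C := by
  symm
  unfold realL
  rw [← (measurePreserving_reflectSwap hn).lintegral_comp (by fun_prop)]
  simp only [integrand_reflectSwap hn _ hA' hB']

end Sigma

end RhinViola

namespace RhinViola

open Set ProbabilityTheory

/-! ### The transformation `ψ`: the variables `δ_1,…,δ_n` -/

section Psi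

variable {n : ℕ}

/-- The first `k` coordinates of `x` are replaced by `δ_1,…,δ_k`. -/
noncomputable def deltaUpTo (k : ℕ) (x : Fin n → ℝ) : Fin n → ℝ := fun i =>
  if (i : ℕ) < k then delta x (i + 1) else x i

/-- The coordinate `d_k`, with the convention `d_0 = 1`. -/
noncomputable def coord' (d : Fin n → ℝ) (k : ℕ) : ℝ := if k = 0 then 1 else coord d k

/-- The density of the change of variables from `x_{k+1}` to `δ_{k+1}`. -/
noncomputable def deltaDensity (k : ℕ) (d : Fin n → ℝ) : ℝ≥0∞ :=
  if 1 < coord' d (k + 1) + coord' d k then ENNReal.ofReal (coord' d k)⁻¹ else 0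

/-- The image of `(0,1)` is `(1-D,1)`, which lies in `(0,1)` because `D ≤ 1`. Writing it as a
condition inside `(0,1)` keeps the same cube as domain throughout the change of variables. -/
theorem lintegral_affine_Ioo {D : ℝ} (hD : 0 < D) (hD1 : D ≤ 1) (f : ℝ → ℝ≥0∞) :
    ∫⁻ y in Ioo (0 : ℝ) 1, f (1 - y * D)
      = ∫⁻ u in Ioo (0 : ℝ) 1, f u * (if 1 < u + D then ENNReal.ofReal D⁻¹ else 0) := by
  have himg : (fun y : ℝ => 1 - y * D) '' Ioo 0 1 = Ioo (1 - D) 1 := by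
    ext u
    simp only [mem_image, mem_Ioo]
    constructor
    · rintro ⟨y, ⟨h0, h1⟩, rfl⟩
      constructor <;> nlinarith
    · rintro ⟨h0, h1⟩
      refine ⟨(1 - u) / D, ⟨div_pos (by linarith) hD, (div_lt_one hD).2 (by linarith)⟩, ?_⟩
      field_simp
      ring
  have key := lintegral_image_eq_lintegral_abs_deriv_mul (measurableSet_Ioo (a := (0 : ℝ)) (b := 1))
    (f := fun y : ℝ => 1 - y * D) (f' := fun _ => -D)
    (fun y _ => by
      have := ((hasDerivAt_id y).mul_const D).const_sub 1
      simpa using this.hasDerivWithinAt)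
    (fun x _ y _ h => by
      simp only at h
      have : x * D = y * D := by linarith
      exact mul_right_cancel₀ hD.ne' this)
    (fun u => f u * ENNReal.ofReal D⁻¹)
  rw [himg] at key
  have e1 : ∫⁻ u in Ioo (0 : ℝ) 1, f u * (if 1 < u + D then ENNReal.ofReal D⁻¹ else 0)
      = ∫⁻ u in Ioo (1 - D) 1, f u * ENNReal.ofReal D⁻¹ := by
    rw [← lintegral_indicator measurableSet_Ioo, ← lintegral_indicator measurableSet_Ioo]
    congr 1
    ext u
    simp only [indicator, mem_Ioo]
    by_cases h : 1 < u + D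
    · simp only [h, if_true]
      congr 1
      rw [eq_iff_iff]
      constructor <;> rintro ⟨h1, h2⟩ <;> constructor <;> linarith
    · have : ¬ (1 - D < u ∧ u < 1) := fun h' => h (by linarith [h'.1])
      simp [h, this]
  rw [e1, key]
  refine setLIntegral_congr_fun measurableSet_Ioo fun y _ => ?_
  simp only [abs_neg, abs_of_pos hD]
  rw [mul_left_comm, ← ENNReal.ofReal_mul hD.le, mul_inv_cancel₀ hD.ne', ENNReal.ofReal_one,
    mul_one]

theorem coord_deltaUpTo (k : ℕ) (x : Fin n → ℝ) {j : ℕ} (h1 : 1 ≤ j) (h2 : j ≤ n) :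
    coord (deltaUpTo k x) j = if j ≤ k then delta x j else coord x j := by
  rw [coord, dif_pos ⟨h1, h2⟩, deltaUpTo]
  simp only
  rw [show j - 1 + 1 = j by omega]
  by_cases h : j ≤ k
  · rw [if_pos h, if_pos (by omega)]
  · rw [if_neg h, if_neg (by omega), coord, dif_pos ⟨h1, h2⟩]

theorem coord'_deltaUpTo {k : ℕ} (x : Fin n → ℝ) {j : ℕ} (h1 : j ≤ k) (h2 : j ≤ n) :
    coord' (deltaUpTo k x) j = delta x j := by
  unfold coord'
  split_ifs with h
  · subst h; rfl
  · rw [coord_deltaUpTo _ _ (by omega) h2, if_pos h1]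

theorem deltaUpTo_succ_update (x : Fin n → ℝ) (i : Fin n) (y : ℝ) :
    deltaUpTo (i + 1) (Function.update x i y)
      = Function.update (deltaUpTo i x) i (1 - y * delta x i) := by
  funext j
  by_cases hj : j = i
  · subst hj
    rw [Function.update_self, deltaUpTo, if_pos (by omega), delta_succ, coord_update, if_pos rfl,
      delta_update_of_le _ _ _ le_rfl]
  · have hj' : (j : ℕ) ≠ i := fun h => hj (Fin.ext h)
    rw [Function.update_of_ne hj, deltaUpTo, deltaUpTo]
    by_cases h : (j : ℕ) < i
    · rw [if_pos (by omega), if_pos h, delta_update_of_le _ _ _ (by omega)]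
    · rw [if_neg (by omega), if_neg h, Function.update_of_ne hj]

theorem deltaUpTo_update (x : Fin n → ℝ) (i : Fin n) (y : ℝ) :
    deltaUpTo i (Function.update x i y) = Function.update (deltaUpTo i x) i y := by
  funext j
  by_cases hj : j = i
  · subst hj
    rw [Function.update_self, deltaUpTo, if_neg (by omega), Function.update_self]
  · rw [Function.update_of_ne hj, deltaUpTo, deltaUpTo]
    by_cases h : (j : ℕ) < i
    · rw [if_pos h, if_pos h, delta_update_of_le _ _ _ (by omega)]
    · rw [if_neg h, if_neg h, Function.update_of_ne hj]

@[fun_prop]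
theorem measurable_coord' (k : ℕ) : Measurable fun x : Fin n → ℝ => coord' x k := by
  unfold coord'
  split_ifs <;> fun_prop

@[fun_prop]
theorem measurable_deltaUpTo (k : ℕ) : Measurable (deltaUpTo k : (Fin n → ℝ) → Fin n → ℝ) := by
  unfold deltaUpTo
  refine measurable_pi_lambda _ fun i => ?_
  split_ifs <;> fun_prop

@[fun_prop]
theorem measurable_deltaDensity (k : ℕ) : Measurable fun d : Fin n → ℝ => deltaDensity k d := by
  unfold deltaDensity
  exact Measurable.ite (measurableSet_lt (by fun_prop) (by fun_prop)) (by fun_prop)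
    measurable_const

/-- Only `x_{k+1}` is replaced, by `1 - x_{k+1} δ_k`. Since `δ_k` does not depend on `x_{k+1}`, this
is an affine substitution in one variable, and no Jacobian determinant is required. -/
theorem lintegral_deltaUpTo_succ {k : ℕ} (hk : k < n) {F : (Fin n → ℝ) → ℝ≥0∞}
    (hF : Measurable F) :
    ∫⁻ x, F (deltaUpTo (k + 1) x) ∂cubeMeasure n
      = ∫⁻ x, F (deltaUpTo k x) * deltaDensity k (deltaUpTo k x) ∂cubeMeasure n := by
  refine lintegral_cube_eq_of_coord ⟨k, hk⟩ (by fun_prop) (by fun_prop) fun x hx => ?_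
  have e1 := fun y => deltaUpTo_succ_update x ⟨k, hk⟩ y
  have e2 := fun y => deltaUpTo_update x ⟨k, hk⟩ y
  simp only at e1 e2
  simp only [e1, e2]
  rw [lintegral_affine_Ioo (delta_pos hx hk.le) (delta_le_one hx hk.le)
    (fun u => F (Function.update (deltaUpTo k x) ⟨k, hk⟩ u))]
  congr 1
  funext u
  have h1 : coord' (Function.update (deltaUpTo k x) ⟨k, hk⟩ u) (k + 1) = u := by
    rw [coord', if_neg (by omega), coord_update, if_pos rfl]
  have h2 : coord' (Function.update (deltaUpTo k x) ⟨k, hk⟩ u) k = delta x k := by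
    rw [← coord'_deltaUpTo x le_rfl hk.le]
    unfold coord'
    rw [coord_update, if_neg (Nat.ne_of_lt (Nat.lt_succ_self k))]
  rw [deltaDensity, h1, h2]

/-- Change of variables from `x` to `(δ_1,…,δ_n)`. -/
theorem lintegral_deltaUpTo {k : ℕ} (hk : k ≤ n) {F : (Fin n → ℝ) → ℝ≥0∞}
    (hF : Measurable F) :
    ∫⁻ x, F (deltaUpTo k x) ∂cubeMeasure n
      = ∫⁻ x, F x * ∏ j ∈ Finset.range k, deltaDensity j x ∂cubeMeasure n := by
  induction k generalizing F with
  | zero =>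
    have : (deltaUpTo 0 : (Fin n → ℝ) → Fin n → ℝ) = id := by
      funext x i; simp [deltaUpTo]
    simp [this]
  | succ k ih =>
    rw [lintegral_deltaUpTo_succ (by omega) hF,
      ih (by omega) (F := fun d => F d * deltaDensity k d) (by fun_prop)]
    simp only [Finset.prod_range_succ, mul_assoc, mul_comm (deltaDensity k _)]

theorem sum_Icc_one_add_two (m : ℕ) (f : ℕ → ℝ) :
    ∑ k ∈ Finset.Icc 1 (m + 2), f k = f 1 + ∑ i ∈ Finset.range m, f (i + 2) + f (m + 2) := by
  induction m with
  | zero => rw [Finset.sum_Icc_succ_top (by omega)]; simp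
  | succ m ih =>
    rw [Finset.sum_Icc_succ_top (by omega), ih, Finset.sum_range_succ]; ring

theorem sum_Icc_two_add_two (m : ℕ) (f : ℕ → ℝ) :
    ∑ k ∈ Finset.Icc 2 (m + 2), f k = ∑ i ∈ Finset.range m, f (i + 2) + f (m + 2) := by
  induction m with
  | zero => simp
  | succ m ih =>
    rw [Finset.sum_Icc_succ_top (by omega), ih, Finset.sum_range_succ]

/-- The logarithm of the integrand in the variables `δ_k`, in terms of `l k = log δ_k`,
`r k = log (1 - δ_k)` and `s k = log (δ_k + δ_{k-1} - 1)`. -/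
noncomputable def logForm (n : ℕ) (A B C l r s : ℕ → ℝ) : ℝ :=
  ∑ k ∈ Finset.Icc 1 n, ((r k - l (k - 1)) * A k + (s k - l (k - 1)) * B k)
    - ∑ k ∈ Finset.Icc 2 n, l k * C k - l n

/-- Collects the exponent of each factor, Jacobian `∏_{j<n} 1/δ_j` included. The hypotheses encode
`δ_0 = 1` and `δ_1 + δ_0 - 1 = δ_1`; the latter merges `b_1` into the exponent of `δ_1`. -/
theorem logForm_sub (m : ℕ) (A B C l r s : ℕ → ℝ) (hl : l 0 = 0) (hs : s 1 = l 1) :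
    logForm (m + 2) A B C l r s - ∑ j ∈ Finset.range (m + 2), l j
      = (r 1 * A 1 + ∑ i ∈ Finset.range m, r (i + 2) * A (i + 2) + r (m + 2) * A (m + 2))
        + ∑ i ∈ Finset.range (m + 1), s (i + 2) * B (i + 2)
        - (l 1 * (A 2 + B 2 - B 1 + 1)
          + ∑ i ∈ Finset.range m, l (i + 2) * (A (i + 3) + B (i + 3) + C (i + 2) + 1)
          + l (m + 2) * (C (m + 2) + 1)) := by
  have hshift : ∑ i ∈ Finset.range m, l (i + 1) * (A (i + 2) + B (i + 2))
      + l (m + 1) * (A (m + 2) + B (m + 2))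
      = ∑ i ∈ Finset.range m, l (i + 2) * (A (i + 3) + B (i + 3)) + l 1 * (A 2 + B 2) := by
    rw [← Finset.sum_range_succ (fun i => l (i + 1) * (A (i + 2) + B (i + 2))),
      Finset.sum_range_succ' (fun i => l (i + 1) * (A (i + 2) + B (i + 2)))]
  rw [logForm, sum_Icc_one_add_two, sum_Icc_two_add_two, Finset.sum_range_succ' l (m + 1),
    Finset.sum_range_succ' (fun k => l (k + 1)) m,
    Finset.sum_range_succ (fun i => s (i + 2) * B (i + 2))]
  simp only [Nat.sub_self, show ∀ i, i + 2 - 1 = i + 1 from fun i => rfl,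
    hl, hs, add_assoc, one_add_one_eq_two]
  have e : ∀ i, (r (i + 2) - l (i + 1)) * A (i + 2) + (s (i + 2) - l (i + 1)) * B (i + 2)
      = r (i + 2) * A (i + 2) + s (i + 2) * B (i + 2) - l (i + 1) * (A (i + 2) + B (i + 2)) :=
    fun i => by ring
  have e' : ∀ i, l (i + 2) * (A (i + 3) + (B (i + 3) + (C (i + 2) + 1)))
      = l (i + 2) * (A (i + 3) + B (i + 3)) + l (i + 2) * C (i + 2) + l (i + 2) :=
    fun i => by ring
  simp only [e, e', Finset.sum_add_distrib, Finset.sum_sub_distrib]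
  linear_combination -hshift

/-- The formulas for `ψ` are the solution of the equations that match the exponents of `logForm_sub`
in reverse order: those of `1-δ_k` give `a'`, those of `δ_k+δ_{k-1}-1` give `b'_k` for `k ≥ 2`, that
of `δ_1` gives `b'_1`, and those of the other `δ_k` give `c'`. -/
theorem logForm_reverse {m : ℕ} {A B C A' B' C' l r s l' r' s' : ℕ → ℝ} (hl : l 0 = 0)
    (hs : s 1 = l 1) (hl' : l' 0 = 0) (hs' : s' 1 = l' 1)
    (hll : ∀ k, 1 ≤ k → k ≤ m + 2 → l' k = l (m + 3 - k))
    (hrr : ∀ k, 1 ≤ k → k ≤ m + 2 → r' k = r (m + 3 - k))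
    (hss : ∀ k, 2 ≤ k → k ≤ m + 2 → s' k = s (m + 4 - k))
    (hA : ∀ k, A' k = A (m + 3 - k))
    (hB : ∀ k, B' k = if k = 1 then A (m + 1) + B (m + 2) - C (m + 2) else B (m + 4 - k))
    (hC : ∀ k, C' k = if k = m + 2 then A 2 + B 2 - B 1
      else A (m + 4 - k) + B (m + 4 - k) + C (m + 3 - k) - B (m + 3 - k) - A (m + 2 - k)) :
    logForm (m + 2) A' B' C' l' r' s' - ∑ j ∈ Finset.range (m + 2), l' j
      = logForm (m + 2) A B C l r s - ∑ j ∈ Finset.range (m + 2), l j := by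
  rw [logForm_sub m _ _ _ _ _ _ hl hs, logForm_sub m _ _ _ _ _ _ hl' hs']
  have h1 : ∑ i ∈ Finset.range m, r' (i + 2) * A' (i + 2)
      = ∑ i ∈ Finset.range m, r (i + 2) * A (i + 2) := by
    rw [← Finset.sum_range_reflect]
    refine Finset.sum_congr rfl fun i hi => ?_
    rw [Finset.mem_range] at hi
    rw [hrr _ (by omega) (by omega), hA, show m + 3 - (m - 1 - i + 2) = i + 2 by omega]
  have h2 : ∑ i ∈ Finset.range (m + 1), s' (i + 2) * B' (i + 2)
      = ∑ i ∈ Finset.range (m + 1), s (i + 2) * B (i + 2) := by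
    rw [← Finset.sum_range_reflect]
    refine Finset.sum_congr rfl fun i hi => ?_
    rw [Finset.mem_range] at hi
    rw [hss _ (by omega) (by omega), hB, if_neg (by omega),
      show m + 4 - (m + 1 - 1 - i + 2) = i + 2 by omega]
  have h3 : ∑ i ∈ Finset.range m, l' (i + 2) * (A' (i + 3) + B' (i + 3) + C' (i + 2) + 1)
      = ∑ i ∈ Finset.range m, l (i + 2) * (A (i + 3) + B (i + 3) + C (i + 2) + 1) := by
    rw [← Finset.sum_range_reflect]
    refine Finset.sum_congr rfl fun i hi => ?_
    rw [Finset.mem_range] at hi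
    rw [hll _ (by omega) (by omega), hA, hB, hC, if_neg (by omega), if_neg (by omega),
      show m + 3 - (m - 1 - i + 2) = i + 2 by omega,
      show m + 3 - (m - 1 - i + 3) = i + 1 by omega,
      show m + 4 - (m - 1 - i + 3) = i + 2 by omega,
      show m + 4 - (m - 1 - i + 2) = i + 3 by omega,
      show m + 2 - (m - 1 - i + 2) = i + 1 by omega]
    ring
  rw [h1, h2, h3, hrr 1 le_rfl (by omega), hrr (m + 2) (by omega) le_rfl, hll 1 le_rfl (by omega),
    hll (m + 2) (by omega) le_rfl, hA, hA, hA, hB, hB, hC, if_pos rfl, if_pos rfl,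
    if_neg (by omega), show m + 3 - 1 = m + 2 by omega, show m + 3 - (m + 2) = 1 by omega,
    show m + 3 - 2 = m + 1 by omega, show m + 4 - 2 = m + 2 by omega]
  ring

/-- Uses `x_k = (1-δ_k)/δ_{k-1}` and `1-x_k = (δ_k+δ_{k-1}-1)/δ_{k-1}`. -/
theorem integrand_eq_exp_logForm {A B C : ℕ → ℝ} {x : Fin n → ℝ}
    (hx : ∀ i, x i ∈ Ioo (0 : ℝ) 1) :
    integrand A B C x = Real.exp (logForm n A B C
      (fun k => Real.log (coord' (deltaUpTo n x) k))
      (fun k => Real.log (1 - coord' (deltaUpTo n x) k))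
      (fun k => Real.log (coord' (deltaUpTo n x) k + coord' (deltaUpTo n x) (k - 1) - 1))) := by
  rw [integrand_eq_exp hx, logForm, coord'_deltaUpTo x le_rfl le_rfl]
  congr 3
  · refine Finset.sum_congr rfl fun k hk => ?_
    rw [Finset.mem_Icc] at hk
    obtain ⟨k, rfl⟩ := Nat.exists_eq_add_of_le' hk.1
    rw [Nat.add_sub_cancel, coord'_deltaUpTo x hk.2 hk.2,
      coord'_deltaUpTo x (j := k) (by omega) (by omega)]
    have h1 := coord_mem hx hk.1 hk.2
    have hd := delta_pos hx (k := k) (by omega)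
    have e1 : 1 - delta x (k + 1) = coord x (k + 1) * delta x k := by rw [delta_succ]; ring
    have e2 : delta x (k + 1) + delta x k - 1 = (1 - coord x (k + 1)) * delta x k := by
      rw [delta_succ]; ring
    rw [e1, e2, Real.log_mul h1.1.ne' hd.ne', Real.log_mul (by linarith [h1.2]) hd.ne']
    ring
  · refine Finset.sum_congr rfl fun k hk => ?_
    rw [Finset.mem_Icc] at hk
    rw [coord'_deltaUpTo x hk.2 hk.2]

theorem coord'_mem {d : Fin n → ℝ} (hd : ∀ i, d i ∈ Ioo (0 : ℝ) 1) {k : ℕ} (h2 : k ≤ n) :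
    coord' d k ∈ Ioc (0 : ℝ) 1 := by
  unfold coord'
  split_ifs with h
  · simp
  · exact Ioo_subset_Ioc_self (coord_mem hd (by omega) h2)

theorem prod_deltaDensity {d : Fin n → ℝ} (hd : ∀ i, d i ∈ Ioo (0 : ℝ) 1) :
    ∏ j ∈ Finset.range n, deltaDensity j d
      = if ∀ j < n, 1 < coord' d (j + 1) + coord' d j then
        ENNReal.ofReal (Real.exp (-∑ j ∈ Finset.range n, Real.log (coord' d j))) else 0 := by
  split_ifs with h
  · rw [← Finset.sum_neg_distrib, Real.exp_sum,
      ENNReal.ofReal_prod_of_nonneg fun _ _ => (Real.exp_pos _).le]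
    refine Finset.prod_congr rfl fun j hj => ?_
    rw [Finset.mem_range] at hj
    rw [deltaDensity, if_pos (h j hj), Real.exp_neg, Real.exp_log (coord'_mem hd hj.le).1]
  · push Not at h
    obtain ⟨j, hj, hlt⟩ := h
    refine Finset.prod_eq_zero (Finset.mem_range.2 hj) ?_
    rw [deltaDensity, if_neg (not_lt.2 hlt)]

@[fun_prop]
theorem measurable_logForm (A B C : ℕ → ℝ) : Measurable fun d : Fin n → ℝ => logForm n A B C
    (fun k => Real.log (coord' d k)) (fun k => Real.log (1 - coord' d k))
    (fun k => Real.log (coord' d k + coord' d (k - 1) - 1)) := by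
  unfold logForm
  fun_prop

theorem realL_eq_lintegral_delta (n : ℕ) (A B C : ℕ → ℝ) :
    realL n A B C = ∫⁻ d, ENNReal.ofReal (Real.exp (logForm n A B C
        (fun k => Real.log (coord' d k)) (fun k => Real.log (1 - coord' d k))
        (fun k => Real.log (coord' d k + coord' d (k - 1) - 1))))
      * ∏ j ∈ Finset.range n, deltaDensity j d ∂cubeMeasure n := by
  rw [← lintegral_deltaUpTo le_rfl (F := fun d => ENNReal.ofReal (Real.exp (logForm n A B C
        (fun k => Real.log (coord' d k)) (fun k => Real.log (1 - coord' d k))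
        (fun k => Real.log (coord' d k + coord' d (k - 1) - 1))))) (by fun_prop)]
  exact lintegral_cube_congr fun x hx => by rw [integrand_eq_exp_logForm hx]

theorem coord'_rev (d : Fin n → ℝ) {k : ℕ} (h1 : 1 ≤ k) (h2 : k ≤ n) :
    coord' (fun i => d (Fin.revPerm i)) k = coord' d (n + 1 - k) := by
  rw [coord', if_neg (by omega), coord', if_neg (by omega), coord, dif_pos ⟨h1, h2⟩, coord,
    dif_pos ⟨by omega, by omega⟩]
  congr 1
  ext
  simp
  omega

theorem realL_psi {m : ℕ} {A B C A' B' C' : ℕ → ℝ}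
    (hA : ∀ k, A' k = A (m + 3 - k))
    (hB : ∀ k, B' k = if k = 1 then A (m + 1) + B (m + 2) - C (m + 2) else B (m + 4 - k))
    (hC : ∀ k, C' k = if k = m + 2 then A 2 + B 2 - B 1
      else A (m + 4 - k) + B (m + 4 - k) + C (m + 3 - k) - B (m + 3 - k) - A (m + 2 - k)) :
    realL (m + 2) A' B' C' = realL (m + 2) A B C := by
  rw [realL_eq_lintegral_delta, realL_eq_lintegral_delta,
    ← (measurePreserving_comp_perm Fin.revPerm).lintegral_comp (by fun_prop)]
  refine lintegral_cube_congr fun d hd => ?_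
  set d' : Fin (m + 2) → ℝ := fun i => d (Fin.revPerm i) with hd'
  have hdm : ∀ i, d' i ∈ Ioo (0 : ℝ) 1 := fun i => hd _
  have hc : ∀ k, 1 ≤ k → k ≤ m + 2 → coord' d' k = coord' d (m + 3 - k) := fun k h1 h2 =>
    coord'_rev d h1 h2
  have h0 : coord' d 0 = 1 := rfl
  have h0' : coord' d' 0 = 1 := rfl
  -- Reversal exchanges the conditions for `j` and `n - j` when `1 ≤ j ≤ n-1`. The condition for `j
  -- = 0` has no partner, but it is automatic because `d_0 = 1` and `d_1 > 0`.
  have hgood : (∀ j < m + 2, 1 < coord' d' (j + 1) + coord' d' j)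
      ↔ ∀ j < m + 2, 1 < coord' d (j + 1) + coord' d j := by
    constructor
    · intro h j hj
      rcases Nat.eq_zero_or_pos j with rfl | hj0
      · have := (coord'_mem hd (k := 1) (by omega)).1
        rw [h0]; linarith
      · have := h (m + 2 - j) (by omega)
        rw [hc _ (by omega) (by omega), hc _ (by omega) (by omega),
          show m + 3 - (m + 2 - j + 1) = j by omega,
          show m + 3 - (m + 2 - j) = j + 1 by omega] at this
        linarith
    · intro h j hj
      rcases Nat.eq_zero_or_pos j with rfl | hj0
      · have := (coord'_mem hdm (k := 1) (by omega)).1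
        rw [h0']; linarith
      · have := h (m + 2 - j) (by omega)
        rw [hc _ (by omega) (by omega), hc _ (by omega) (by omega),
          show m + 3 - (j + 1) = m + 2 - j by omega,
          show m + 3 - j = m + 2 - j + 1 by omega]
        linarith
  rw [prod_deltaDensity hd, prod_deltaDensity hdm]
  simp only [hgood]
  split_ifs
  · rw [← ENNReal.ofReal_mul (Real.exp_pos _).le, ← ENNReal.ofReal_mul (Real.exp_pos _).le,
      ← Real.exp_add, ← Real.exp_add, ← sub_eq_add_neg, ← sub_eq_add_neg]
    congr 2
    exact logForm_reverse (m := m) (l := fun k => Real.log (coord' d k))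
      (r := fun k => Real.log (1 - coord' d k))
      (s := fun k => Real.log (coord' d k + coord' d (k - 1) - 1))
      (l' := fun k => Real.log (coord' d' k)) (r' := fun k => Real.log (1 - coord' d' k))
      (s' := fun k => Real.log (coord' d' k + coord' d' (k - 1) - 1))
      (by simp [h0]) (by simp [h0]) (by simp [h0']) (by simp [h0'])
      (fun k h1 h2 => by simp only [hc k h1 h2]) (fun k h1 h2 => by simp only [hc k h1 h2])
      (fun k h1 h2 => by
        rw [hc k (by omega) h2, hc (k - 1) (by omega) (by omega),
          show m + 3 - (k - 1) = m + 4 - k by omega, show m + 4 - k - 1 = m + 3 - k by omega,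
          add_comm (coord' d _)]) hA hB hC
  · simp

end Psi

end RhinViola

namespace RhinViola

open Set ProbabilityTheory Filter Topology

/-! ### Convergence forces the exponents to exceed `-1` -/

section Necessity

variable {n : ℕ} {A B C : ℕ → ℝ}

/-- Near `0` the factor `h` is at least `h 0 / 2`, so `y^s` itself must be integrable there. -/
theorem neg_one_lt_of_lintegral_rpow_mul_ne_top {s : ℝ} {h : ℝ → ℝ} (hc : ContinuousAt h 0)
    (h0 : 0 < h 0) (hfin : ∫⁻ y in Ioo (0 : ℝ) 1, ENNReal.ofReal (y ^ s * h y) ≠ ⊤) : -1 < s := by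
  have hev : ∀ᶠ y in 𝓝 (0 : ℝ), h 0 / 2 < h y := hc.eventually_const_lt (by linarith)
  obtain ⟨ε, hε, hball⟩ := Metric.eventually_nhds_iff.1 hev
  set δ := min ε 1 with hδ
  have hδ0 : 0 < δ := lt_min hε one_pos
  have hle : ∫⁻ y in Ioo (0 : ℝ) δ, ENNReal.ofReal (y ^ s * (h 0 / 2))
      ≤ ∫⁻ y in Ioo (0 : ℝ) 1, ENNReal.ofReal (y ^ s * h y) := by
    refine (setLIntegral_mono' measurableSet_Ioo fun y hy => ?_).trans
      (lintegral_mono_set (Ioo_subset_Ioo_right (min_le_right ε 1)))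
    refine ENNReal.ofReal_le_ofReal (mul_le_mul_of_nonneg_left ?_ (Real.rpow_nonneg hy.1.le _))
    refine (hball ?_).le
    rw [dist_zero_right, Real.norm_eq_abs, abs_of_pos hy.1]
    exact hy.2.trans_le (min_le_left _ _)
  have hint : Integrable (fun y : ℝ => y ^ s * (h 0 / 2)) (volume.restrict (Ioo 0 δ)) := by
    rw [← lintegral_ofReal_ne_top_iff_integrable (by fun_prop)]
    · exact ne_top_of_le_ne_top hfin hle
    · filter_upwards [ae_restrict_mem measurableSet_Ioo] with y hy
      exact mul_nonneg (Real.rpow_nonneg hy.1.le _) (by linarith)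
  have hint' : IntegrableOn (fun y : ℝ => y ^ s) (Ioo 0 δ) := by
    have := hint.mul_const (h 0 / 2)⁻¹
    refine this.congr (Eventually.of_forall fun y => ?_)
    field_simp
  exact (intervalIntegral.integrableOn_Ioo_rpow_iff hδ0).1 hint'

/-- Setting the exponent to `0` instead of deleting the factor leaves an integrand of the same
shape, which is regular on the face `x_k = 0`. -/
theorem integrand_factor_left {k : ℕ} (h1 : 1 ≤ k) (h2 : k ≤ n) (x : Fin n → ℝ) :
    integrand A B C x = coord x k ^ A k * integrand (Function.update A k 0) B C x := by
  have hk : k ∈ Finset.Icc 1 n := Finset.mem_Icc.2 ⟨h1, h2⟩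
  have e : ∏ j ∈ (Finset.Icc 1 n).erase k, coord x j ^ Function.update A k 0 j
      * (1 - coord x j) ^ B j
      = ∏ j ∈ (Finset.Icc 1 n).erase k, coord x j ^ A j * (1 - coord x j) ^ B j :=
    Finset.prod_congr rfl fun j hj => by rw [Function.update_of_ne (Finset.ne_of_mem_erase hj)]
  unfold integrand
  rw [← Finset.mul_prod_erase _ _ hk, ← Finset.mul_prod_erase _ _ hk, e, Function.update_self,
    Real.rpow_zero]
  ring

theorem integrand_factor_right {k : ℕ} (h1 : 1 ≤ k) (h2 : k ≤ n) (x : Fin n → ℝ) :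
    integrand A B C x = (1 - coord x k) ^ B k * integrand A (Function.update B k 0) C x := by
  have hk : k ∈ Finset.Icc 1 n := Finset.mem_Icc.2 ⟨h1, h2⟩
  have e : ∏ j ∈ (Finset.Icc 1 n).erase k, coord x j ^ A j
      * (1 - coord x j) ^ Function.update B k 0 j
      = ∏ j ∈ (Finset.Icc 1 n).erase k, coord x j ^ A j * (1 - coord x j) ^ B j :=
    Finset.prod_congr rfl fun j hj => by rw [Function.update_of_ne (Finset.ne_of_mem_erase hj)]
  unfold integrand
  rw [← Finset.mul_prod_erase _ _ hk, ← Finset.mul_prod_erase _ _ hk, e, Function.update_self,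
    Real.rpow_zero]
  ring

/-- Positivity of `δ_k` is asked from `k = 2` on only: `δ_1` vanishes on the face `x_1 = 1`, but for
`n ≥ 2` it does not occur in the integrand. -/
theorem integrand_pos_of_boundary (hn : 2 ≤ n) {x : Fin n → ℝ}
    (hA : ∀ k, 1 ≤ k → k ≤ n → 0 < coord x k ∨ A k = 0)
    (hB : ∀ k, 1 ≤ k → k ≤ n → 0 < 1 - coord x k ∨ B k = 0)
    (hδ : ∀ k, 2 ≤ k → k ≤ n → 0 < delta x k) : 0 < integrand A B C x := by
  refine mul_pos (div_pos (Finset.prod_pos fun k hk => ?_) (Finset.prod_pos fun k hk => ?_))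
    (one_div_pos.2 (hδ n hn le_rfl))
  · rw [Finset.mem_Icc] at hk
    refine mul_pos ?_ ?_
    · rcases hA k hk.1 hk.2 with h | h
      · exact Real.rpow_pos_of_pos h _
      · rw [h, Real.rpow_zero]; exact one_pos
    · rcases hB k hk.1 hk.2 with h | h
      · exact Real.rpow_pos_of_pos h _
      · rw [h, Real.rpow_zero]; exact one_pos
  · rw [Finset.mem_Icc] at hk
    exact Real.rpow_pos_of_pos (hδ k hk.1 hk.2) _

theorem continuousAt_integrand_of_boundary (hn : 2 ≤ n) {x : Fin n → ℝ}
    (hA : ∀ k, 1 ≤ k → k ≤ n → 0 < coord x k ∨ A k = 0)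
    (hB : ∀ k, 1 ≤ k → k ≤ n → 0 < 1 - coord x k ∨ B k = 0)
    (hδ : ∀ k, 2 ≤ k → k ≤ n → 0 < delta x k) : ContinuousAt (integrand A B C) x := by
  unfold integrand
  refine ContinuousAt.mul (ContinuousAt.div ?_ ?_ (Finset.prod_pos fun k hk => ?_).ne')
    (continuousAt_const.div (by fun_prop) (hδ n hn le_rfl).ne')
  · refine tendsto_finsetProd _ fun k hk => ?_
    rw [Finset.mem_Icc] at hk
    exact ((continuous_coord k).continuousAt.rpow_const
      ((hA k hk.1 hk.2).imp ne_of_gt fun h => h.ge)).mul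
      (ContinuousAt.rpow_const (by fun_prop) ((hB k hk.1 hk.2).imp ne_of_gt fun h => h.ge))
  · refine tendsto_finsetProd _ fun k hk => ?_
    rw [Finset.mem_Icc] at hk
    exact (continuous_delta k).continuousAt.rpow_const (Or.inl (hδ k hk.1 hk.2).ne')
  · rw [Finset.mem_Icc] at hk
    exact Real.rpow_pos_of_pos (hδ k hk.1 hk.2) _

/-- Some line parallel to the `k`-th axis has a finite partial integral. On it the cofactor of
`x_k^{a_k}` is continuous and positive at `x_k = 0`, so the one-variable criterion applies. -/
theorem neg_one_lt_left_of_realL_ne_top (hn : 2 ≤ n) (h : realL n A B C ≠ ⊤) {k : ℕ}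
    (h1 : 1 ≤ k) (h2 : k ≤ n) : -1 < A k := by
  obtain ⟨x, hx, hfin⟩ := exists_lintegral_update_ne_top ⟨k - 1, by omega⟩ (by fun_prop) h
  set i : Fin n := ⟨k - 1, by omega⟩ with hi
  have hik : (i : ℕ) + 1 = k := by simp [hi]; omega
  have hcoord : ∀ y j, coord (Function.update x i y) j = if j = k then y else coord x j :=
    fun y j => by rw [coord_update, hik]
  have hA : ∀ j, 1 ≤ j → j ≤ n →
      0 < coord (Function.update x i 0) j ∨ Function.update A k 0 j = 0 := by
    intro j hj1 hj2
    rw [hcoord]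
    by_cases hj : j = k
    · right; rw [hj, Function.update_self]
    · left; rw [if_neg hj]; exact (coord_mem hx hj1 hj2).1
  have hB : ∀ j, 1 ≤ j → j ≤ n → 0 < 1 - coord (Function.update x i 0) j ∨ B j = 0 := by
    intro j hj1 hj2
    left
    rw [hcoord]
    split_ifs
    · norm_num
    · linarith [(coord_mem hx hj1 hj2).2]
  have hδ : ∀ j, 2 ≤ j → j ≤ n → 0 < delta (Function.update x i 0) j := by
    intro j _ hj2
    refine (delta_pos_le_one (m := 0) (by simp [delta]) (fun l hl1 hl2 => ?_)
      (Nat.zero_le _) hj2).1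
    rw [hcoord]
    split_ifs
    · simp
    · exact Ioo_subset_Ico_self (coord_mem hx hl1 hl2)
  refine neg_one_lt_of_lintegral_rpow_mul_ne_top
    (h := fun y => integrand (Function.update A k 0) B C (Function.update x i y)) ?_
    (integrand_pos_of_boundary hn hA hB hδ) ?_
  · exact ContinuousAt.comp (f := fun y => Function.update x i y)
      (continuousAt_integrand_of_boundary hn hA hB hδ)
      (Continuous.continuousAt (by fun_prop))
  · convert hfin using 4 with y
    rw [integrand_factor_left (A := A) h1 h2 (Function.update x i y), hcoord, if_pos rfl]

theorem neg_one_lt_right_of_realL_ne_top (hn : 2 ≤ n) (h : realL n A B C ≠ ⊤) {k : ℕ}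
    (h1 : 1 ≤ k) (h2 : k ≤ n) : -1 < B k := by
  obtain ⟨x, hx, hfin⟩ := exists_lintegral_update_ne_top ⟨k - 1, by omega⟩ (by fun_prop) h
  set i : Fin n := ⟨k - 1, by omega⟩ with hi
  have hik : (i : ℕ) + 1 = k := by simp [hi]; omega
  have hcoord : ∀ y j, coord (Function.update x i y) j = if j = k then y else coord x j :=
    fun y j => by rw [coord_update, hik]
  have hA : ∀ j, 1 ≤ j → j ≤ n → 0 < coord (Function.update x i 1) j ∨ A j = 0 := by
    intro j hj1 hj2
    left
    rw [hcoord]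
    split_ifs
    · norm_num
    · exact (coord_mem hx hj1 hj2).1
  have hB : ∀ j, 1 ≤ j → j ≤ n →
      0 < 1 - coord (Function.update x i 1) j ∨ Function.update B k 0 j = 0 := by
    intro j hj1 hj2
    rw [hcoord]
    by_cases hj : j = k
    · right; rw [hj, Function.update_self]
    · left; rw [if_neg hj]; linarith [(coord_mem hx hj1 hj2).2]
  have hlt : ∀ j < k, delta (Function.update x i 1) j = delta x j := fun j hj =>
    delta_update_of_le _ _ _ (by omega)
  have hδk : delta (Function.update x i 1) k = 1 - delta x (k - 1) := by
    obtain ⟨k, rfl⟩ := Nat.exists_eq_add_of_le' h1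
    rw [delta_succ, hcoord, if_pos rfl, hlt k (by omega), Nat.add_sub_cancel, one_mul]
  have htail : ∀ l, k < l → l ≤ n → coord (Function.update x i 1) l ∈ Ico (0 : ℝ) 1 :=
    fun l hl1 hl2 => by
      rw [hcoord, if_neg (by omega)]
      exact Ioo_subset_Ico_self (coord_mem hx (by omega) hl2)
  have hδ : ∀ j, 2 ≤ j → j ≤ n → 0 < delta (Function.update x i 1) j := by
    intro j hj1 hj2
    rcases lt_or_ge j k with hjk | hjk
    · rw [hlt j hjk]; exact delta_pos hx (by omega)
    · rcases Nat.lt_or_ge k 2 with hk | hk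
      · obtain rfl : k = 1 := by omega
        have hδ2 : delta (Function.update x i 1) 2 = 1 := by
          rw [delta_succ, hδk]; simp [delta]
        exact (delta_pos_le_one (m := 2) (by rw [hδ2]; simp)
          (fun l hl1 hl2 => htail l (by omega) hl2) hj1 hj2).1
      · refine (delta_pos_le_one (m := k) ?_ htail hjk hj2).1
        rw [hδk]
        have h3 := delta_pos hx (k := k - 1) (by omega)
        have h4 := delta_lt_one hx (k := k - 1) (by omega) (by omega)
        constructor <;> linarith
  refine neg_one_lt_of_lintegral_rpow_mul_ne_top
    (h := fun y => integrand A (Function.update B k 0) C (Function.update x i (1 - y))) ?_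
    ?_ ?_
  · refine ContinuousAt.comp (f := fun y : ℝ => Function.update x i (1 - y))
      (g := integrand A (Function.update B k 0) C) ?_
      (Continuous.continuousAt (by fun_prop))
    rw [sub_zero]
    exact continuousAt_integrand_of_boundary hn hA hB hδ
  · rw [sub_zero]
    exact integrand_pos_of_boundary hn hA hB hδ
  -- Reflecting `y ↦ 1 - y` moves the face `x_k = 1` to `0`, where the one-variable criterion is
  -- stated.
  · rw [← measurePreserving_one_sub_Ioo.lintegral_comp (by fun_prop)] at hfin
    convert hfin using 4 with y
    rw [integrand_factor_right (B := B) h1 h2 (Function.update x i (1 - y)), hcoord, if_pos rfl,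
      sub_sub_cancel]

end Necessity

/-! ### Translation by a real parameter and analytic continuation -/

section Shift

variable {n : ℕ} {A B C : ℕ → ℝ}

/-- `L` at the parameters translated by `t` in the direction of `a = b = 1`, `c_n = 1`. -/
noncomputable def shiftL (n : ℕ) (A B C : ℕ → ℝ) (t : ℝ) : ℝ≥0∞ :=
  realL n (fun k => A k + t) (fun k => B k + t) (fun k => C k + if k = n then t else 0)

theorem shiftL_zero : shiftL n A B C 0 = realL n A B C := by
  simp [shiftL]

/-- The logarithm of `∏ x_k (1 - x_k) / δ_n`. -/
noncomputable def logWeight (x : Fin n → ℝ) : ℝ :=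
  ∑ k ∈ Finset.Icc 1 n, (Real.log (coord x k) + Real.log (1 - coord x k)) - Real.log (delta x n)

@[fun_prop]
theorem measurable_logWeight : Measurable (logWeight : (Fin n → ℝ) → ℝ) := by
  unfold logWeight
  fun_prop

/-- The denominator is compensated by the factor `1 - x_n`, since `δ_n = 1 - x_n δ_{n-1} ≥ 1 - x_n`.
This is why a positive translation preserves convergence. -/
theorem logWeight_nonpos (hn : 1 ≤ n) {x : Fin n → ℝ} (hx : ∀ i, x i ∈ Ioo (0 : ℝ) 1) :
    logWeight x ≤ 0 := by
  obtain ⟨n, rfl⟩ := Nat.exists_eq_add_of_le' hn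
  rw [logWeight, Finset.sum_Icc_succ_top (by omega)]
  have h0 : ∀ k, 1 ≤ k → k ≤ n + 1 → Real.log (coord x k) ≤ 0 := fun k h1 h2 =>
    Real.log_nonpos (coord_mem hx h1 h2).1.le (coord_mem hx h1 h2).2.le
  have h1 : ∀ k, 1 ≤ k → k ≤ n + 1 → Real.log (1 - coord x k) ≤ 0 := fun k h1 h2 =>
    Real.log_nonpos (by linarith [(coord_mem hx h1 h2).2]) (by linarith [(coord_mem hx h1 h2).1])
  have hs : ∑ k ∈ Finset.Icc 1 n, (Real.log (coord x k) + Real.log (1 - coord x k)) ≤ 0 :=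
    Finset.sum_nonpos fun k hk => by
      rw [Finset.mem_Icc] at hk
      linarith [h0 k hk.1 (by omega), h1 k hk.1 (by omega)]
  have hn1 := coord_mem hx (k := n + 1) (by omega) le_rfl
  have hlog : Real.log (1 - coord x (n + 1)) ≤ Real.log (delta x (n + 1)) := by
    refine Real.log_le_log (by linarith [hn1.2]) ?_
    rw [delta_succ]
    nlinarith [delta_le_one hx (k := n) (by omega), hn1.1]
  linarith [h0 (n + 1) (by omega) le_rfl]

theorem integrand_shift (hn : 2 ≤ n) {x : Fin n → ℝ} (hx : ∀ i, x i ∈ Ioo (0 : ℝ) 1) (t : ℝ) :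
    integrand (fun k => A k + t) (fun k => B k + t) (fun k => C k + if k = n then t else 0) x
      = integrand A B C x * Real.exp (t * logWeight x) := by
  rw [integrand_eq_exp hx, integrand_eq_exp hx, ← Real.exp_add, logWeight]
  congr 1
  simp only [mul_add, Finset.sum_add_distrib, mul_ite, mul_zero, Finset.sum_ite_eq',
    Finset.mem_Icc, hn, le_refl, and_self, if_true, ← Finset.sum_mul]
  ring

theorem shiftL_eq_lintegral (hn : 2 ≤ n) (t : ℝ) :
    shiftL n A B C t = ∫⁻ x, ENNReal.ofReal (Real.exp (t * logWeight x))
      ∂(cubeMeasure n).withDensity fun x => ENNReal.ofReal (integrand A B C x) := by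
  rw [lintegral_withDensity_eq_lintegral_mul _ (by fun_prop) (by fun_prop)]
  exact lintegral_cube_congr fun x hx => by
    rw [integrand_shift hn hx, ENNReal.ofReal_mul (integrand_pos hx).le]; rfl

theorem isFiniteMeasure_withDensity_integrand (h : realL n A B C ≠ ⊤) :
    IsFiniteMeasure
      ((cubeMeasure n).withDensity fun x => ENNReal.ofReal (integrand A B C x)) :=
  isFiniteMeasure_withDensity h

theorem ae_logWeight_nonpos (hn : 2 ≤ n) :
    ∀ᵐ x ∂(cubeMeasure n).withDensity fun x => ENNReal.ofReal (integrand A B C x),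
      logWeight x ≤ 0 :=
  (withDensity_absolutelyContinuous _ _).ae_le
    ((ae_mem_cube n).mono fun _ hx => logWeight_nonpos (by omega) hx)

theorem integrable_exp_logWeight (hn : 2 ≤ n) (h : realL n A B C ≠ ⊤) {t : ℝ} (ht : 0 ≤ t) :
    Integrable (fun x => Real.exp (t * logWeight x))
      ((cubeMeasure n).withDensity fun x => ENNReal.ofReal (integrand A B C x)) := by
  have := isFiniteMeasure_withDensity_integrand h
  refine (integrable_const (1 : ℝ)).mono' (by fun_prop) ?_
  filter_upwards [ae_logWeight_nonpos hn] with x hx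
  rw [Real.norm_eq_abs, abs_of_pos (Real.exp_pos _), Real.exp_le_one_iff]
  exact mul_nonpos_of_nonneg_of_nonpos ht hx

theorem toReal_shiftL (hn : 2 ≤ n) (t : ℝ) :
    (shiftL n A B C t).toReal = mgf logWeight
      ((cubeMeasure n).withDensity fun x => ENNReal.ofReal (integrand A B C x)) t := by
  rw [shiftL_eq_lintegral hn, mgf, integral_eq_lintegral_of_nonneg_ae
    (Eventually.of_forall fun _ => (Real.exp_pos _).le) (by fun_prop)]

/-- A moment generating function is analytic inside its domain of integrability, which contains
`[0,∞)` because the measure is finite and `logWeight` is nonpositive. -/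
theorem analyticOnNhd_shiftL (hn : 2 ≤ n) (h : realL n A B C ≠ ⊤) :
    AnalyticOnNhd ℝ (fun t => (shiftL n A B C t).toReal) (Ioi 0) := by
  simp only [toReal_shiftL hn]
  refine analyticOnNhd_mgf.mono (interior_maximal (fun t ht => ?_) isOpen_Ioi)
  exact integrable_exp_logWeight hn h (le_of_lt ht)

/-- The point `0` may be on the boundary of the domain of integrability, so analyticity is not
available there; dominated convergence with bound `1` replaces it. -/
theorem tendsto_shiftL_zero (hn : 2 ≤ n) (h : realL n A B C ≠ ⊤) :
    Tendsto (fun t => (shiftL n A B C t).toReal) (𝓝[>] 0) (𝓝 (realL n A B C).toReal) := by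
  have := isFiniteMeasure_withDensity_integrand h
  rw [← shiftL_zero]
  simp only [toReal_shiftL hn, mgf]
  refine tendsto_integral_filter_of_dominated_convergence (fun _ => (1 : ℝ))
    (Eventually.of_forall fun t => by fun_prop) ?_ (integrable_const _) ?_
  · filter_upwards [self_mem_nhdsWithin] with t ht
    filter_upwards [ae_logWeight_nonpos hn] with x hx
    rw [Real.norm_eq_abs, abs_of_pos (Real.exp_pos _), Real.exp_le_one_iff]
    exact mul_nonpos_of_nonneg_of_nonpos (le_of_lt ht) hx
  · refine Eventually.of_forall fun x => ?_
    have : Continuous fun t : ℝ => Real.exp (t * logWeight x) := by fun_prop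
    exact this.continuousAt.tendsto.mono_left nhdsWithin_le_nhds

theorem analyticAt_Gamma {s : ℝ} (hs : 0 < s) : AnalyticAt ℝ Real.Gamma s := by
  have h : AnalyticAt ℂ Complex.Gamma (s : ℂ) := by
    have hopen : IsOpen {z : ℂ | 0 < z.re} := isOpen_lt continuous_const Complex.continuous_re
    refine DifferentiableOn.analyticAt (s := {z : ℂ | 0 < z.re}) (fun z hz => ?_)
      (hopen.mem_nhds (by simpa using hs))
    refine (Complex.differentiableAt_Gamma z fun m hm => ?_).differentiableWithinAt
    have h1 : 0 < z.re := hz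
    rw [hm] at h1
    simp at h1
    linarith [(m.cast_nonneg : (0 : ℝ) ≤ m)]
  have h2 := h.re_ofReal
  refine h2.congr (Eventually.of_forall fun t => ?_)
  simp [Complex.Gamma_ofReal]

/-- `∏ Γ (m + t + 1)` over a list of integers `m`. -/
noncomputable def gammaProd (l : List ℤ) (t : ℝ) : ℝ :=
  (l.map fun m : ℤ => Real.Gamma ((m : ℝ) + t + 1)).prod

theorem gammaProd_pos {l : List ℤ} {t : ℝ} (hl : ∀ m ∈ l, -1 < (m : ℝ) + t) :
    0 < gammaProd l t := by
  refine List.prod_pos fun a ha => ?_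
  obtain ⟨m, hm, rfl⟩ := List.mem_map.1 ha
  exact Real.Gamma_pos_of_pos (by linarith [hl m hm])

theorem analyticAt_gammaProd {l : List ℤ} {t : ℝ} (hl : ∀ m ∈ l, -1 < (m : ℝ) + t) :
    AnalyticAt ℝ (gammaProd l) t := by
  induction l with
  | nil => exact analyticAt_const
  | cons m l ih =>
    have e : gammaProd (m :: l) = fun t => Real.Gamma (m + t + 1) * gammaProd l t := by
      funext t; simp [gammaProd]
    rw [e]
    refine AnalyticAt.mul ?_ (ih fun k hk => hl k (List.mem_cons_of_mem _ hk))
    refine AnalyticAt.fun_comp (f := fun t : ℝ => (m : ℝ) + t + 1) (analyticAt_Gamma ?_)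
      (by fun_prop)
    linarith [hl m List.mem_cons_self]

/-- Extension to `t = 0` of a proportionality which is known for large `t`. -/
theorem realL_mul_gammaProd_eq (hn : 2 ≤ n) {A' B' C' : ℕ → ℝ} {l l' : List ℤ}
    (h : realL n A B C ≠ ⊤) (h' : realL n A' B' C' ≠ ⊤) (hl : ∀ m ∈ l, 0 ≤ m)
    (hl' : ∀ m ∈ l', 0 ≤ m)
    (hev : ∀ᶠ t in atTop, (shiftL n A B C t).toReal * gammaProd l' t
      = (shiftL n A' B' C' t).toReal * gammaProd l t) :
    (realL n A B C).toReal * gammaProd l' 0 = (realL n A' B' C').toReal * gammaProd l 0 := by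
  have hpos : ∀ {l : List ℤ}, (∀ m ∈ l, 0 ≤ m) → ∀ t : ℝ, 0 ≤ t → ∀ m ∈ l, -1 < (m : ℝ) + t := by
    intro l hl t ht m hm
    have : (0 : ℝ) ≤ m := by exact_mod_cast hl m hm
    linarith
  have hf : AnalyticOnNhd ℝ (fun t => (shiftL n A B C t).toReal * gammaProd l' t) (Ioi 0) :=
    fun t ht => (analyticOnNhd_shiftL hn h t ht).mul
      (analyticAt_gammaProd (hpos hl' t (le_of_lt ht)))
  have hg : AnalyticOnNhd ℝ (fun t => (shiftL n A' B' C' t).toReal * gammaProd l t) (Ioi 0) :=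
    fun t ht => (analyticOnNhd_shiftL hn h' t ht).mul
      (analyticAt_gammaProd (hpos hl t (le_of_lt ht)))
  obtain ⟨T, hT⟩ := eventually_atTop.1 hev
  have hmem : (max T 0 + 1) ∈ Ioi (0 : ℝ) := by
    have := le_max_right T 0
    simp only [mem_Ioi]; linarith
  -- Identity theorem on `(0,∞)`, based at a point beyond both `T` and `0`.
  have heq := hf.eqOn_of_preconnected_of_eventuallyEq hg isPreconnected_Ioi hmem (by
    filter_upwards [Ioi_mem_nhds (show T < max T 0 + 1 by linarith [le_max_left T 0])] with t ht
    exact hT t (le_of_lt ht))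
  have hGc : ∀ {l : List ℤ}, (∀ m ∈ l, 0 ≤ m) →
      Tendsto (gammaProd l) (𝓝[>] 0) (𝓝 (gammaProd l 0)) := fun hl =>
    (analyticAt_gammaProd (hpos hl 0 le_rfl)).continuousAt.tendsto.mono_left nhdsWithin_le_nhds
  refine tendsto_nhds_unique ((tendsto_shiftL_zero hn h).mul (hGc hl')) ?_
  refine ((tendsto_shiftL_zero hn h').mul (hGc hl)).congr' ?_
  filter_upwards [self_mem_nhdsWithin] with t ht
  exact (heq ht).symm

end Shift

end RhinViola

/-! ### From the three generators to the whole group -/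

namespace RhinViola

open Set ProbabilityTheory Filter Topology

theorem realL_congr {n : ℕ} {A B C A' B' C' : ℕ → ℝ} (hA : ∀ k, 1 ≤ k → k ≤ n → A k = A' k)
    (hB : ∀ k, 1 ≤ k → k ≤ n → B k = B' k) (hC : ∀ k, 2 ≤ k → k ≤ n → C k = C' k) :
    realL n A B C = realL n A' B' C' := by
  unfold realL integrand
  congr 1
  funext x
  congr 3
  · refine Finset.prod_congr rfl fun k hk => ?_
    rw [Finset.mem_Icc] at hk
    rw [hA k hk.1 hk.2, hB k hk.1 hk.2]
  · refine Finset.prod_congr rfl fun k hk => ?_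
    rw [Finset.mem_Icc] at hk
    rw [hC k hk.1 hk.2]

/-- `L` at the parameter `p` translated by `t` in the direction of `a = b = 1`, `c_n = 1`. -/
noncomputable def paramShiftL {n : ℕ} (p : Param n) (t : ℝ) : ℝ≥0∞ :=
  shiftL n (fun k => p.a k) (fun k => p.b k) (fun k => p.c k) t

theorem paramShiftL_zero {n : ℕ} (p : Param n) : paramShiftL p 0 = L p := by
  rw [paramShiftL, shiftL_zero, L_eq_realL]

theorem paramShiftL_sigmaMap {n : ℕ} (hn : 2 ≤ n) (p : Param n) (t : ℝ) :
    paramShiftL (sigmaMap n p) t = paramShiftL p t := by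
  unfold paramShiftL shiftL
  symm
  rw [← realL_sigma hn (fun _ => rfl) (fun _ => rfl)]
  symm
  refine realL_congr (fun k h1 h2 => ?_) (fun k h1 h2 => ?_) (fun k h1 h2 => ?_) <;>
    simp only [sigmaMap_apply, Param.a_of, Param.b_of, Param.c_of] <;>
    split_ifs <;> first | rfl | omega

theorem paramShiftL_psiMap {n : ℕ} (hn : 2 ≤ n) (p : Param n) (t : ℝ) :
    paramShiftL (psiMap n p) t = paramShiftL p t := by
  obtain ⟨m, rfl⟩ := Nat.exists_eq_add_of_le' hn
  unfold paramShiftL shiftL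
  symm
  rw [← realL_psi (m := m) (fun _ => rfl) (fun _ => rfl) (fun _ => rfl)]
  symm
  refine realL_congr (fun k h1 h2 => ?_) (fun k h1 h2 => ?_) (fun k h1 h2 => ?_)
  · simp only [psiMap_apply, Param.a_of]
    rw [if_pos ⟨h1, h2⟩]
  · simp only [psiMap_apply, Param.b_of]
    rw [if_pos ⟨h1, h2⟩]
    split_ifs
    · push_cast; ring
    · rfl
  · simp only [psiMap_apply, Param.c_of]
    rw [if_pos ⟨h1, h2⟩]
    split_ifs
    · push_cast; ring
    -- Here `c_{n+1-k}` would be the translated coordinate `c_n`, which `k ≥ 2` rules out.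
    · omega
    · push_cast
      rw [show m + 2 + 2 - k = m + 4 - k by omega, show m + 2 + 1 - k = m + 3 - k by omega]; ring

/-- The translation commutes with `φ`, since `φ` fixes its direction. The two Beta values in
`realL_phi` have the same denominator because `c + (a + b - c) = a + b`; cancelling it leaves Gamma
values only. -/
theorem paramShiftL_phiMap {n : ℕ} (hn : 2 ≤ n) {p : Param n} (hp : p ∈ E n) {t : ℝ}
    (ha : -1 < p.a (n - 1) + t) (hb : -1 < p.b (n - 1) + t) (hc : -1 < p.c n + t)
    (hd : -1 < (p.a (n - 1) + p.b (n - 1) - p.c n : ℤ) + t) :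
    ENNReal.ofReal (Real.Gamma (p.c n + t + 1)
        * Real.Gamma ((p.a (n - 1) + p.b (n - 1) - p.c n : ℤ) + t + 1)) * paramShiftL p t
      = ENNReal.ofReal (Real.Gamma (p.a (n - 1) + t + 1) * Real.Gamma (p.b (n - 1) + t + 1))
        * paramShiftL (phiMap n p) t := by
  obtain ⟨m, rfl⟩ := Nat.exists_eq_add_of_le' hn
  have e1 : m + 2 - 1 = m + 1 := by omega
  simp only [e1] at ha hb hd ⊢
  have h := realL_phi (m := m) (A := fun k => p.a k + t) (B := fun k => p.b k + t)
    (C := fun k => p.c k + if k = m + 2 then t else 0)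
    (fun h1 => by
      rw [if_neg (by omega), hp.1 (m + 1) (by omega) (by omega)]; simp) ha hb
    (by simpa using hc) (by simp only [if_true]; push_cast at hd; linarith)
    (fun _ => rfl) (fun _ => rfl) (fun _ => rfl)
  have hshift : paramShiftL (phiMap (m + 2) p) t = _ := realL_congr
    (A' := fun k => if k = m + 1 then (p.c (m + 2) + if m + 2 = m + 2 then t else 0 : ℝ)
      else p.a k + t)
    (B' := fun k => if k = m + 1 then (p.a (m + 1) + t) + (p.b (m + 1) + t)
        - (p.c (m + 2) + if m + 2 = m + 2 then t else 0 : ℝ)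
      else if k = m + 2 then (p.a (m + 1) + t) + (p.b (m + 2) + t)
        - (p.c (m + 2) + if m + 2 = m + 2 then t else 0 : ℝ) else p.b k + t)
    (C' := fun k => if k = m + 2 then p.a (m + 1) + t else
      (p.c k + if k = m + 2 then t else 0 : ℝ))
    (fun k h1 h2 => by
      simp only [phiMap_apply, Param.a_of]
      rw [if_pos ⟨h1, h2⟩, e1]
      split_ifs <;> simp) (fun k h1 h2 => by
      simp only [phiMap_apply, Param.b_of]
      rw [if_pos ⟨h1, h2⟩, e1]
      split_ifs
      · push_cast; ring
      · push_cast; ring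
      · rfl) (fun k h1 h2 => by
      simp only [phiMap_apply, Param.c_of]
      rw [if_pos ⟨h1, h2⟩, e1]
      split_ifs <;> simp)
  rw [← hshift] at h
  simp only [if_true] at h
  have e2 : (p.a (m + 1) : ℝ) + t + (p.b (m + 1) + t) - (p.c (m + 2) + t) + 1
      = (p.a (m + 1) + p.b (m + 1) - p.c (m + 2) : ℤ) + t + 1 := by push_cast; ring
  have hG := Real.Gamma_pos_of_pos
    (show 0 < (p.a (m + 1) : ℝ) + t + 1 + (p.b (m + 1) + t + 1) by linarith)
  have e3 : (p.c (m + 2) : ℝ) + t + 1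
      + ((p.a (m + 1) + p.b (m + 1) - p.c (m + 2) : ℤ) + t + 1)
      = p.a (m + 1) + t + 1 + (p.b (m + 1) + t + 1) := by push_cast; ring
  rw [e2] at h
  unfold beta at h
  rw [e3, div_eq_inv_mul, div_eq_inv_mul, ENNReal.ofReal_mul (inv_pos.2 hG).le,
    ENNReal.ofReal_mul (inv_pos.2 hG).le, mul_assoc, mul_assoc] at h
  exact (ENNReal.mul_right_inj (by simpa using hG) ENNReal.ofReal_ne_top).1 h

theorem Gamma_intCast_add_one {m : ℤ} (hm : 0 ≤ m) :
    Real.Gamma ((m : ℝ) + 0 + 1) = (m.toNat.factorial : ℝ) := by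
  obtain ⟨k, rfl⟩ := Int.eq_ofNat_of_zero_le hm
  rw [add_zero]
  simpa using Real.Gamma_nat_eq_factorial k

theorem ofReal_Gamma_intCast {m : ℤ} (hm : 0 ≤ m) :
    ENNReal.ofReal (Real.Gamma ((m : ℝ) + 0 + 1)) = fact m := by
  rw [Gamma_intCast_add_one hm, fact, ENNReal.ofReal_natCast]

theorem fact_ne_zero (m : ℤ) : fact m ≠ 0 := by
  simp [fact, Nat.factorial_ne_zero]

theorem fact_ne_top (m : ℤ) : fact m ≠ ⊤ := ENNReal.natCast_ne_top _

theorem L_phiMap {n : ℕ} (hn : 2 ≤ n) {p : Param n} (hp : p ∈ E n)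
    (ha : 0 ≤ p.a (n - 1)) (hb : 0 ≤ p.b (n - 1)) (hc : 0 ≤ p.c n)
    (hd : 0 ≤ p.a (n - 1) + p.b (n - 1) - p.c n) :
    L p = fact (p.a (n - 1)) * fact (p.b (n - 1)) /
        (fact (p.c n) * fact (p.a (n - 1) + p.b (n - 1) - p.c n)) * L (phiMap n p) := by
  have hcast : ∀ {m : ℤ}, 0 ≤ m → -1 < (m : ℝ) + 0 := fun {m} hm => by
    have : (0 : ℝ) ≤ m := by exact_mod_cast hm
    linarith
  have hG : ∀ {m : ℤ}, 0 ≤ m → 0 ≤ Real.Gamma ((m : ℝ) + 0 + 1) := fun {m} hm => by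
    rw [Gamma_intCast_add_one hm]; positivity
  have h := paramShiftL_phiMap hn hp (hcast ha) (hcast hb) (hcast hc) (hcast hd)
  rw [ENNReal.ofReal_mul (hG hc), ENNReal.ofReal_mul (hG ha), ofReal_Gamma_intCast ha,
    ofReal_Gamma_intCast hb, ofReal_Gamma_intCast hc, ofReal_Gamma_intCast hd,
    paramShiftL_zero, paramShiftL_zero] at h
  rw [ENNReal.mul_comm_div, ← mul_div_assoc, ← h, mul_comm, mul_div_assoc, ENNReal.div_self,
    mul_one]
  · exact mul_ne_zero (fact_ne_zero _) (fact_ne_zero _)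
  · exact ENNReal.mul_ne_top (fact_ne_top _) (fact_ne_top _)

theorem Param.a_nonneg {n : ℕ} (hn : 2 ≤ n) {p : Param n} (h : L p ≠ ⊤) (k : ℕ) :
    0 ≤ p.a k := by
  by_cases hk : 1 ≤ k ∧ k ≤ n
  · rw [L_eq_realL] at h
    have := neg_one_lt_left_of_realL_ne_top hn h hk.1 hk.2
    have h2 : -1 < p.a k := by exact_mod_cast this
    omega
  · rw [Param.a, dif_neg hk]

theorem Param.b_nonneg {n : ℕ} (hn : 2 ≤ n) {p : Param n} (h : L p ≠ ⊤) (k : ℕ) :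
    0 ≤ p.b k := by
  by_cases hk : 1 ≤ k ∧ k ≤ n
  · rw [L_eq_realL] at h
    have := neg_one_lt_right_of_realL_ne_top hn h hk.1 hk.2
    have h2 : -1 < p.b k := by exact_mod_cast this
    omega
  · rw [Param.b, dif_neg hk]

theorem gammaProd_eq {l l' : List ℤ} (h : ∀ f : ℤ → ℝ, (l.map f).prod = (l'.map f).prod) (t : ℝ) :
    gammaProd l t = gammaProd l' t := h _

theorem eventually_gammaProd_pos (l : List ℤ) : ∀ᶠ t in atTop, 0 < gammaProd l t := by
  have : ∀ᶠ t : ℝ in atTop, ∀ m ∈ l, -1 < (m : ℝ) + t := by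
    induction l with
    | nil => simp
    | cons m l ih =>
      filter_upwards [ih, eventually_gt_atTop (-1 - (m : ℝ))] with t h1 h2
      intro k hk
      rcases List.mem_cons.1 hk with rfl | hk
      · linarith
      · exact h1 k hk
  exact this.mono fun t ht => gammaProd_pos ht

/-- `∏ m!` over a list of nonnegative integers `m`. -/
def factorialProd (l : List ℤ) : ℕ := (l.map fun m => m.toNat.factorial).prod

theorem factorialProd_pos (l : List ℤ) : 0 < factorialProd l :=
  List.prod_pos fun a ha => by
    obtain ⟨m, _, rfl⟩ := List.mem_map.1 ha
    exact Nat.factorial_pos _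

theorem gammaProd_zero {l : List ℤ} (hl : ∀ m ∈ l, 0 ≤ m) :
    gammaProd l 0 = factorialProd l := by
  rw [gammaProd, factorialProd]
  push_cast
  rw [List.map_map]
  congr 1
  refine List.map_congr_left fun m hm => ?_
  exact Gamma_intCast_add_one (hl m hm)

theorem prod_map_fact (l : List ℤ) : (l.map fact).prod = factorialProd l := by
  rw [factorialProd]
  push_cast
  rw [List.map_map]
  rfl

/-- The proportionality of `L(g p)` and `L(p)` after a large translation. -/
theorem eventually_paramShiftL_mul {n : ℕ} (hn : 2 ≤ n) {args : E n → List ℤ}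
    (hσ : ∀ p, ∀ f : ℤ → ℝ, ((args (sigma hn p)).map f).prod = ((args p).map f).prod)
    (hψ : ∀ p, ∀ f : ℤ → ℝ, ((args (psi hn p)).map f).prod = ((args p).map f).prod)
    (hφ : ∀ p : E n, ∀ f : ℤ → ℝ, ((args (phi hn p)).map f).prod
        * (f (p.1.a (n - 1)) * f (p.1.b (n - 1)))
      = ((args p).map f).prod * (f (p.1.c n) * f (p.1.a (n - 1) + p.1.b (n - 1) - p.1.c n)))
    {g : E n ≃ₗ[ℤ] E n} (hg : g ∈ G hn) (p : E n) :
    ∀ᶠ t in atTop, (paramShiftL (p : Param n) t).toReal * gammaProd (args (g p)) t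
      = (paramShiftL (g p : Param n) t).toReal * gammaProd (args p) t := by
  induction hg using Subgroup.closure_induction generalizing p with
  | mem g hg =>
    rcases hg with rfl | rfl | rfl
    · refine Eventually.of_forall fun t => ?_
      rw [coe_sigma, paramShiftL_sigmaMap hn, gammaProd_eq (hσ p)]
    · refine Eventually.of_forall fun t => ?_
      rw [coe_psi, paramShiftL_psiMap hn, gammaProd_eq (hψ p)]
    · filter_upwards [eventually_gt_atTop (-1 - (p.1.a (n - 1) : ℝ)),
        eventually_gt_atTop (-1 - (p.1.b (n - 1) : ℝ)), eventually_gt_atTop (-1 - (p.1.c n : ℝ)),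
        eventually_gt_atTop (-1 - ((p.1.a (n - 1) + p.1.b (n - 1) - p.1.c n : ℤ) : ℝ))]
        with t ha hb hc hd
      -- The identity holds in `[0,∞]`, so passing to real numbers needs no finiteness: if one side
      -- is infinite, both become `0`.
      have h := congrArg ENNReal.toReal (paramShiftL_phiMap hn p.2 (t := t) (by linarith)
        (by linarith) (by linarith) (by linarith))
      have e := hφ p fun m : ℤ => Real.Gamma ((m : ℝ) + t + 1)
      have h1 := Real.Gamma_pos_of_pos (show 0 < (p.1.a (n - 1) : ℝ) + t + 1 by linarith)
      have h2 := Real.Gamma_pos_of_pos (show 0 < (p.1.b (n - 1) : ℝ) + t + 1 by linarith)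
      have h3 := Real.Gamma_pos_of_pos (show 0 < (p.1.c n : ℝ) + t + 1 by linarith)
      have h4 := Real.Gamma_pos_of_pos (show 0 <
        ((p.1.a (n - 1) + p.1.b (n - 1) - p.1.c n : ℤ) : ℝ) + t + 1 by linarith)
      rw [ENNReal.toReal_mul, ENNReal.toReal_mul, ENNReal.toReal_ofReal (by positivity),
        ENNReal.toReal_ofReal (by positivity)] at h
      rw [coe_phi]
      unfold gammaProd
      refine mul_right_cancel₀ (mul_pos h1 h2).ne' ?_
      rw [mul_assoc, e]
      linear_combination ((args p).map fun m : ℤ => Real.Gamma ((m : ℝ) + t + 1)).prod * h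
  | one => exact Eventually.of_forall fun t => rfl
  | mul g h _ _ ihg ihh =>
    -- The Gamma product at the intermediate point `h p` is positive for large `t`, hence can be
    -- cancelled.
    filter_upwards [ihg (h p), ihh p, eventually_gammaProd_pos (args (h p))] with t h1 h2 h3
    rw [LinearEquiv.mul_apply]
    refine mul_right_cancel₀ h3.ne' ?_
    linear_combination gammaProd (args (g (h p))) t * h2 + gammaProd (args p) t * h1
  | inv g _ ih =>
    filter_upwards [ih (g⁻¹ p)] with t ht
    rw [← LinearEquiv.mul_apply, mul_inv_cancel] at ht
    exact ht.symm

/-- Finiteness is needed at the two ends `p` and `g p` only: the points visited by a word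
representing `g` matter solely for large `t`. -/
theorem L_mul_factorials {n : ℕ} (hn : 2 ≤ n) {args : E n → List ℤ}
    (hσ : ∀ p, ∀ f : ℤ → ℝ, ((args (sigma hn p)).map f).prod = ((args p).map f).prod)
    (hψ : ∀ p, ∀ f : ℤ → ℝ, ((args (psi hn p)).map f).prod = ((args p).map f).prod)
    (hφ : ∀ p : E n, ∀ f : ℤ → ℝ, ((args (phi hn p)).map f).prod
        * (f (p.1.a (n - 1)) * f (p.1.b (n - 1)))
      = ((args p).map f).prod * (f (p.1.c n) * f (p.1.a (n - 1) + p.1.b (n - 1) - p.1.c n)))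
    (hargs : ∀ p : E n, L (p : Param n) ≠ ⊤ → ∀ m ∈ args p, 0 ≤ m)
    {g : E n ≃ₗ[ℤ] E n} (hg : g ∈ G hn) {p : E n} (h : L (p : Param n) ≠ ⊤)
    (h' : L (g p : Param n) ≠ ⊤) :
    L (p : Param n) * ((args (g p)).map fact).prod
      = L (g p : Param n) * ((args p).map fact).prod := by
  have key := realL_mul_gammaProd_eq hn (by rwa [← L_eq_realL]) (by rwa [← L_eq_realL])
    (hargs p h) (hargs (g p) h') (eventually_paramShiftL_mul hn hσ hψ hφ hg p)
  rw [← L_eq_realL, ← L_eq_realL, gammaProd_zero (hargs p h), gammaProd_zero (hargs _ h')] at key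
  rw [← ENNReal.toReal_eq_toReal_iff' (by
      rw [prod_map_fact]; exact ENNReal.mul_ne_top h (ENNReal.natCast_ne_top _)) (by
      rw [prod_map_fact]; exact ENNReal.mul_ne_top h' (ENNReal.natCast_ne_top _)),
    prod_map_fact, prod_map_fact, ENNReal.toReal_mul, ENNReal.toReal_mul]
  simpa using key

/-- `G` is a Rhin–Viola group and leaves a quotient invariant, as soon as the list of factorials
is compatible with the three generators. -/
theorem rhinViola_of_args {n : ℕ} (hn : 2 ≤ n) {args : E n → List ℤ}
    (hσ : ∀ p, ∀ f : ℤ → ℝ, ((args (sigma hn p)).map f).prod = ((args p).map f).prod)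
    (hψ : ∀ p, ∀ f : ℤ → ℝ, ((args (psi hn p)).map f).prod = ((args p).map f).prod)
    (hφ : ∀ p : E n, ∀ f : ℤ → ℝ, ((args (phi hn p)).map f).prod
        * (f (p.1.a (n - 1)) * f (p.1.b (n - 1)))
      = ((args p).map f).prod * (f (p.1.c n) * f (p.1.a (n - 1) + p.1.b (n - 1) - p.1.c n)))
    (hargs : ∀ p : E n, L (p : Param n) ≠ ⊤ → ∀ m ∈ args p, 0 ≤ m) :
    IsRhinViolaGroup (fun p : E n => L (p : Param n)) (G hn) ∧
      LeavesStable (fun p : E n => L (p : Param n)) (G hn) args := by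
  have hpos : ∀ p : Param n, 0 < L p := fun p => by rw [L_eq_realL]; exact realL_pos
  refine ⟨⟨fun p => hpos p, fun g hg p hiff => ?_⟩, ⟨hargs, fun g hg p h h' => ?_⟩⟩
  · by_cases h : L (p : Param n) = ⊤
    · refine ⟨1, one_pos, ?_⟩
      rw [quot, if_pos ⟨hiff.2 h, h⟩]
      simp
    · have h' : L (g p : Param n) ≠ ⊤ := fun hh => h (hiff.1 hh)
      have key := L_mul_factorials hn hσ hψ hφ hargs hg h h'
      rw [prod_map_fact, prod_map_fact] at key
      have e1 := factorialProd_pos (args (g p))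
      have e2 := factorialProd_pos (args p)
      -- Invariance of the quotient identifies the ratio of the integrals with the ratio of the
      -- factorial products.
      refine ⟨factorialProd (args (g p)) / factorialProd (args p), by positivity, ?_⟩
      rw [quot, if_neg (fun hh => h hh.2)]
      push_cast
      rw [ENNReal.ofReal_div_of_pos (by exact_mod_cast e2), ENNReal.ofReal_natCast,
        ENNReal.ofReal_natCast, ENNReal.div_eq_div_iff (by exact_mod_cast e2.ne')
          (ENNReal.natCast_ne_top _) (hpos _).ne' h]
      rw [mul_comm, ← key, mul_comm]
  · have key := L_mul_factorials hn hσ hψ hφ hargs hg h h'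
    rw [prod_map_fact, prod_map_fact] at key ⊢
    have e1 := factorialProd_pos (args (g p))
    have e2 := factorialProd_pos (args p)
    rw [ENNReal.div_eq_div_iff (by exact_mod_cast e2.ne') (ENNReal.natCast_ne_top _)
      (by exact_mod_cast e1.ne') (ENNReal.natCast_ne_top _)]
    rw [mul_comm, ← key, mul_comm]

end RhinViola

/-! ### The factorial lists -/

namespace RhinViola

theorem L_sigma {n : ℕ} (hn : 2 ≤ n) (p : E n) : L (sigma hn p : Param n) = L (p : Param n) := by
  rw [coe_sigma, ← paramShiftL_zero, paramShiftL_sigmaMap hn, paramShiftL_zero]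

theorem L_psi {n : ℕ} (hn : 2 ≤ n) (p : E n) : L (psi hn p : Param n) = L (p : Param n) := by
  rw [coe_psi, ← paramShiftL_zero, paramShiftL_psiMap hn, paramShiftL_zero]

/-- This integer is the coordinate `b_1` of `ψ p`, whose integral is also finite. -/
theorem Param.a_add_b_sub_c_nonneg {n : ℕ} (hn : 2 ≤ n) {p : E n} (h : L (p : Param n) ≠ ⊤) :
    0 ≤ p.1.a (n - 1) + p.1.b n - p.1.c n := by
  have h1 := Param.b_nonneg hn (p := (psi hn p : Param n)) (by rwa [L_psi]) 1
  rwa [coe_psi, psiMap_apply, Param.b_of, if_pos ⟨le_rfl, by omega⟩, if_pos rfl] at h1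

/-- The arguments of the factorials for `n = 2`. -/
def argsTwo (p : E 2) : List ℤ :=
  [p.1.a 1, p.1.a 2, p.1.b 1, p.1.b 2, p.1.a 1 + p.1.b 2 - p.1.c 2]

/-- The arguments of the factorials for `n = 3`. -/
def argsThree (p : E 3) : List ℤ :=
  [p.1.a 1, p.1.a 2, p.1.a 3, p.1.b 1, p.1.b 2, p.1.b 3,
    p.1.a 2 + p.1.b 3 - p.1.c 3, p.1.b 1 + p.1.b 3 - p.1.c 3]

/-- The arguments of the factorials for `n = 4`. -/
def argsFour (p : E 4) : List ℤ := [p.1.a 3, p.1.b 3, p.1.a 2]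

/-- The arguments of the factorials for `n ≥ 5`. -/
def argsGeneral {n : ℕ} (p : E n) : List ℤ := [p.1.a (n - 1), p.1.b (n - 1), p.1.a 2, p.1.b 3]

theorem rhinViola_two (hn : 2 ≤ 2) : IsRhinViolaGroup (fun p : E 2 => L (p : Param 2)) (G hn) ∧
    LeavesStable (fun p : E 2 => L (p : Param 2)) (G hn) argsTwo := by
  refine rhinViola_of_args hn (fun p f => ?_) (fun p f => ?_) (fun p f => ?_) (fun p h => ?_)
  · simp only [argsTwo, coe_sigma, sigmaMap_apply, Param.a_of, Param.b_of, Param.c_of,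
      List.map_cons, List.map_nil, List.prod_cons, List.prod_nil]
    norm_num
    rw [show p.1.b 2 + p.1.a 1 - p.1.c 2 = p.1.a 1 + p.1.b 2 - p.1.c 2 by ring]
    ring
  · simp only [argsTwo, coe_psi, psiMap_apply, Param.a_of, Param.b_of, Param.c_of,
      List.map_cons, List.map_nil, List.prod_cons, List.prod_nil]
    norm_num
    ring
  · simp only [argsTwo, coe_phi, phiMap_apply, Param.a_of, Param.b_of, Param.c_of,
      List.map_cons, List.map_nil, List.prod_cons, List.prod_nil]
    norm_num
    ring
  · have h1 := Param.a_nonneg hn h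
    have h2 := Param.b_nonneg hn h
    have h3 := Param.a_add_b_sub_c_nonneg hn h
    simp only [argsTwo, List.forall_mem_cons]
    exact ⟨h1 1, h1 2, h2 1, h2 2, h3, by simp⟩

theorem rhinViola_three (hn : 2 ≤ 3) : IsRhinViolaGroup (fun p : E 3 => L (p : Param 3)) (G hn) ∧
    LeavesStable (fun p : E 3 => L (p : Param 3)) (G hn) argsThree := by
  refine rhinViola_of_args hn (fun p f => ?_) (fun p f => ?_) (fun p f => ?_) (fun p h => ?_)
  · simp only [argsThree, coe_sigma, sigmaMap_apply, Param.a_of, Param.b_of, Param.c_of,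
      List.map_cons, List.map_nil, List.prod_cons, List.prod_nil]
    norm_num
    ring
  · simp only [argsThree, coe_psi, psiMap_apply, Param.a_of, Param.b_of, Param.c_of,
      List.map_cons, List.map_nil, List.prod_cons, List.prod_nil]
    norm_num
    rw [show p.1.a 2 + p.1.b 3 - p.1.c 3 + p.1.b 2 - (p.1.a 2 + p.1.b 2 - p.1.b 1)
        = p.1.b 1 + p.1.b 3 - p.1.c 3 by ring]
    ring
  · simp only [argsThree, coe_phi, phiMap_apply, Param.a_of, Param.b_of, Param.c_of,
      List.map_cons, List.map_nil, List.prod_cons, List.prod_nil]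
    norm_num
    rw [show p.1.b 1 + (p.1.a 2 + p.1.b 3 - p.1.c 3) - p.1.a 2
        = p.1.b 1 + p.1.b 3 - p.1.c 3 by ring]
    ring
  · have h1 := Param.a_nonneg hn h
    have h2 := Param.b_nonneg hn h
    have h3 := Param.a_add_b_sub_c_nonneg hn h
    -- Since `σ` turns `a_2` into `b_1`, the last argument of the list is the previous one evaluated
    -- at `σ p`.
    have h4 := Param.a_add_b_sub_c_nonneg hn (p := sigma hn p) (by rwa [L_sigma])
    simp only [coe_sigma, sigmaMap_apply, Param.a_of, Param.b_of, Param.c_of] at h4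
    norm_num at h3 h4
    simp only [argsThree, List.forall_mem_cons]
    exact ⟨h1 1, h1 2, h1 3, h2 1, h2 2, h2 3, by omega, by omega, by simp⟩

/-- For `n = 4`, `b_{n-1}` and `b_3` coincide and `ψ` fixes this coordinate, so it is listed once.
For `n ≥ 5`, `ψ` exchanges two distinct coordinates. -/
theorem rhinViola_four (hn : 2 ≤ 4) : IsRhinViolaGroup (fun p : E 4 => L (p : Param 4)) (G hn) ∧
    LeavesStable (fun p : E 4 => L (p : Param 4)) (G hn) argsFour := by
  refine rhinViola_of_args hn (fun p f => ?_) (fun p f => ?_) (fun p f => ?_) (fun p h => ?_)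
  · have h2 := (p.2.2.2 le_rfl).1
    simp only [argsFour, coe_sigma, sigmaMap_apply, Param.a_of, Param.b_of,
      List.map_cons, List.map_nil, List.prod_cons, List.prod_nil]
    norm_num [h2]
  · simp only [argsFour, coe_psi, psiMap_apply, Param.a_of, Param.b_of,
      List.map_cons, List.map_nil, List.prod_cons, List.prod_nil]
    norm_num
    ring
  · simp only [argsFour, coe_phi, phiMap_apply, Param.a_of, Param.b_of,
      List.map_cons, List.map_nil, List.prod_cons, List.prod_nil]
    norm_num
    ring
  · have h1 := Param.a_nonneg hn h
    have h2 := Param.b_nonneg hn h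
    simp only [argsFour, List.forall_mem_cons]
    exact ⟨h1 3, h2 3, h1 2, by simp⟩

theorem rhinViola_general {n : ℕ} (hn : 2 ≤ n) (h5 : 5 ≤ n) :
    IsRhinViolaGroup (fun p : E n => L (p : Param n)) (G hn) ∧
    LeavesStable (fun p : E n => L (p : Param n)) (G hn) argsGeneral := by
  refine rhinViola_of_args hn (fun p f => ?_) (fun p f => ?_) (fun p f => ?_) (fun p h => ?_)
  · have h2 := (p.2.2.2 (by omega)).1
    have e1 : (sigma hn p).1.a (n - 1) = p.1.a (n - 1) := by
      rw [coe_sigma, sigmaMap_apply, Param.a_of]; grind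
    have e2 : (sigma hn p).1.b (n - 1) = p.1.b (n - 1) := by
      rw [coe_sigma, sigmaMap_apply, Param.b_of]; grind
    have e3 : (sigma hn p).1.a 2 = p.1.a 2 := by
      rw [coe_sigma, sigmaMap_apply, Param.a_of]; grind
    have e4 : (sigma hn p).1.b 3 = p.1.b 3 := by
      rw [coe_sigma, sigmaMap_apply, Param.b_of]; grind
    rw [argsGeneral, e1, e2, e3, e4, argsGeneral]
  · have e1 : (psi hn p).1.a (n - 1) = p.1.a 2 := by
      rw [coe_psi, psiMap_apply, Param.a_of, if_pos (by omega), show n + 1 - (n - 1) = 2 by omega]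
    have e2 : (psi hn p).1.b (n - 1) = p.1.b 3 := by
      rw [coe_psi, psiMap_apply, Param.b_of, if_pos (by omega), if_neg (by omega),
        show n + 2 - (n - 1) = 3 by omega]
    have e3 : (psi hn p).1.a 2 = p.1.a (n - 1) := by
      rw [coe_psi, psiMap_apply, Param.a_of, if_pos (by omega), show n + 1 - 2 = n - 1 by omega]
    have e4 : (psi hn p).1.b 3 = p.1.b (n - 1) := by
      rw [coe_psi, psiMap_apply, Param.b_of, if_pos (by omega), if_neg (by omega),
        show n + 2 - 3 = n - 1 by omega]
    rw [argsGeneral, e1, e2, e3, e4, argsGeneral]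
    simp only [List.map_cons, List.map_nil, List.prod_cons, List.prod_nil]
    ring
  · have e1 : (phi hn p).1.a (n - 1) = p.1.c n := by
      rw [coe_phi, phiMap_apply, Param.a_of, if_pos (by omega), if_pos rfl]
    have e2 : (phi hn p).1.b (n - 1) = p.1.a (n - 1) + p.1.b (n - 1) - p.1.c n := by
      rw [coe_phi, phiMap_apply, Param.b_of, if_pos (by omega), if_pos rfl]
    have e3 : (phi hn p).1.a 2 = p.1.a 2 := by
      rw [coe_phi, phiMap_apply, Param.a_of, if_pos (by omega), if_neg (by omega)]
    have e4 : (phi hn p).1.b 3 = p.1.b 3 := by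
      rw [coe_phi, phiMap_apply, Param.b_of, if_pos (by omega), if_neg (by omega),
        if_neg (by omega)]
    rw [argsGeneral, e1, e2, e3, e4, argsGeneral]
    simp only [List.map_cons, List.map_nil, List.prod_cons, List.prod_nil]
    ring
  · have h1 := Param.a_nonneg hn h
    have h2 := Param.b_nonneg hn h
    simp only [argsGeneral, List.forall_mem_cons]
    exact ⟨h1 _, h2 _, h1 2, h2 3, by simp⟩

end RhinViola

/-! ### Identifying `G` through linear forms: general principle -/

namespace RhinViola

open Equiv

/-- A group generated by automorphisms of a module is isomorphic to a group of transformations of a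
set in which the module embeds equivariantly. -/
theorem nonempty_closure_mulEquiv {M Γ V : Type*} [AddCommGroup M] [Group Γ]
    (act : Γ →* Function.End V) (T : M → V) (hT : Function.Injective T)
    (hfaith : ∀ γ, (∀ p, act γ (T p) = T p) → γ = 1) (s : Set ((M ≃ₗ[ℤ] M) × Γ))
    (hs : ∀ x ∈ s, ∀ p, T (x.1 p) = act x.2 (T p))
    (htop : Subgroup.closure (Prod.snd '' s) = ⊤) :
    Nonempty (Subgroup.closure (Prod.fst '' s) ≃* Γ) := by
  -- `R` is the graph of the desired isomorphism. Both projections are injective on it: one because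
  -- `act` is faithful on the image of `T`, the other because `T` is injective.
  set R := Subgroup.closure s with hR
  have hinv : ∀ x ∈ R, ∀ p, T (x.1 p) = act x.2 (T p) := by
    intro x hx
    induction hx using Subgroup.closure_induction with
    | mem x hx => exact hs x hx
    | one => intro p; rw [Prod.snd_one, map_one]; rfl
    | mul x y _ _ hx hy =>
      intro p
      rw [Prod.fst_mul, LinearEquiv.mul_apply, hx, hy, Prod.snd_mul, map_mul]; rfl
    | inv x _ hx =>
      intro p
      have h := hx (x.1⁻¹ p)
      rw [← LinearEquiv.mul_apply, mul_inv_cancel] at h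
      have h2 : act x.2⁻¹ (act x.2 (T (x.1⁻¹ p))) = T (x.1⁻¹ p) := by
        have : (act x.2⁻¹ * act x.2) (T (x.1⁻¹ p)) = T (x.1⁻¹ p) := by
          rw [← map_mul, inv_mul_cancel, map_one]; rfl
        exact this
      rw [← h] at h2
      exact h2.symm
  have e1 : R.map (MonoidHom.fst (M ≃ₗ[ℤ] M) Γ) = Subgroup.closure (Prod.fst '' s) :=
    MonoidHom.map_closure _ _
  have e2 : R.map (MonoidHom.snd (M ≃ₗ[ℤ] M) Γ) = ⊤ := (MonoidHom.map_closure _ _).trans htop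
  have b1 : Function.Bijective ((MonoidHom.fst (M ≃ₗ[ℤ] M) Γ).subgroupMap R) := by
    refine ⟨(injective_iff_map_eq_one _).2 fun x hx => ?_, MonoidHom.subgroupMap_surjective _ _⟩
    have hx1 : x.1.1 = 1 := congrArg Subtype.val hx
    refine Subtype.ext (Prod.ext hx1 (hfaith _ fun p => ?_))
    rw [← hinv x.1 x.2 p, hx1]; rfl
  have b2 : Function.Bijective ((MonoidHom.snd (M ≃ₗ[ℤ] M) Γ).comp R.subtype) := by
    refine ⟨(injective_iff_map_eq_one _).2 fun x hx => ?_, fun γ => ?_⟩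
    · have hx2 : x.1.2 = 1 := hx
      refine Subtype.ext (Prod.ext (LinearEquiv.ext fun p => hT ?_) hx2)
      rw [hinv x.1 x.2 p, hx2, map_one]; rfl
    · have : γ ∈ R.map (MonoidHom.snd (M ≃ₗ[ℤ] M) Γ) := by rw [e2]; trivial
      obtain ⟨x, hx, rfl⟩ := this
      exact ⟨⟨x, hx⟩, rfl⟩
  exact ⟨(MulEquiv.subgroupCongr e1).symm.trans
    ((MulEquiv.ofBijective _ b1).symm.trans (MulEquiv.ofBijective _ b2))⟩

/-- Every transposition is one through `x`, or a conjugate of such a one by another. -/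
theorem eq_top_of_swap_mem {α : Type*} [DecidableEq α] [Finite α] (K : Subgroup (Perm α)) (x : α)
    (h : ∀ y, y ≠ x → swap x y ∈ K) : K = ⊤ := by
  rw [eq_top_iff, ← Equiv.Perm.closure_isSwap, Subgroup.closure_le]
  rintro _ ⟨y, z, hyz, rfl⟩
  by_cases hy : y = x
  · subst hy; exact h z hyz.symm
  by_cases hz : z = x
  · subst hz; rw [swap_comm]; exact h y hy
  have e : swap y z = swap x y * swap x z * swap x y := by
    rw [swap_comm x z, swap_mul_swap_mul_swap hz hyz.symm]
  rw [e]
  exact K.mul_mem (K.mul_mem (h y hy) (h z hz)) (h y hy)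

theorem Param.ext_coords {n : ℕ} {p q : Param n} (ha : ∀ k, 1 ≤ k → k ≤ n → p.a k = q.a k)
    (hb : ∀ k, 1 ≤ k → k ≤ n → p.b k = q.b k) (hc : ∀ k, 2 ≤ k → k ≤ n → p.c k = q.c k) :
    p = q := by
  rw [← Param.of_self p, ← Param.of_self q]
  exact Param.of_congr ha hb hc

/-! ### The case `n = 2` -/

section Two

/-- Permutations act on vectors. -/
def permEnd (ι : Type*) : Perm ι →* Function.End (ι → ℤ) where
  toFun π := fun v i => v (π⁻¹ i)
  map_one' := rfl
  map_mul' _ _ := rfl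

/-- Five linear forms permuted by `G` for `n = 2`. -/
def formsTwo (p : E 2) : Fin 5 → ℤ :=
  ![p.1.a 2 - p.1.b 1 + p.1.c 2, p.1.a 2 - p.1.b 1 + 2 * p.1.b 2 - p.1.c 2,
    -p.1.a 2 + p.1.b 1 + p.1.c 2, p.1.a 2 + p.1.b 1 - p.1.c 2,
    2 * p.1.a 1 - p.1.a 2 + p.1.b 1 - p.1.c 2]

theorem formsTwo_injective : Function.Injective formsTwo := by
  intro p q h
  have h0 := congrFun h 0
  have h1 := congrFun h 1
  have h2 := congrFun h 2
  have h3 := congrFun h 3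
  have h4 := congrFun h 4
  simp [formsTwo] at h0 h1 h2 h3 h4
  refine Subtype.ext (Param.ext_coords (fun k hk1 hk2 => ?_) (fun k hk1 hk2 => ?_)
    (fun k hk1 hk2 => ?_)) <;> interval_cases k <;> omega

/-- At one suitable parameter the five forms take distinct values, so no nontrivial permutation
fixes them. -/
theorem formsTwo_faithful (γ : Perm (Fin 5))
    (h : ∀ p, permEnd (Fin 5) γ (formsTwo p) = formsTwo p) : γ = 1 := by
  let p : Param 2 := Param.of 2 (fun k => if k = 1 then 0 else 1) (fun k => if k = 1 then 0 else 5)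
    (fun _ => 4)
  have hp : p ∈ E 2 := ⟨fun k h1 h2 => by omega, fun h => by omega, fun h => by omega⟩
  have e : formsTwo ⟨p, hp⟩ = ![5, 7, 3, -3, -5] := by
    funext i
    fin_cases i <;> simp [formsTwo, p, Param.a_of, Param.b_of, Param.c_of]
  have hinj : Function.Injective (formsTwo ⟨p, hp⟩) := by rw [e]; decide
  rw [← inv_eq_one]
  exact Equiv.ext fun i => hinj (congrFun (h ⟨p, hp⟩) i)

/-- Conjugating the transposition attached to `φ` by the other two generators yields all
transpositions through `0`. -/
theorem closure_perm_two : Subgroup.closure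
    ({swap 0 2 * swap 1 4, swap 1 2 * swap 3 4, swap 2 4} : Set (Perm (Fin 5))) = ⊤ := by
  set K := Subgroup.closure
    ({swap 0 2 * swap 1 4, swap 1 2 * swap 3 4, swap 2 4} : Set (Perm (Fin 5)))
  have h1 : swap 0 2 * swap 1 4 ∈ K := Subgroup.subset_closure (by simp)
  have h2 : swap 1 2 * swap 3 4 ∈ K := Subgroup.subset_closure (by simp)
  have h24 : swap 2 4 ∈ K := Subgroup.subset_closure (by simp)
  have conj : ∀ {g t : Perm (Fin 5)}, g ∈ K → t ∈ K → g * t * g⁻¹ ∈ K := fun hg ht =>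
    K.mul_mem (K.mul_mem hg ht) (K.inv_mem hg)
  have h01 : swap 0 1 ∈ K := by convert conj h1 h24 using 1; decide
  have h13 : swap 1 3 ∈ K := by convert conj h2 h24 using 1; decide
  have h02 : swap 0 2 ∈ K := by convert conj h2 h01 using 1; decide
  refine eq_top_of_swap_mem K 0 fun y hy => ?_
  fin_cases y
  · exact absurd rfl hy
  · exact h01
  · exact h02
  · show swap 0 3 ∈ K
    convert conj h01 h13 using 1; decide
  · show swap 0 4 ∈ K
    convert conj h02 h24 using 1; decide

theorem permEnd_apply {ι : Type*} (π : Perm ι) (v : ι → ℤ) :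
    permEnd ι π v = fun i => v (π⁻¹ i) := rfl

theorem nonempty_G_two_mulEquiv (hn : 2 ≤ 2) : Nonempty (G hn ≃* Perm (Fin 5)) := by
  set s : Set ((E 2 ≃ₗ[ℤ] E 2) × Perm (Fin 5)) := {(sigma hn, swap 0 2 * swap 1 4),
    (psi hn, swap 1 2 * swap 3 4), (phi hn, swap 2 4)} with hs
  have hfst : Prod.fst '' s = {sigma hn, psi hn, phi hn} := by
    simp only [hs, Set.image_insert_eq, Set.image_singleton]
  have hsnd : Prod.snd '' s = {swap 0 2 * swap 1 4, swap 1 2 * swap 3 4, swap 2 4} := by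
    simp only [hs, Set.image_insert_eq, Set.image_singleton]
  rw [G, ← hfst]
  refine nonempty_closure_mulEquiv (permEnd (Fin 5)) formsTwo formsTwo_injective
    formsTwo_faithful s ?_ (hsnd ▸ closure_perm_two)
  rintro x (rfl | rfl | rfl) p
  · have e : ⇑(swap 0 2 * swap 1 4 : Perm (Fin 5))⁻¹ = ![2, 4, 0, 3, 1] := by decide
    rw [permEnd_apply, e]
    funext i
    fin_cases i <;> simp [formsTwo, coe_sigma, sigmaMap_apply, Param.a_of, Param.b_of,
      Param.c_of] <;> ring
  · have e : ⇑(swap 1 2 * swap 3 4 : Perm (Fin 5))⁻¹ = ![0, 2, 1, 4, 3] := by decide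
    rw [permEnd_apply, e]
    funext i
    fin_cases i <;> simp [formsTwo, coe_psi, psiMap_apply, Param.a_of, Param.b_of,
      Param.c_of] <;> ring
  · have e : ⇑(swap 2 4 : Perm (Fin 5))⁻¹ = ![0, 1, 4, 3, 2] := by decide
    rw [permEnd_apply, e]
    funext i
    fin_cases i <;> simp [formsTwo, coe_phi, phiMap_apply, Param.a_of, Param.b_of,
      Param.c_of] <;> ring

end Two

end RhinViola

namespace RhinViola

open Equiv

/-! ### The case `n = 3` -/

section Three

/-- The sign `(-1)^e`. -/
def zmodSign (e : ZMod 2) : ℤ := if e = 0 then 1 else -1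

theorem zmodSign_add (e f : ZMod 2) : zmodSign (e + f) = zmodSign e * zmodSign f := by
  revert e f; decide

theorem zmodSign_mul_self (e : ZMod 2) : zmodSign e * zmodSign e = 1 := by
  revert e; decide

/-- Signed permutations act on vectors, and trivially on an additional coordinate. -/
def signedPermEnd :
    Multiplicative H ⋊[permAction] Perm (Fin 5) →* Function.End ((Fin 5 → ℤ) × ℤ) where
  toFun γ := fun v => (fun i => zmodSign (γ.left.toAdd.1 i) * v.1 (γ.right⁻¹ i), v.2)
  map_one' := by
    funext v
    refine Prod.ext (funext fun i => ?_) rfl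
    exact one_mul _
  map_mul' γ γ' := by
    funext v
    refine Prod.ext (funext fun i => ?_) rfl
    change zmodSign (γ.left.toAdd.1 i + γ'.left.toAdd.1 (γ.right⁻¹ i)) *
      v.1 ((γ.right * γ'.right)⁻¹ i) = zmodSign (γ.left.toAdd.1 i) *
        (zmodSign (γ'.left.toAdd.1 (γ.right⁻¹ i)) * v.1 (γ'.right⁻¹ (γ.right⁻¹ i)))
    rw [zmodSign_add, mul_assoc, mul_inv_rev, Perm.mul_apply]

/-- Five linear forms permuted up to sign by `G`, and an invariant form, for `n = 3`. -/
def formsThree (p : E 3) : (Fin 5 → ℤ) × ℤ :=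
  (![2 * p.1.a 1 - p.1.a 2 - p.1.a 3 + p.1.b 1 - p.1.c 3,
      -p.1.a 2 - p.1.a 3 + p.1.b 1 + p.1.c 3,
      p.1.a 2 - p.1.a 3 + p.1.b 1 - p.1.c 3,
      p.1.a 2 - p.1.a 3 - p.1.b 1 + 2 * p.1.b 2 - p.1.c 3,
      p.1.a 2 - p.1.a 3 - p.1.b 1 + p.1.c 3],
    2 * p.1.a 1 + p.1.a 2 - p.1.a 3 + p.1.b 1 + 2 * p.1.b 2 - p.1.c 3)

/-- `𝓔` has rank `6`, so five forms cannot separate its points; hence the additional invariant form.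
-/
theorem formsThree_injective : Function.Injective formsThree := by
  intro p q h
  have hI := congrArg Prod.snd h
  have h' := congrArg Prod.fst h
  have h0 := congrFun h' 0
  have h1 := congrFun h' 1
  have h2 := congrFun h' 2
  have h3 := congrFun h' 3
  have h4 := congrFun h' 4
  simp [formsThree] at h0 h1 h2 h3 h4 hI
  have p1 := p.2.1 2 le_rfl le_rfl
  have p2 := p.2.2.1 rfl
  have q1 := q.2.1 2 le_rfl le_rfl
  have q2 := q.2.2.1 rfl
  refine Subtype.ext (Param.ext_coords (fun k hk1 hk2 => ?_) (fun k hk1 hk2 => ?_)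
    (fun k hk1 hk2 => ?_)) <;> interval_cases k <;> omega

theorem formsThree_faithful (γ : Multiplicative H ⋊[permAction] Perm (Fin 5))
    (h : ∀ p, signedPermEnd γ (formsThree p) = formsThree p) : γ = 1 := by
  let p : Param 3 := Param.of 3 (fun k => if k = 1 then 7 else if k = 2 then 5 else 1)
    (fun k => if k = 1 then 2 else if k = 2 then 3 else 9) (fun _ => 0)
  have hp : p ∈ E 3 := by
    refine ⟨fun k h1 h2 => ?_, fun _ => ?_, fun h => by omega⟩
    · simp [p, Param.c_of]
    · simp [p, Param.a_of, Param.b_of]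
  have e : (formsThree ⟨p, hp⟩).1 = ![10, -4, 6, 8, 2] := by
    funext i
    fin_cases i <;> simp [formsThree, p, Param.a_of, Param.b_of, Param.c_of]
  -- Distinct squares determine the permutation whatever the signs are; once it is trivial,
  -- nonvanishing of the values determines the signs.
  have hinj : Function.Injective fun i => ![(10 : ℤ), -4, 6, 8, 2] i * ![10, -4, 6, 8, 2] i := by
    decide
  have hne : ∀ i, ![(10 : ℤ), -4, 6, 8, 2] i ≠ 0 := by decide
  have key : ∀ i, zmodSign (γ.left.toAdd.1 i) * ![(10 : ℤ), -4, 6, 8, 2] (γ.right⁻¹ i)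
      = ![10, -4, 6, 8, 2] i := by
    intro i
    have := congrFun (congrArg Prod.fst (h ⟨p, hp⟩)) i
    rw [← e]
    exact this
  have hperm : ∀ i, γ.right⁻¹ i = i := fun i => hinj (by
    simp only
    rw [← key i]
    linear_combination -(![(10 : ℤ), -4, 6, 8, 2] (γ.right⁻¹ i) *
      ![(10 : ℤ), -4, 6, 8, 2] (γ.right⁻¹ i)) * zmodSign_mul_self (γ.left.toAdd.1 i))
  refine SemidirectProduct.ext ?_ ?_
  · refine Multiplicative.toAdd.injective (Subtype.ext (funext fun i => ?_))
    have h1 := key i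
    rw [hperm i] at h1
    have h2 : zmodSign (γ.left.toAdd.1 i) = 1 := mul_right_cancel₀ (hne i) (by rw [h1, one_mul])
    unfold zmodSign at h2
    split_ifs at h2 with h3
    exact h3
  · rw [SemidirectProduct.one_right, ← inv_eq_one]
    exact Equiv.ext hperm

/-- The element of `H` with two non-zero coordinates `i` and `j`. -/
def pairH (i j : Fin 5) : H := ⟨Pi.single i 1 + Pi.single j 1, by
  change ∑ k, (Pi.single i 1 + Pi.single j 1 : Fin 5 → ZMod 2) k = 0
  revert i j; decide⟩

/-- The coordinates `1,…,4` of an element of `H` are free, and its coordinate `0` is their sum. -/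
theorem eq_sum_pairH (e : H) : e = (e.1 1).val • pairH 0 1 + (e.1 2).val • pairH 0 2
    + (e.1 3).val • pairH 0 3 + (e.1 4).val • pairH 0 4 := by
  obtain ⟨e, he⟩ := e
  refine Subtype.ext ?_
  have he' : ∑ i, e i = 0 := he
  change e = (e 1).val • (Pi.single 0 1 + Pi.single 1 1 : Fin 5 → ZMod 2)
    + (e 2).val • (Pi.single 0 1 + Pi.single 2 1 : Fin 5 → ZMod 2)
    + (e 3).val • (Pi.single 0 1 + Pi.single 3 1 : Fin 5 → ZMod 2)
    + (e 4).val • (Pi.single 0 1 + Pi.single 4 1 : Fin 5 → ZMod 2)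
  rw [Fin.sum_univ_five] at he'
  have h0 : e 0 = e 1 + e 2 + e 3 + e 4 := by
    have h2 : ∀ a b c d f : ZMod 2, a + b + c + d + f = 0 → a = b + c + d + f := by decide
    exact h2 _ _ _ _ _ he'
  have hs : ∀ x y : ZMod 2, x.val • y = x * y := by decide
  funext i
  change e i = (e 1).val • ((Pi.single 0 1 : Fin 5 → ZMod 2) i + (Pi.single 1 1 : Fin 5 → ZMod 2) i)
    + (e 2).val • ((Pi.single 0 1 : Fin 5 → ZMod 2) i + (Pi.single 2 1 : Fin 5 → ZMod 2) i)
    + (e 3).val • ((Pi.single 0 1 : Fin 5 → ZMod 2) i + (Pi.single 3 1 : Fin 5 → ZMod 2) i)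
    + (e 4).val • ((Pi.single 0 1 : Fin 5 → ZMod 2) i + (Pi.single 4 1 : Fin 5 → ZMod 2) i)
  simp only [hs]
  fin_cases i <;> simp [h0]

theorem permAction_pairH (s : Perm (Fin 5)) (i j : Fin 5) :
    permAction s (Multiplicative.ofAdd (pairH i j)) = Multiplicative.ofAdd (pairH (s i) (s j)) := by
  refine Multiplicative.toAdd.injective (Subtype.ext (funext fun k => ?_))
  change (Pi.single i 1 + Pi.single j 1 : Fin 5 → ZMod 2) (s⁻¹ k)
    = (Pi.single (s i) 1 + Pi.single (s j) 1 : Fin 5 → ZMod 2) k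
  simp only [Pi.add_apply, Pi.single_apply, Perm.inv_eq_iff_eq]

/-- Conjugation of `swap 1 2` produces all transpositions through `2`, hence every permutation.
Dividing the second generator by its permutation leaves one even sign change, whose conjugates
generate `H`. -/
theorem closure_signedPerm_three : Subgroup.closure
    ({SemidirectProduct.inr (swap 0 3 * swap 1 4),
      SemidirectProduct.inl (Multiplicative.ofAdd (pairH 0 4))
        * SemidirectProduct.inr (swap 0 4 * swap 1 3),
      SemidirectProduct.inr (swap 1 2)} :
      Set (Multiplicative H ⋊[permAction] Perm (Fin 5))) = ⊤ := by
  set S : Set (Multiplicative H ⋊[permAction] Perm (Fin 5)) :=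
    {SemidirectProduct.inr (swap 0 3 * swap 1 4),
      SemidirectProduct.inl (Multiplicative.ofAdd (pairH 0 4))
        * SemidirectProduct.inr (swap 0 4 * swap 1 3),
      SemidirectProduct.inr (swap 1 2)}
  set K := Subgroup.closure S
  have h1 : SemidirectProduct.inr (swap 0 3 * swap 1 4) ∈ K :=
    Subgroup.subset_closure (by simp [S])
  have h2 : SemidirectProduct.inl (Multiplicative.ofAdd (pairH 0 4))
      * SemidirectProduct.inr (swap 0 4 * swap 1 3) ∈ K := Subgroup.subset_closure (by simp [S])
  have h12 : SemidirectProduct.inr (swap 1 2) ∈ K := Subgroup.subset_closure (by simp [S])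
  have conj : ∀ {g t}, g ∈ K → t ∈ K → g * t * g⁻¹ ∈ K := fun hg ht =>
    K.mul_mem (K.mul_mem hg ht) (K.inv_mem hg)
  have h24 : SemidirectProduct.inr (swap 2 4) ∈ K := by
    convert conj h1 h12 using 1
    rw [← map_inv, ← map_mul, ← map_mul]
    congr 1
    decide
  have h23 : SemidirectProduct.inr (swap 2 3) ∈ K := by
    convert conj h2 h12 using 1
    -- The sign change at `0` and `4` commutes with `swap 2 3`, so conjugation by the second
    -- generator introduces no sign.
    have e : permAction (swap 2 3) (Multiplicative.ofAdd (pairH 0 4))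
        = Multiplicative.ofAdd (pairH 0 4) := by rw [permAction_pairH]; rfl
    have e2 : (SemidirectProduct.inr (swap 2 3) : Multiplicative H ⋊[permAction] Perm (Fin 5))
        * SemidirectProduct.inl (Multiplicative.ofAdd (pairH 0 4))
        = SemidirectProduct.inl (Multiplicative.ofAdd (pairH 0 4))
          * SemidirectProduct.inr (swap 2 3) := by
      have h := SemidirectProduct.inl_aut (φ := permAction) (swap 2 3)
        (Multiplicative.ofAdd (pairH 0 4))
      rw [e] at h
      conv_rhs => rw [h]
      rw [mul_assoc (_ * _), ← map_mul, inv_mul_cancel, map_one, mul_one]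
    rw [eq_mul_inv_iff_mul_eq, ← mul_assoc, e2, mul_assoc, mul_assoc, ← map_mul, ← map_mul]
    congr 2
    decide
  have h20 : SemidirectProduct.inr (swap 2 0) ∈ K := by
    convert conj h1 h23 using 1
    rw [← map_inv, ← map_mul, ← map_mul]
    congr 1
    decide
  have hinr : ∀ s, SemidirectProduct.inr s ∈ K := by
    have : K.comap SemidirectProduct.inr = ⊤ := by
      refine eq_top_of_swap_mem _ 2 fun y hy => ?_
      rw [Subgroup.mem_comap]
      fin_cases y
      · exact h20
      · rw [swap_comm]; exact h12
      · exact absurd rfl hy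
      · exact h23
      · exact h24
    intro s
    have h : s ∈ K.comap SemidirectProduct.inr := by rw [this]; trivial
    exact h
  have hpair : SemidirectProduct.inl (Multiplicative.ofAdd (pairH 0 4)) ∈ K := by
    have := K.mul_mem h2 (K.inv_mem (hinr (swap 0 4 * swap 1 3)))
    rwa [mul_inv_cancel_right] at this
  have hpairs : ∀ j, j ≠ 0 → SemidirectProduct.inl (Multiplicative.ofAdd (pairH 0 j)) ∈ K := by
    intro j hj
    have := conj (hinr (swap 4 j)) hpair
    rw [← map_inv, ← SemidirectProduct.inl_aut, permAction_pairH, swap_apply_left,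
      swap_apply_of_ne_of_ne (by decide) hj.symm] at this
    exact this
  have hinl : ∀ e, SemidirectProduct.inl e ∈ K := by
    intro e
    have he : e = Multiplicative.ofAdd (pairH 0 1) ^ (e.toAdd.1 1).val
        * Multiplicative.ofAdd (pairH 0 2) ^ (e.toAdd.1 2).val
        * Multiplicative.ofAdd (pairH 0 3) ^ (e.toAdd.1 3).val
        * Multiplicative.ofAdd (pairH 0 4) ^ (e.toAdd.1 4).val := eq_sum_pairH e.toAdd
    rw [he]
    simp only [map_mul, map_pow]
    exact K.mul_mem (K.mul_mem (K.mul_mem (K.pow_mem (hpairs 1 (by decide)) _)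
      (K.pow_mem (hpairs 2 (by decide)) _)) (K.pow_mem (hpairs 3 (by decide)) _))
      (K.pow_mem (hpairs 4 (by decide)) _)
  rw [eq_top_iff]
  intro x _
  rw [← SemidirectProduct.inl_left_mul_inr_right x]
  exact K.mul_mem (hinl _) (hinr _)

theorem signedPermEnd_apply (γ : Multiplicative H ⋊[permAction] Perm (Fin 5))
    (v : (Fin 5 → ℤ) × ℤ) : signedPermEnd γ v
      = (fun i => zmodSign (γ.left.toAdd.1 i) * v.1 (γ.right⁻¹ i), v.2) := rfl

theorem signedPermEnd_inr (s : Perm (Fin 5)) (v : (Fin 5 → ℤ) × ℤ) :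
    signedPermEnd (SemidirectProduct.inr s) v = (fun i => v.1 (s⁻¹ i), v.2) := by
  rw [signedPermEnd_apply]
  simp [zmodSign]

theorem signedPermEnd_inl_mul_inr (e : H) (s : Perm (Fin 5)) (v : (Fin 5 → ℤ) × ℤ) :
    signedPermEnd (SemidirectProduct.inl (Multiplicative.ofAdd e) * SemidirectProduct.inr s) v
      = (fun i => zmodSign (e.1 i) * v.1 (s⁻¹ i), v.2) := by
  rw [signedPermEnd_apply]
  simp

theorem nonempty_G_three_mulEquiv (hn : 2 ≤ 3) :
    Nonempty (G hn ≃* Multiplicative H ⋊[permAction] Perm (Fin 5)) := by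
  set s : Set ((E 3 ≃ₗ[ℤ] E 3) × (Multiplicative H ⋊[permAction] Perm (Fin 5))) :=
    {(sigma hn, SemidirectProduct.inr (swap 0 3 * swap 1 4)),
      (psi hn, SemidirectProduct.inl (Multiplicative.ofAdd (pairH 0 4))
        * SemidirectProduct.inr (swap 0 4 * swap 1 3)),
      (phi hn, SemidirectProduct.inr (swap 1 2))} with hs
  have hfst : Prod.fst '' s = {sigma hn, psi hn, phi hn} := by
    simp only [hs, Set.image_insert_eq, Set.image_singleton]
  have hsnd : Prod.snd '' s = {SemidirectProduct.inr (swap 0 3 * swap 1 4),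
      SemidirectProduct.inl (Multiplicative.ofAdd (pairH 0 4))
        * SemidirectProduct.inr (swap 0 4 * swap 1 3),
      SemidirectProduct.inr (swap 1 2)} := by
    simp only [hs, Set.image_insert_eq, Set.image_singleton]
  rw [G, ← hfst]
  refine nonempty_closure_mulEquiv signedPermEnd formsThree formsThree_injective
    formsThree_faithful s ?_ (hsnd ▸ closure_signedPerm_three)
  rintro x (rfl | rfl | rfl) p
  · have e : ⇑(swap 0 3 * swap 1 4 : Perm (Fin 5))⁻¹ = ![3, 4, 2, 0, 1] := by
      decide
    rw [signedPermEnd_inr, e]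
    refine Prod.ext (funext fun i => ?_) ?_
    · fin_cases i <;> simp [formsThree, coe_sigma, sigmaMap_apply, Param.a_of, Param.b_of,
        Param.c_of] <;> ring
    · simp [formsThree, coe_sigma, sigmaMap_apply, Param.a_of, Param.b_of, Param.c_of]
      ring
  · have e : ⇑(swap 0 4 * swap 1 3 : Perm (Fin 5))⁻¹ = ![4, 3, 2, 1, 0] := by
      decide
    have e2 : (fun i => zmodSign ((pairH 0 4).1 i)) = ![-1, 1, 1, 1, -1] := by decide
    have e3 : ∀ i, zmodSign ((pairH 0 4).1 i) = ![-1, 1, 1, 1, -1] i := congrFun e2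
    have hp := p.2.2.1 rfl
    rw [signedPermEnd_inl_mul_inr, e]
    refine Prod.ext (funext fun i => ((congrArg (· * _) (e3 i)).trans ?_).symm) ?_
    · fin_cases i <;> simp [formsThree, coe_psi, psiMap_apply, Param.a_of, Param.b_of,
        Param.c_of] <;> linarith
    · simp [formsThree, coe_psi, psiMap_apply, Param.a_of, Param.b_of, Param.c_of]
      linarith
  · have e : ⇑(swap 1 2 : Perm (Fin 5))⁻¹ = ![0, 2, 1, 3, 4] := by
      decide
    rw [signedPermEnd_inr, e]
    refine Prod.ext (funext fun i => ?_) ?_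
    · fin_cases i <;> simp [formsThree, coe_phi, phiMap_apply, Param.a_of, Param.b_of,
        Param.c_of] <;> ring
    · simp [formsThree, coe_phi, phiMap_apply, Param.a_of, Param.b_of, Param.c_of]
      ring

end Three

end RhinViola

namespace RhinViola

open Equiv

/-! ### The case `n ≥ 4` -/

section General

/-- A pair of permutations and an element of `ℤ/2ℤ` act on pairs of vectors; the latter also
reverses an additional vector. -/
def wreathFun {ι : Type*} {n : ℕ} (π : Perm ι × Perm ι) (e : Multiplicative (ZMod 2))
    (v : (ι → ℤ) × (ι → ℤ) × (Fin n → ℤ)) : (ι → ℤ) × (ι → ℤ) × (Fin n → ℤ) :=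
  if e = 1 then (fun i => v.1 (π.1⁻¹ i), fun i => v.2.1 (π.2⁻¹ i), v.2.2)
  else (fun i => v.2.1 (π.1⁻¹ i), fun i => v.1 (π.2⁻¹ i), fun i => v.2.2 i.rev)

theorem wreathFun_mul {ι : Type*} {n : ℕ} (π π' : Perm ι × Perm ι) (e e' : Multiplicative (ZMod 2))
    (v : (ι → ℤ) × (ι → ℤ) × (Fin n → ℤ)) :
    wreathFun (π * swapAction (Perm ι) e π') (e * e') v = wreathFun π e (wreathFun π' e' v) := by
  have hc : ∀ e : Multiplicative (ZMod 2), e = 1 ∨ e = Multiplicative.ofAdd 1 := by decide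
  have h1 : ¬ (Multiplicative.ofAdd (1 : ZMod 2) = 1) := by decide
  have h2 : Multiplicative.ofAdd (1 : ZMod 2) * Multiplicative.ofAdd 1 = 1 := by decide
  rcases hc e with rfl | rfl <;> rcases hc e' with rfl | rfl <;>
    simp [wreathFun, h1, h2, swapAction, MulEquiv.prodComm]

/-- The action of the wreath product of `ℤ/2ℤ` with a permutation group on pairs of vectors. -/
def wreathEnd (ι : Type*) (n : ℕ) : (Perm ι × Perm ι) ⋊[swapAction (Perm ι)] Multiplicative (ZMod 2)
    →* Function.End ((ι → ℤ) × (ι → ℤ) × (Fin n → ℤ)) where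
  toFun γ := wreathFun γ.left γ.right
  map_one' := rfl
  map_mul' γ γ' := funext fun v => wreathFun_mul γ.left γ'.left γ.right γ'.right v

theorem wreathEnd_inl {ι : Type*} {n : ℕ} (α β : Perm ι) (v : (ι → ℤ) × (ι → ℤ) × (Fin n → ℤ)) :
    wreathEnd ι n (SemidirectProduct.inl (α, β)) v
      = (fun i => v.1 (α⁻¹ i), fun i => v.2.1 (β⁻¹ i), v.2.2) := rfl

theorem wreathEnd_inr {ι : Type*} {n : ℕ} (v : (ι → ℤ) × (ι → ℤ) × (Fin n → ℤ)) :
    wreathEnd ι n (SemidirectProduct.inr (Multiplicative.ofAdd 1)) v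
      = (v.2.1, v.1, fun i => v.2.2 i.rev) := rfl

/-- Two families of linear forms permuted by `G`, for `n ≥ 4`, and the remaining coordinates. -/
def formsGeneral {n : ℕ} (p : E n) : (Fin 3 → ℤ) × (Fin 3 → ℤ) × (Fin n → ℤ) :=
  (![p.1.a 1, p.1.b 2, p.1.a 2], ![p.1.a n, p.1.b n, p.1.a (n - 1)],
    fun i => if 2 ≤ i.1 ∧ i.1 + 3 ≤ n then p.1.a (i.1 + 1) else 0)

/-- The forms give every `a_k` and `b_2`; the relation `b_{k+2} = a_k + b_{k+1} - a_{k+2}` then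
yields the other `b_k` recursively, while `b_1 = a_2` and `c_n = b_n`. -/
theorem formsGeneral_injective {n : ℕ} (hn : 4 ≤ n) :
    Function.Injective (formsGeneral (n := n)) := by
  intro p q h
  have hu := congrArg Prod.fst h
  have hv := congrArg (fun v => v.2.1) h
  have hw := congrArg (fun v => v.2.2) h
  have a1 : p.1.a 1 = q.1.a 1 := congrFun hu 0
  have b2 : p.1.b 2 = q.1.b 2 := congrFun hu 1
  have a2 : p.1.a 2 = q.1.a 2 := congrFun hu 2
  have an : p.1.a n = q.1.a n := congrFun hv 0
  have bn : p.1.b n = q.1.b n := congrFun hv 1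
  have an1 : p.1.a (n - 1) = q.1.a (n - 1) := congrFun hv 2
  have ha : ∀ k, 1 ≤ k → k ≤ n → p.1.a k = q.1.a k := by
    intro k h1 h2
    by_cases hk : 3 ≤ k ∧ k + 2 ≤ n
    · have := congrFun hw ⟨k - 1, by omega⟩
      simp only [formsGeneral] at this
      rwa [if_pos (by omega), if_pos (by omega), show k - 1 + 1 = k by omega] at this
    · obtain rfl | rfl | rfl | rfl : k = 1 ∨ k = 2 ∨ k = n - 1 ∨ k = n := by omega
      all_goals assumption
  obtain ⟨p1, p2, p3⟩ := p.2.2.2 hn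
  obtain ⟨q1, q2, q3⟩ := q.2.2.2 hn
  have hb : ∀ k, k + 2 ≤ n → p.1.b (k + 2) = q.1.b (k + 2) := by
    intro k hk
    induction k with
    | zero => exact b2
    | succ k ih =>
      have e1 := p3 (k + 1) (by omega) (by omega)
      have e2 := q3 (k + 1) (by omega) (by omega)
      have e3 := ih (by omega)
      have e4 := ha (k + 1) (by omega) (by omega)
      have e5 := ha (k + 1 + 2) (by omega) (by omega)
      rw [show k + 1 + 1 = k + 2 by omega] at e1 e2
      linarith
  refine Subtype.ext (Param.ext_coords ha (fun k h1 h2 => ?_) (fun k h1 h2 => ?_))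
  · rcases Nat.lt_or_ge k 2 with hk | hk
    · obtain rfl : k = 1 := by omega
      rw [← p1, ← q1, a2]
    · have := hb (k - 2) (by omega)
      rwa [show k - 2 + 2 = k by omega] at this
  · rcases Nat.lt_or_ge k n with hk | hk
    · rw [p.2.1 k h1 (by omega), q.2.1 k h1 (by omega)]
    · obtain rfl : k = n := by omega
      rw [← p2, ← q2, bn]

theorem exists_formsGeneral_eq {n : ℕ} (hn : 4 ≤ n) : ∃ p : E n,
    (formsGeneral p).1 = ![0, 1, 5] ∧ (formsGeneral p).2.1 = ![-1, 3, 4] := by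
  -- The relations of `𝓔` say that `a_{k-1} + a_k + b_k` is independent of `k ≥ 2`. Fixing this sum
  -- at `6` makes the values of the six forms pairwise distinct.
  let A : ℕ → ℤ := fun k => if k = 2 then 5 else if k = n then -1 else if k = n - 1 then 4 else 0
  let p : Param n := Param.of n A (fun k => if k = 1 then 5 else 6 - A (k - 1) - A k)
    (fun k => if k = n then 3 else 0)
  have hp : p ∈ E n := by
    refine ⟨fun k h1 h2 => ?_, fun h => by omega, fun _ => ⟨?_, ?_, fun k h1 h2 => ?_⟩⟩ <;>
      simp only [p, A, Param.a_of, Param.b_of, Param.c_of]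
    · grind
    · grind
    · grind
    · rw [show k + 2 - 1 = k + 1 by omega, show k + 1 - 1 = k by omega]
      grind
  refine ⟨⟨p, hp⟩, ?_, ?_⟩ <;> funext i <;> fin_cases i <;>
    simp [formsGeneral, p, A, Param.a_of, Param.b_of] <;> grind

theorem formsGeneral_faithful {n : ℕ} (hn : 4 ≤ n)
    (γ : (Perm (Fin 3) × Perm (Fin 3)) ⋊[swapAction (Perm (Fin 3))] Multiplicative (ZMod 2))
    (h : ∀ p : E n, wreathEnd (Fin 3) n γ (formsGeneral p) = formsGeneral p) : γ = 1 := by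
  obtain ⟨p, hu, hv⟩ := exists_formsGeneral_eq hn
  have iu : Function.Injective ![(0 : ℤ), 1, 5] := by decide
  have iv : Function.Injective ![(-1 : ℤ), 3, 4] := by decide
  have hc : ∀ i j, ![(-1 : ℤ), 3, 4] i ≠ ![(0 : ℤ), 1, 5] j := by decide
  have hp := h p
  obtain ⟨⟨α, β⟩, e⟩ := γ
  by_cases he : e = 1
  · subst he
    have h1 : ∀ i, (formsGeneral p).1 (α⁻¹ i) = (formsGeneral p).1 i :=
      congrFun (congrArg Prod.fst hp)
    have h2 : ∀ i, (formsGeneral p).2.1 (β⁻¹ i) = (formsGeneral p).2.1 i :=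
      congrFun (congrArg (fun v => v.2.1) hp)
    rw [hu] at h1
    rw [hv] at h2
    have e1 : α = 1 := inv_eq_one.1 (Equiv.ext fun i => iu (h1 i))
    have e2 : β = 1 := inv_eq_one.1 (Equiv.ext fun i => iv (h2 i))
    rw [e1, e2]
    rfl
  -- An element exchanging the two triples is excluded because their values at `p` are disjoint.
  · have hw : wreathEnd (Fin 3) n ⟨(α, β), e⟩ (formsGeneral p)
        = (fun i => (formsGeneral p).2.1 (α⁻¹ i), fun i => (formsGeneral p).1 (β⁻¹ i),
          fun i => (formsGeneral p).2.2 i.rev) := if_neg he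
    rw [hw] at hp
    have h1 : (formsGeneral p).2.1 (α⁻¹ 0) = (formsGeneral p).1 0 :=
      congrFun (congrArg Prod.fst hp) 0
    rw [hu, hv] at h1
    exact absurd h1 (hc _ _)

/-- Conjugation by the exchange of the factors brings `swap 1 2` to the left factor, where it joins
`swap 0 1` to generate the symmetric group; conjugating back gives the right factor. -/
theorem closure_wreath : Subgroup.closure
    ({SemidirectProduct.inl (swap 0 1, 1), SemidirectProduct.inr (Multiplicative.ofAdd 1),
      SemidirectProduct.inl (1, swap 1 2)} :
      Set ((Perm (Fin 3) × Perm (Fin 3)) ⋊[swapAction (Perm (Fin 3))] Multiplicative (ZMod 2)))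
      = ⊤ := by
  set S : Set ((Perm (Fin 3) × Perm (Fin 3)) ⋊[swapAction (Perm (Fin 3))]
      Multiplicative (ZMod 2)) :=
    {SemidirectProduct.inl (swap 0 1, 1), SemidirectProduct.inr (Multiplicative.ofAdd 1),
      SemidirectProduct.inl (1, swap 1 2)}
  set K := Subgroup.closure S
  have h1 : SemidirectProduct.inl (swap 0 1, 1) ∈ K := Subgroup.subset_closure (by simp [S])
  have h2 : SemidirectProduct.inr (Multiplicative.ofAdd 1) ∈ K :=
    Subgroup.subset_closure (by simp [S])
  have h3 : SemidirectProduct.inl (1, swap 1 2) ∈ K := Subgroup.subset_closure (by simp [S])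
  have conj : ∀ α β, SemidirectProduct.inl (α, β) ∈ K → SemidirectProduct.inl (β, α) ∈ K := by
    intro α β h
    have := K.mul_mem (K.mul_mem h2 h) (K.inv_mem h2)
    rwa [← map_inv, ← SemidirectProduct.inl_aut] at this
  have hleft : ∀ α, SemidirectProduct.inl (α, 1) ∈ K := by
    have : K.comap (SemidirectProduct.inl.comp (MonoidHom.inl _ _)) = ⊤ := by
      refine eq_top_of_swap_mem _ 1 fun y hy => ?_
      rw [Subgroup.mem_comap]
      fin_cases y
      · rw [swap_comm]; exact h1
      · exact absurd rfl hy
      · exact conj _ _ h3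
    intro α
    have h : α ∈ K.comap (SemidirectProduct.inl.comp (MonoidHom.inl _ _)) := by rw [this]; trivial
    exact h
  rw [eq_top_iff]
  intro x _
  rw [← SemidirectProduct.inl_left_mul_inr_right x]
  refine K.mul_mem ?_ ?_
  · have e : x.left = (x.left.1, 1) * (1, x.left.2) := by simp
    rw [e, map_mul]
    exact K.mul_mem (hleft _) (conj _ _ (hleft _))
  · have hc : ∀ e : Multiplicative (ZMod 2), e = 1 ∨ e = Multiplicative.ofAdd 1 := by decide
    rcases hc x.right with h | h <;> rw [h]
    · rw [map_one]; exact K.one_mem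
    · exact h2

theorem formsGeneral_sigma {n : ℕ} (hn : 2 ≤ n) (h4 : 4 ≤ n) (p : E n) :
    formsGeneral (sigma hn p) = (fun i => (formsGeneral p).1 (![1, 0, 2] i),
      (formsGeneral p).2.1, (formsGeneral p).2.2) := by
  obtain ⟨p1, p2, -⟩ := p.2.2.2 h4
  refine Prod.ext (funext fun i => ?_) (Prod.ext (funext fun i => ?_) (funext fun i => ?_))
  · fin_cases i <;> simp [formsGeneral, coe_sigma, sigmaMap_apply, Param.a_of, Param.b_of] <;> grind
  · fin_cases i <;> simp [formsGeneral, coe_sigma, sigmaMap_apply, Param.a_of, Param.b_of] <;> grind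
  · simp only [formsGeneral, coe_sigma, sigmaMap_apply, Param.a_of]
    grind

theorem formsGeneral_psi {n : ℕ} (hn : 2 ≤ n) (h4 : 4 ≤ n) (p : E n) :
    formsGeneral (psi hn p) = ((formsGeneral p).2.1,
      (formsGeneral p).1, fun i => (formsGeneral p).2.2 i.rev) := by
  obtain ⟨p1, p2, -⟩ := p.2.2.2 h4
  refine Prod.ext (funext fun i => ?_) (Prod.ext (funext fun i => ?_) (funext fun i => ?_))
  · fin_cases i <;> simp [formsGeneral, coe_psi, psiMap_apply, Param.a_of, Param.b_of] <;> grind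
  · fin_cases i <;> simp [formsGeneral, coe_psi, psiMap_apply, Param.a_of, Param.b_of] <;> grind
  · simp only [formsGeneral, coe_psi, psiMap_apply, Param.a_of, Fin.val_rev]
    grind

theorem formsGeneral_phi {n : ℕ} (hn : 2 ≤ n) (h4 : 4 ≤ n) (p : E n) :
    formsGeneral (phi hn p) = ((formsGeneral p).1,
      fun i => (formsGeneral p).2.1 (![0, 2, 1] i), (formsGeneral p).2.2) := by
  obtain ⟨p1, p2, -⟩ := p.2.2.2 h4
  refine Prod.ext (funext fun i => ?_) (Prod.ext (funext fun i => ?_) (funext fun i => ?_))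
  · fin_cases i <;> simp [formsGeneral, coe_phi, phiMap_apply, Param.a_of, Param.b_of] <;> grind
  · fin_cases i <;> simp [formsGeneral, coe_phi, phiMap_apply, Param.a_of, Param.b_of] <;> grind
  · simp only [formsGeneral, coe_phi, phiMap_apply, Param.a_of]
    grind

theorem nonempty_G_mulEquiv {n : ℕ} (hn : 2 ≤ n) (h4 : 4 ≤ n) :
    Nonempty (G hn ≃* (Perm (Fin 3) × Perm (Fin 3)) ⋊[swapAction (Perm (Fin 3))]
      Multiplicative (ZMod 2)) := by
  set s : Set ((E n ≃ₗ[ℤ] E n) ×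
      ((Perm (Fin 3) × Perm (Fin 3)) ⋊[swapAction (Perm (Fin 3))] Multiplicative (ZMod 2))) :=
    {(sigma hn, SemidirectProduct.inl (swap 0 1, 1)),
      (psi hn, SemidirectProduct.inr (Multiplicative.ofAdd 1)),
      (phi hn, SemidirectProduct.inl (1, swap 1 2))} with hs
  have hfst : Prod.fst '' s = {sigma hn, psi hn, phi hn} := by
    simp only [hs, Set.image_insert_eq, Set.image_singleton]
  have hsnd : Prod.snd '' s = {SemidirectProduct.inl (swap 0 1, 1),
      SemidirectProduct.inr (Multiplicative.ofAdd 1), SemidirectProduct.inl (1, swap 1 2)} := by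
    simp only [hs, Set.image_insert_eq, Set.image_singleton]
  rw [G, ← hfst]
  refine nonempty_closure_mulEquiv (wreathEnd (Fin 3) n) formsGeneral (formsGeneral_injective h4)
    (formsGeneral_faithful h4) s ?_ (hsnd ▸ closure_wreath)
  rintro x (rfl | rfl | rfl) p
  · have e : ⇑(swap 0 1 : Perm (Fin 3))⁻¹ = ![1, 0, 2] := by decide
    rw [wreathEnd_inl, e]
    exact formsGeneral_sigma hn h4 p
  · rw [wreathEnd_inr]
    exact formsGeneral_psi hn h4 p
  · have e : ⇑(swap 1 2 : Perm (Fin 3))⁻¹ = ![0, 2, 1] := by decide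
    rw [wreathEnd_inl, e]
    exact formsGeneral_phi hn h4 p

theorem card_wreath : Nat.card
    ((Perm (Fin 3) × Perm (Fin 3)) ⋊[swapAction (Perm (Fin 3))] Multiplicative (ZMod 2)) = 72 := by
  rw [SemidirectProduct.card, Nat.card_prod, Nat.card_perm, Nat.card_congr Multiplicative.toAdd,
    Nat.card_zmod, Nat.card_fin]
  rfl

end General

end RhinViola

theorem mainTheorem4 (n : ℕ) (hn : 2 ≤ n) :
    -- `G = ⟨σ, ψ, φ⟩` is a Rhin–Viola group of the family `L(p)`, `p ∈ 𝓔`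
    IsRhinViolaGroup (fun p : E n => L (p : Param n)) (G hn) ∧
    -- effect of the three generators on `L(p)`, valid also when it is infinite
    (∀ p : E n, L (sigma hn p : Param n) = L (p : Param n)) ∧
    (∀ p : E n, L (psi hn p : Param n) = L (p : Param n)) ∧
    (∀ p : E n, 0 ≤ p.1.a (n - 1) → 0 ≤ p.1.b (n - 1) → 0 ≤ p.1.c n →
      0 ≤ p.1.a (n - 1) + p.1.b (n - 1) - p.1.c n →
      L (p : Param n) = fact (p.1.a (n - 1)) * fact (p.1.b (n - 1)) /
        (fact (p.1.c n) * fact (p.1.a (n - 1) + p.1.b (n - 1) - p.1.c n)) *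
          L (phi hn p : Param n)) ∧
    -- `n ≥ 4`
    (4 ≤ n →
      Nonempty (G hn ≃*
        (Equiv.Perm (Fin 3) × Equiv.Perm (Fin 3)) ⋊[swapAction (Equiv.Perm (Fin 3))]
          Multiplicative (ZMod 2)) ∧
      Nat.card (G hn) = 72) ∧
    (5 ≤ n → LeavesStable (fun p : E n => L (p : Param n)) (G hn)
      fun p => [p.1.a (n - 1), p.1.b (n - 1), p.1.a 2, p.1.b 3]) ∧
    (n = 4 → LeavesStable (fun p : E n => L (p : Param n)) (G hn)
      fun p => [p.1.a 3, p.1.b 3, p.1.a 2]) ∧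
    -- `n = 3`
    (n = 3 →
      Nonempty (G hn ≃* Multiplicative H ⋊[permAction] Equiv.Perm (Fin 5)) ∧
      LeavesStable (fun p : E n => L (p : Param n)) (G hn)
        fun p => [p.1.a 1, p.1.a 2, p.1.a 3, p.1.b 1, p.1.b 2, p.1.b 3,
          p.1.a 2 + p.1.b 3 - p.1.c 3, p.1.b 1 + p.1.b 3 - p.1.c 3]) ∧
    -- `n = 2`
    (n = 2 →
      Nonempty (G hn ≃* Equiv.Perm (Fin 5)) ∧
      LeavesStable (fun p : E n => L (p : Param n)) (G hn)
        fun p => [p.1.a 1, p.1.a 2, p.1.b 1, p.1.b 2, p.1.a 1 + p.1.b 2 - p.1.c 2]) := by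
  have hRV : IsRhinViolaGroup (fun p : E n => L (p : Param n)) (G hn) := by
    obtain rfl | rfl | rfl | h5 : n = 2 ∨ n = 3 ∨ n = 4 ∨ 5 ≤ n := by omega
    · exact (rhinViola_two hn).1
    · exact (rhinViola_three hn).1
    · exact (rhinViola_four hn).1
    · exact (rhinViola_general hn h5).1
  refine ⟨hRV, L_sigma hn, L_psi hn, fun p ha hb hc hd => L_phiMap hn p.2 ha hb hc hd, ?_, ?_, ?_,
    ?_, ?_⟩
  · intro h4
    obtain ⟨e⟩ := nonempty_G_mulEquiv hn h4
    exact ⟨⟨e⟩, (Nat.card_congr e.toEquiv).trans card_wreath⟩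
  · exact fun h5 => (rhinViola_general hn h5).2
  · rintro rfl
    exact (rhinViola_four hn).2
  · rintro rfl
    exact ⟨nonempty_G_three_mulEquiv hn, (rhinViola_three hn).2⟩
  · rintro rfl
    exact ⟨nonempty_G_two_mulEquiv hn, (rhinViola_two hn).2⟩
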